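/- Fix the dimension $n\ge 1$. Let $f_0,\dots,f_m:\mathbb{R}^n\to\mathbb{R}$ be quasi-convex (all sublevel sets $\{x : f_i(x)\le\alpha\}$ are convex), let $\varepsilon>0$ be real, and for $\delta\in\mathbb{R}$ put $K_\delta=\{x\in\mathbb{R}^n : f_i(x)\le\delta \text{ for all } i=0,\dots,m\}$. Let $B,\Delta\ge 1$ be integers with $K_0,K_\varepsilon\subset[-B,B]^n$. A rational point has precision at most $\Delta$ if it can be written as $(p_1/q,\dots,p_n/q)$ with integers $p_j$ and $1\le q\le\Delta$. Assume that the following oracles are available. Evaluation oracles: for an index $i$, a rational point $x$ and rationals $r,s$, the oracle tells whether $f_i(x)\le r+s\varepsilon$. $\Delta$-feasibility oracle: for $P=[-B,B]^n\cap A$ with a rational affine space $A$, the oracle returns a point of $P\cap K_{\varepsilon/2}$ with precision at most $\Delta$, or certifies that $P\cap K_0$ contains no point with precision at most $\Delta$. Separating hyperplane oracle: for a rational affine space $A$ and a rational point $a\in A$, the oracle returns either that $a\in K_\varepsilon$, or a vector $c\in\mathbb{Q}^n$ with $\|c\|_\infty=1$ and $c^{\mathsf T}x\le c^{\mathsf T}a$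 for all $x\in K_{\varepsilon/2}\cap A$; if $A\ne\{a\}$ and $K_{\varepsilon/2}\cap A\neq\emptyset$, then $x\mapsto c^{\mathsf T}x$ is not constant on $A$, so that $\{x\in A: c^{\mathsf T}x=c^{\mathsf T}a\}$ is a hyperplane of $A$. As usual for oracles, the encoding length of $c$ is bounded by a fixed polynomial in the encoding length of the query, $\log B$ and $\log\Delta$. Linear integer optimization oracle: for a rational polytope $P$ and a linear objective function, the oracle returns a point of $P\cap\mathbb{Z}^n$ with minimum objective value, or certifies that $P\cap\mathbb{Z}^n=\emptyset$. Then there is an algorithm (a program of a random access machine with logarithmic cost and with calls to these oracles, depending only on $n$) which, given $B$, $\Delta$, $m$ and the oracles, either finds a point $z\in K_\varepsilon\cap\mathbb{Z}^n$ or correctly reports that $K_0\cap\mathbb{Z}^n=\emptyset$. Its running time, in which an oracle call is charged the encoding length of the query and of the answer, is bounded by a polynomial in $\log B$ and $\log\Delta$ that depends only on $n$ and on the polynomial bounding the answers of the separating hyperplane oracle. -/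

import Mathlib

open scoped BigOperators

namespace ConvexIntMin

/-! ## Level sets, boxes, affine spaces and polyhedra -/

/-- The set of all `x` with `f i x ≤ δ` for all `i`; for `δ = 0, ε, ε / 2` these are the sets
`K_0`, `K_ε`, `K_{ε/2}`. -/
def levelSet {n m : ℕ} (f : Fin (m + 1) → (Fin n → ℝ) → ℝ) (δ : ℝ) : Set (Fin n → ℝ) :=
  {x | ∀ i, f i x ≤ δ}

/-- The box `[-B, B]^n`. -/
def box (n B : ℕ) : Set (Fin n → ℝ) :=
  {x | ∀ j, -(B : ℝ) ≤ x j ∧ x j ≤ B}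

/-- An integer row `(α, β)`, which stands for the equation `α · x = β` or the inequality
`α · x ≤ β`. -/
abbrev Row (n : ℕ) : Type := (Fin n → ℤ) × ℤ

/-- The real vector with the given rational coordinates. -/
def ratPoint {n : ℕ} (x : Fin n → ℚ) : Fin n → ℝ := fun j => (x j : ℝ)

/-- The real vector with the given integer coordinates. -/
def intPoint {n : ℕ} (z : Fin n → ℤ) : Fin n → ℝ := fun j => (z j : ℝ)

/-- The affine space given by a finite system of equations `α · x = β`. -/
def affineSpace {n : ℕ} (S : List (Row n)) : Set (Fin n → ℝ) :=
  {x | ∀ r ∈ S, ∑ j, (r.1 j : ℝ) * x j = r.2}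

/-- The polyhedron given by a finite system of inequalities `α · x ≤ β`; it is a polytope
when it is bounded. -/
def polyhedron {n : ℕ} (S : List (Row n)) : Set (Fin n → ℝ) :=
  {x | ∀ r ∈ S, ∑ j, (r.1 j : ℝ) * x j ≤ r.2}

/-- The rational vector `x` has precision at most `Δ`: it can be written as
`(p_1 / q, …, p_n / q)` with integers `p_j` and a denominator `1 ≤ q ≤ Δ`. -/
def PrecisionLE {n : ℕ} (Δ : ℕ) (x : Fin n → ℚ) : Prop :=
  ∃ q : ℕ, 1 ≤ q ∧ q ≤ Δ ∧ ∀ j, ∃ p : ℤ, x j = (p : ℚ) / (q : ℚ)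

/-! ## Binary encoding sizes -/

/-- Number of binary digits of an integer. -/
def bits (z : ℤ) : ℕ := Nat.size z.natAbs

/-- Encoding size of a list of integers. -/
def listSize (l : List ℤ) : ℕ := (l.map fun z => 1 + bits z).sum

/-- A rational vector as the list `num, den, num, den, …` (fractions in lowest terms). -/
def encodeRat {n : ℕ} (x : Fin n → ℚ) : List ℤ :=
  (List.ofFn x).flatMap fun q => [q.num, (q.den : ℤ)]

/-- Encoding size of a system of rows. -/
def systemSize {n : ℕ} (S : List (Row n)) : ℕ :=
  (S.map fun r => listSize (List.ofFn r.1) + listSize [r.2]).sum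

/-! ## The oracles -/

/-- The four oracles, as functions from queries to answers.
* `eval i x r s` compares the value `f i x` with the threshold `r + s * ε` (a real value is
  accessible to a machine only through such comparisons).
* `feas S` is asked about the intersection of the box `[-B, B]^n` with the affine space of `S`.
  The answer `none` certifies that there is no suitable point.
* `sep S a` is asked about the affine space of `S` and its point `a`.
  The answer `none` asserts that `a` is in `K_ε`.
* `opt S h` is asked to minimize `h · x` over the integer points of the polytope of `S`.
  The answer `none` certifies that there is no integer point. -/
structure Oracles (n m : ℕ) where
  eval : Fin (m + 1) → (Fin n → ℚ) → ℚ → ℚ → Bool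
  feas : List (Row n) → Option (Fin n → ℚ)
  sep : List (Row n) → (Fin n → ℚ) → Option (Fin n → ℚ)
  opt : List (Row n) → (Fin n → ℤ) → Option (Fin n → ℤ)

/-- The specification of the oracles for the functions `f`. Nothing is assumed about answers to
improper queries (a point outside the affine space, an unbounded polyhedron). -/
structure Oracles.Valid {n m : ℕ} (O : Oracles n m) (f : Fin (m + 1) → (Fin n → ℝ) → ℝ)
    (ε : ℝ) (B Δ : ℕ) : Prop where
  /-- Evaluation. -/
  eval_iff : ∀ i x r s, O.eval i x r s = true ↔ f i (ratPoint x) ≤ (r : ℝ) + (s : ℝ) * ε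
  /-- Feasibility: a returned point. -/
  feas_some : ∀ S x, O.feas S = some x →
    ratPoint x ∈ box n B ∧ ratPoint x ∈ affineSpace S ∧ ratPoint x ∈ levelSet f (ε / 2) ∧
      PrecisionLE Δ x
  /-- Feasibility: a negative answer. -/
  feas_none : ∀ S, O.feas S = none → ∀ x : Fin n → ℚ, PrecisionLE Δ x →
    ratPoint x ∈ box n B → ratPoint x ∈ affineSpace S → ratPoint x ∉ levelSet f 0
  /-- Separation: the answer that the point is in `K_ε`. -/
  sep_none : ∀ S a, ratPoint a ∈ affineSpace S → O.sep S a = none →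
    ratPoint a ∈ levelSet f ε
  /-- Separation: a returned vector has maximum norm `1`. -/
  sep_norm : ∀ S a c, ratPoint a ∈ affineSpace S → O.sep S a = some c →
    (∀ j, |c j| ≤ 1) ∧ ∃ j, |c j| = 1
  /-- Separation: a returned vector separates. -/
  sep_le : ∀ S a c, ratPoint a ∈ affineSpace S → O.sep S a = some c →
    ∀ x ∈ levelSet f (ε / 2) ∩ affineSpace S,
      ∑ j, (c j : ℝ) * x j ≤ ∑ j, (c j : ℝ) * ratPoint a j
  /-- Separation: a returned vector defines a hyperplane of the affine space, provided that this
  space is not a single point and that there is something to separate. -/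
  sep_proper : ∀ S a c, ratPoint a ∈ affineSpace S → O.sep S a = some c →
    affineSpace S ≠ {ratPoint a} → (levelSet f (ε / 2) ∩ affineSpace S).Nonempty →
      ∃ x ∈ affineSpace S, ∑ j, (c j : ℝ) * x j ≠ ∑ j, (c j : ℝ) * ratPoint a j
  /-- Linear integer optimization: a returned point. -/
  opt_some : ∀ S h z, Bornology.IsBounded (polyhedron S) → O.opt S h = some z →
    intPoint z ∈ polyhedron S ∧
      ∀ w : Fin n → ℤ, intPoint w ∈ polyhedron S → ∑ j, h j * z j ≤ ∑ j, h j * w j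
  /-- Linear integer optimization: a negative answer. -/
  opt_none : ∀ S h, Bornology.IsBounded (polyhedron S) → O.opt S h = none →
    ∀ w : Fin n → ℤ, intPoint w ∉ polyhedron S

/-- The usual convention for oracles: the length of an answer is bounded by a fixed polynomial
in the length of the query and of the data `B`, `Δ`. It is needed only for the separating
vectors, as nothing else bounds their encoding size. -/
def Oracles.SepPolySize {n m : ℕ} (O : Oracles n m) (B Δ C d : ℕ) : Prop :=
  ∀ S a c, ratPoint a ∈ affineSpace S → O.sep S a = some c →
    listSize (encodeRat c) ≤
      C * (systemSize S + listSize (encodeRat a) + Nat.log 2 B + Nat.log 2 Δ + 1) ^ d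

/-! ## Programs: a random access machine with logarithmic cost and oracle calls

A program works on countably many integer arrays. The cost of an operation is the number of
binary digits of the numbers involved, addresses included. -/

/-- The memory: `σ x i` is cell `i` of array `x`. -/
abbrev State : Type := ℕ → ℤ → ℤ

/-- Integer expressions; `div` is integer division. -/
inductive Expr : Type
  | const (z : ℤ)
  | get (x : ℕ) (i : Expr)
  | add (a b : Expr)
  | sub (a b : Expr)
  | mul (a b : Expr)
  | div (a b : Expr)

/-- Value of an expression. -/
def Expr.val (σ : State) : Expr → ℤ
  | .const z => z
  | .get x i => σ x (i.val σ)
  | .add a b => a.val σ + b.val σ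
  | .sub a b => a.val σ - b.val σ
  | .mul a b => a.val σ * b.val σ
  | .div a b => a.val σ / b.val σ

/-- Cost of evaluating an expression: every node costs one plus the number of binary digits of
its value. -/
def Expr.cost (σ : State) : Expr → ℕ
  | .const z => 1 + bits z
  | .get x i => 1 + bits (σ x (i.val σ)) + i.cost σ
  | .add a b => 1 + bits (a.val σ + b.val σ) + a.cost σ + b.cost σ
  | .sub a b => 1 + bits (a.val σ - b.val σ) + a.cost σ + b.cost σ
  | .mul a b => 1 + bits (a.val σ * b.val σ) + a.cost σ + b.cost σ
  | .div a b => 1 + bits (a.val σ / b.val σ) + a.cost σ + b.cost σ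

/-- The kinds of oracle calls. -/
inductive Call : Type
  | eval
  | feas
  | sep
  | opt

/-- Programs. `cond e p q` and `loop e p` test whether `0 < e`; `call c x y` sends the query
stored in array `x` to an oracle and stores the answer in array `y`. -/
inductive Prog : Type
  | skip
  | assign (x : ℕ) (i e : Expr)
  | seq (p q : Prog)
  | cond (e : Expr) (p q : Prog)
  | loop (e : Expr) (p : Prog)
  | call (c : Call) (x y : ℕ)

/-- The fraction stored in cells `s`, `s + 1`. -/
def readRat (a : ℤ → ℤ) (s : ℤ) : ℚ := (a s : ℚ) / (a (s + 1) : ℚ)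

/-- The rational vector stored in the `2 * n` cells from `s` on. -/
def readRatVec (n : ℕ) (a : ℤ → ℤ) (s : ℤ) : Fin n → ℚ := fun j => readRat a (s + 2 * (j : ℕ))

/-- The integer vector stored in the `n` cells from `s` on. -/
def readIntVec (n : ℕ) (a : ℤ → ℤ) (s : ℤ) : Fin n → ℤ := fun j => a (s + (j : ℕ))

/-- The system of `k` rows stored, row by row, in the `k * (n + 1)` cells from `s` on. -/
def readSystem (n : ℕ) (a : ℤ → ℤ) (s : ℤ) (k : ℕ) : List (Row n) :=
  (List.range k).map fun i =>
    (readIntVec n a (s + (i : ℤ) * (n + 1)), a (s + (i : ℤ) * (n + 1) + n))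

/-- Number of cells of the query stored in an array, from cell `0` on.
* `eval`: index of the function, two fractions `r`, `s`, and a rational vector;
* `feas`: number of equations, and the equations;
* `sep`: number of equations, a rational vector, and the equations;
* `opt`: number of inequalities, an integer objective vector, and the inequalities. -/
def queryLength (n : ℕ) (a : ℤ → ℤ) : Call → ℕ
  | .eval => 5 + 2 * n
  | .feas => 1 + (a 0).toNat * (n + 1)
  | .sep => 1 + 2 * n + (a 0).toNat * (n + 1)
  | .opt => 1 + n + (a 0).toNat * (n + 1)

/-- Encoding size of the query stored in an array. -/
def querySize (n : ℕ) (a : ℤ → ℤ) (c : Call) : ℕ :=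
  listSize ((List.range (queryLength n a c)).map fun t => a (t : ℤ))

/-- Encoding of an optional answer: `0` for `none`, and `1` followed by the answer otherwise. -/
def encodeOption {α : Type} (enc : α → List ℤ) : Option α → List ℤ
  | none => [0]
  | some v => 1 :: enc v

/-- The answer of the oracle to the query stored in an array, as a list of integers. -/
def Oracles.reply {n m : ℕ} (O : Oracles n m) (a : ℤ → ℤ) : Call → List ℤ
  | .eval =>
      if h : 0 ≤ a 0 ∧ (a 0).toNat < m + 1 then
        if O.eval ⟨(a 0).toNat, h.2⟩ (readRatVec n a 5) (readRat a 1) (readRat a 3) = true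
        then [1] else [0]
      else [0]
  | .feas => encodeOption encodeRat (O.feas (readSystem n a 1 (a 0).toNat))
  | .sep => encodeOption encodeRat
      (O.sep (readSystem n a (1 + 2 * n) (a 0).toNat) (readRatVec n a 1))
  | .opt => encodeOption List.ofFn
      (O.opt (readSystem n a (1 + n) (a 0).toNat) (readIntVec n a 1))

/-- Overwrites the cells `0, 1, …` of an array by the entries of a list. -/
def writeList (a : ℤ → ℤ) (l : List ℤ) : ℤ → ℤ :=
  fun t => if 0 ≤ t then l.getD t.toNat (a t) else a t

/-- `Exec O p σ τ t`: with the oracles `O`, the program `p` started in the memory `σ` terminates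
with the memory `τ`, and the run costs `t`. -/
inductive Exec {n m : ℕ} (O : Oracles n m) : Prog → State → State → ℕ → Prop
  | skip (σ : State) : Exec O .skip σ σ 1
  | assign (x : ℕ) (i e : Expr) (σ : State) :
      Exec O (.assign x i e) σ
        (Function.update σ x (Function.update (σ x) (i.val σ) (e.val σ)))
        (1 + i.cost σ + e.cost σ)
  | seq {p q : Prog} {σ τ υ : State} {s t : ℕ} :
      Exec O p σ τ s → Exec O q τ υ t → Exec O (.seq p q) σ υ (1 + s + t)
  | cond_pos {e : Expr} {p q : Prog} {σ τ : State} {t : ℕ} :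
      0 < e.val σ → Exec O p σ τ t → Exec O (.cond e p q) σ τ (1 + e.cost σ + t)
  | cond_neg {e : Expr} {p q : Prog} {σ τ : State} {t : ℕ} :
      ¬ 0 < e.val σ → Exec O q σ τ t → Exec O (.cond e p q) σ τ (1 + e.cost σ + t)
  | loop_pos {e : Expr} {p : Prog} {σ τ υ : State} {s t : ℕ} :
      0 < e.val σ → Exec O p σ τ s → Exec O (.loop e p) τ υ t →
        Exec O (.loop e p) σ υ (1 + e.cost σ + s + t)
  | loop_neg {e : Expr} {p : Prog} {σ : State} :
      ¬ 0 < e.val σ → Exec O (.loop e p) σ σ (1 + e.cost σ)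
  | call (c : Call) (x y : ℕ) (σ : State) :
      Exec O (.call c x y) σ
        (Function.update σ y (writeList (σ y) (O.reply (σ x) c)))
        (1 + querySize n (σ x) c + listSize (O.reply (σ x) c))

/-- The initial memory: the numbers `B`, `Δ`, `m` in cell `0` of the arrays `0`, `1`, `2`, and
zeros elsewhere. -/
def initState (B Δ m : ℕ) : State := fun x i =>
  if i = 0 then
    if x = 0 then (B : ℤ) else if x = 1 then (Δ : ℤ) else if x = 2 then (m : ℤ) else 0
  else 0

/-- The output in array `0` is correct: either cell `0` is `1` and the cells `1, …, n` hold an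
integer point of `K_ε`, or cell `0` is `0` and `K_0` has no integer point. -/
def CorrectOutput {n m : ℕ} (f : Fin (m + 1) → (Fin n → ℝ) → ℝ) (ε : ℝ) (σ : State) : Prop :=
  (σ 0 0 = 1 ∧ intPoint (readIntVec n (σ 0) 1) ∈ levelSet f ε) ∨
  (σ 0 0 = 0 ∧ ∀ z : Fin n → ℤ, intPoint z ∉ levelSet f 0)

end ConvexIntMin

namespace ConvexIntMin

/-! ### Geometry of numbers: density in tori, short vectors, flatness, halving. -/

/-! ## Finite subgroups of the torus -/

/-! The algorithm recurses on the dimension k of an affine space given by n - k independent integer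
equations (`Solves`). In dimension 0 the space is one point. If that point is integral and in the
box, the feasibility oracle decides the matter. For k ≥ 1, a level keeps a polytope (box, equations,
cuts) containing every integer point of K_0 in the space. Progress is measured by the number of
integer points of this polytope, at most (2B + 1)^n. A round either settles the problem, possibly by
handing boundedly many hyperplanes to the next level, or removes a fixed fraction of the points.
Hence O(log B) rounds suffice.

In a round, let o be an integer point of the polytope. Choose successively short integer directions
ℓ_i, orthogonal to the equations and to the earlier edges w_j = v_j - o, and integer points v_i of
the polytope maximizing |ℓ_i · (x - o)|. Such directions exist by Siegel's lemma
(`exists_orthogonal`). If ℓ_i is constant on the integer points, one hyperplane contains all of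
them. Otherwise the matrix (ℓ_i · w_j) is triangular and dominated by its diagonal (`Frame`). The
simplex with vertices o and v_j then has its integer points in the polytope, while all integer
points of the polytope lie in the box |ℓ_i · (x - o)| ≤ ℓ_i · w_i. By back substitution, box and
simplex differ only by a factor depending on k (`sum_abs_le_of_triangular`).

Now there are two cases, according to whether the small copy of the box around the centroid of the
simplex contains a lattice point a of the space.

If it does, a is given to the separation oracle. Unless a is in K_ε or the set to be separated is
empty, a separating hyperplane through a results. The next level treats the hyperplane itself, and
by integrality the remaining points lie at least one unit below it. A whole small box around a is
contained in the simplex. By pigeonhole, the translates of the cells of a grid to a, each reflected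
where necessary, show that the discarded halfspace contains a constant fraction of all integer
points (`Frame.card_le_mul_card_halfspace`).

If it does not, the lattice is flat. Modulo the sublattice spanned by the w_j it becomes a finite
subgroup of a k-dimensional torus that misses a neighbourhood of a point. A positive trigonometric
kernel shows that a nonzero character of bounded frequency annihilates such a subgroup
(`exists_frequency_bound`). The character is an integral functional g on the lattice with |g · w_j|
≤ M, not zero on all w_j. It extends to a short integer vector (`exists_flatness_bound`), and g · (z
- o) takes at most 2^(k+1) M + 1 values on the polytope.

Every auxiliary object (o, ℓ_i, v_i, a, g) is found by the integer optimization oracle. All vectors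
have polynomially many digits, and the recursion has depth n, so composing the cost bounds keeps
them polynomial. -/

lemma exists_pow_mul_pow_lt_one (k : ℕ) {ρ : ℝ} (h0 : 0 ≤ ρ) (h1 : ρ < 1) :
    ∃ m : ℕ, (2 * (m : ℝ) + 1) ^ k * ρ ^ m < 1 := by
  have ht := tendsto_pow_const_mul_const_pow_of_abs_lt_one k (r := ρ) (by rwa [abs_of_nonneg h0])
  have h3 : (0 : ℝ) < 1 / 3 ^ k := by positivity
  obtain ⟨m, hm, hm1⟩ := ((ht.eventually (gt_mem_nhds h3)).and
    (Filter.eventually_ge_atTop 1)).exists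
  refine ⟨m, ?_⟩
  have hm1' : (1 : ℝ) ≤ m := by exact_mod_cast hm1
  calc (2 * (m : ℝ) + 1) ^ k * ρ ^ m ≤ (3 * m) ^ k * ρ ^ m := by
        gcongr; linarith
    _ = 3 ^ k * ((m : ℝ) ^ k * ρ ^ m) := by ring
    _ < 3 ^ k * (1 / 3 ^ k) := by gcongr
    _ = 1 := by field_simp

/-- This kernel factor depends only on the distance of t to the nearest integer, and decreases in
that distance on [0, 1/2]. -/
lemma one_add_cos_le {N : ℕ} (hN : 2 ≤ N) {t : ℝ} (ht : ∀ p : ℤ, 1 / (N : ℝ) < |t - p|) :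
    (1 + Real.cos (2 * Real.pi * t)) / 2 ≤ (1 + Real.cos (2 * Real.pi / N)) / 2 := by
  have h1 := ht (round t)
  have h2 := abs_sub_round t
  have hpi := Real.pi_pos
  have hN' : (0 : ℝ) < N := by positivity
  have h3 : Real.cos (2 * Real.pi * t) = Real.cos (2 * Real.pi * |t - round t|) := by
    rw [← abs_of_pos (show 0 < 2 * Real.pi by positivity), ← abs_mul, Real.cos_abs,
      abs_of_pos (show 0 < 2 * Real.pi by positivity), ← Real.cos_sub_int_mul_two_pi _ (round t)]
    congr 1; ring
  have h4 : Real.cos (2 * Real.pi * |t - round t|) ≤ Real.cos (2 * Real.pi / N) := by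
    apply Real.cos_le_cos_of_nonneg_of_le_pi
    · positivity
    · nlinarith
    · rw [div_eq_mul_one_div]; gcongr
  linarith

/-- With u = exp(iθ) the base is (1 + u)² / (4u), so the binomial theorem gives frequencies between
-m and m. The constant coefficient, at a = m, is the central binomial coefficient over 4^m. -/
lemma one_add_cos_pow_eq (m : ℕ) (θ : ℝ) :
    (((((1 + Real.cos θ) / 2) ^ m : ℝ)) : ℂ) =
      ∑ a ∈ Finset.range (2 * m + 1), ((2 * m).choose a / 4 ^ m : ℂ) *
        Complex.exp (θ * Complex.I) ^ ((a : ℤ) - m) := by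
  set u := Complex.exp (θ * Complex.I) with hu
  have hu0 : u ≠ 0 := Complex.exp_ne_zero _
  have h1 : ((1 + Real.cos θ) / 2 : ℂ) = (1 + u) ^ 2 / (4 * u) := by
    have : (Real.cos θ : ℂ) = (u + u⁻¹) / 2 := by
      rw [Complex.ofReal_cos, Complex.cos, hu, ← Complex.exp_neg, neg_mul]
    rw [this]; field_simp; ring
  push_cast at h1 ⊢
  rw [h1, div_pow, ← pow_mul, add_comm 1 u, add_pow, Finset.sum_div]
  refine Finset.sum_congr rfl fun a _ => ?_
  rw [zpow_sub₀ hu0, mul_pow, zpow_natCast, zpow_natCast]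
  field_simp
  simp

lemma addChar_map_sum {ι A : Type*} [AddCommMonoid A] (ψ : AddChar A ℂ) (s : Finset ι)
    (v : ι → A) : ψ (∑ i ∈ s, v i) = ∏ i ∈ s, ψ (v i) := by
  classical
  induction s using Finset.induction_on with
  | empty => simp
  | insert a s ha ih => rw [Finset.sum_insert ha, Finset.prod_insert ha, ψ.map_add_eq_mul, ih]

/-- A finite subgroup of the torus that is not `1 / N`-dense is annihilated by a nonzero character
of bounded frequency. -/
theorem exists_frequency_bound (k N : ℕ) (hN : 2 ≤ N) : ∃ M : ℕ, ∀ (Q : ℕ) [NeZero Q]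
    (G : AddSubgroup (Fin k → ZMod Q)),
    (∀ h : Fin k → ℤ, (∀ i, |h i| ≤ M) → (∀ g ∈ G, ∑ i, (h i : ZMod Q) * g i = 0) → h = 0) →
    ∀ x : Fin k → ℝ, ∃ g ∈ G, ∀ i, ∃ p : ℤ, |x i - ((g i).val : ℝ) / Q - p| ≤ 1 / N := by
  set ρ : ℝ := (1 + Real.cos (2 * Real.pi / N)) / 2 with hρ
  have hρ0 : 0 ≤ ρ := by have := Real.neg_one_le_cos (2 * Real.pi / N); linarith
  have hρ1 : ρ < 1 := by
    have h : Real.cos (2 * Real.pi / N) < 1 := by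
      rw [← Real.cos_zero]
      have hN' : (2 : ℝ) ≤ N := by exact_mod_cast hN
      have hpi := Real.pi_pos
      apply Real.cos_lt_cos_of_nonneg_of_le_pi le_rfl
      · rw [div_le_iff₀ (by linarith)]; nlinarith
      · positivity
    linarith
  -- The mean of the kernel will be at least (2m + 1)^(-k), whereas its values at points not near x
  -- are at most ρ^m; m is chosen so that these contradict each other.
  obtain ⟨m, hm⟩ := exists_pow_mul_pow_lt_one k hρ0 hρ1
  refine ⟨m, fun Q _ G hG x => ?_⟩
  by_contra hcon
  push Not at hcon
  classical
  -- A nonnegative kernel centred at x. If g is far from x in some coordinate, that factor is at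
  -- most ρ^m and the others are at most 1.
  let F : (Fin k → ZMod Q) → ℝ := fun g =>
    ∏ i, ((1 + Real.cos (2 * Real.pi * (x i - ((g i).val : ℝ) / Q))) / 2) ^ m
  have hf0 : ∀ t : ℝ, 0 ≤ (1 + Real.cos t) / 2 := fun t => by
    have := Real.neg_one_le_cos t; linarith
  have hf1 : ∀ t : ℝ, (1 + Real.cos t) / 2 ≤ 1 := fun t => by
    have := Real.cos_le_one t; linarith
  have hFle : ∀ g ∈ G, F g ≤ ρ ^ m := by
    intro g hg
    obtain ⟨i, hi⟩ := hcon g hg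
    rw [show F g = _ from (Finset.mul_prod_erase Finset.univ _ (Finset.mem_univ i)).symm]
    calc _ ≤ ρ ^ m * 1 := by
          apply mul_le_mul
          · exact pow_le_pow_left₀ (hf0 _) (one_add_cos_le hN hi) _
          · exact Finset.prod_le_one (fun j _ => pow_nonneg (hf0 _) _)
              (fun j _ => pow_le_one₀ (hf0 _) (hf1 _))
          · exact Finset.prod_nonneg (fun j _ => pow_nonneg (hf0 _) _)
          · positivity
      _ = ρ ^ m := mul_one _
  let e : Fin k → ℂ := fun i => Complex.exp ((2 * Real.pi * x i : ℝ) * Complex.I)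
  let ψ : AddChar (ZMod Q) ℂ := ZMod.stdAddChar
  have hexp : ∀ g : Fin k → ZMod Q, ∀ i,
      Complex.exp ((2 * Real.pi * (x i - ((g i).val : ℝ) / Q) : ℝ) * Complex.I) =
        e i * ψ (-(g i)) := by
    intro g i
    have h1 : ψ (-(g i)) = Complex.exp (-(2 * Real.pi * Complex.I * (g i).val / Q)) := by
      have h2 : -(g i) = (((-((g i).val : ℤ)) : ℤ) : ZMod Q) := by simp
      rw [h2]
      simp only [ψ]
      rw [ZMod.stdAddChar_coe]
      congr 1; push_cast; ring
    rw [h1]; simp only [e]; rw [← Complex.exp_add]; congr 1; push_cast; ring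
  -- Fourier coefficients of `F`; the index a stands for the frequency a - m, which is at most m in
  -- absolute value.
  let w : (Fin k → ℕ) → ℂ := fun a =>
    ∏ i, ((2 * m).choose (a i) / 4 ^ m : ℂ) * e i ^ ((a i : ℤ) - m)
  have hF : ∀ g, (F g : ℂ) = ∑ a ∈ Fintype.piFinset (fun _ : Fin k => Finset.range (2 * m + 1)),
      w a * ψ (-∑ i, (((a i : ℤ) - m : ℤ) : ZMod Q) * g i) := by
    intro g
    simp only [F]
    push_cast
    have : ∀ i, ((1 + Complex.cos (2 * Real.pi * (x i - ((g i).val : ℂ) / Q))) / 2) ^ m =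
        ∑ a ∈ Finset.range (2 * m + 1), ((2 * m).choose a / 4 ^ m : ℂ) *
          (e i ^ ((a : ℤ) - m) * ψ (-((((a : ℤ) - m : ℤ) : ZMod Q) * g i))) := by
      intro i
      have h := one_add_cos_pow_eq m (2 * Real.pi * (x i - ((g i).val : ℝ) / Q))
      rw [hexp] at h
      push_cast at h ⊢
      rw [h]
      refine Finset.sum_congr rfl fun a _ => ?_
      rw [mul_zpow, ← AddChar.map_zsmul_eq_zpow]
      congr 4
      simp
    rw [Finset.prod_congr rfl fun i _ => this i, Finset.prod_univ_sum]
    refine Finset.sum_congr rfl fun a _ => ?_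
    simp only [w]
    rw [← Finset.sum_neg_distrib, addChar_map_sum, ← Finset.prod_mul_distrib]
    refine Finset.prod_congr rfl fun i _ => ?_
    push_cast
    rw [mul_assoc]
  -- Orthogonality of characters: the sum over G vanishes unless the character is trivial on G, and
  -- by `hG` only frequency zero is trivial there. Thus the mean of `F` over G is its constant
  -- coefficient.
  have hchar : ∀ a ∈ Fintype.piFinset (fun _ : Fin k => Finset.range (2 * m + 1)),
      ∑ g : G, ψ (-∑ i, (((a i : ℤ) - m : ℤ) : ZMod Q) * (g : Fin k → ZMod Q) i) =
        if a = fun _ => m then (Fintype.card G : ℂ) else 0 := by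
    intro a ha
    let φ : G →+ ZMod Q :=
      { toFun := fun g => -∑ i, (((a i : ℤ) - m : ℤ) : ZMod Q) * (g : Fin k → ZMod Q) i
        map_zero' := by simp
        map_add' := by
          intro g g'
          simp [mul_add, Finset.sum_add_distrib]; ring }
    have h := AddChar.sum_eq_ite (ψ.compAddMonoidHom φ)
    have h' : ∑ g : G, ψ (-∑ i, (((a i : ℤ) - m : ℤ) : ZMod Q) * (g : Fin k → ZMod Q) i) =
      ∑ g : G, (ψ.compAddMonoidHom φ) g := rfl
    rw [h', h]
    have hiff : ψ.compAddMonoidHom φ = 0 ↔ a = fun _ => m := by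
      constructor
      · intro h0
        have hz := hG (fun i => (a i : ℤ) - m) (fun i => by
          have := Finset.mem_range.1 (Fintype.mem_piFinset.1 ha i)
          rw [abs_le]; constructor <;> omega) (fun g hg => by
          have h2 : ψ (φ ⟨g, hg⟩) = 1 := by
            have := DFunLike.congr_fun h0 ⟨g, hg⟩
            simpa using this
          rw [← ψ.map_zero_eq_one] at h2
          have h3 := ZMod.injective_stdAddChar h2
          simpa [φ] using h3)
        funext i
        have := congrFun hz i
        simp at this
        omega
      · rintro rfl
        ext g
        simp [φ]
    simp only [hiff]
  have hsum : ((∑ g : G, F g : ℝ) : ℂ) =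
      (Fintype.card G : ℂ) * ((2 * m).choose m / 4 ^ m : ℂ) ^ k := by
    push_cast
    simp only [hF]
    rw [Finset.sum_comm]
    simp only [← Finset.mul_sum]
    rw [Finset.sum_congr rfl fun a ha => by rw [hchar a ha]]
    simp only [mul_ite, mul_zero]
    rw [Finset.sum_ite_eq' ]
    rw [if_pos (by simp [Fintype.mem_piFinset]; omega)]
    simp only [w, sub_self, zpow_zero, mul_one, Finset.prod_const, Finset.card_univ,
      Fintype.card_fin]
    ring
  have hsum' : ∑ g : G, F g = (Fintype.card G : ℝ) * ((2 * m).choose m / 4 ^ m : ℝ) ^ k := by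
    apply Complex.ofReal_injective
    rw [hsum]; push_cast; rfl
  have hle : ∑ g : G, F g ≤ Fintype.card G * ρ ^ m := by
    calc ∑ g : G, F g ≤ ∑ _g : G, ρ ^ m := Finset.sum_le_sum fun g _ => hFle g g.2
      _ = _ := by simp
  have hcard : (0 : ℝ) < Fintype.card G := by exact_mod_cast Fintype.card_pos
  rw [hsum'] at hle
  have hle2 := le_of_mul_le_mul_left hle hcard
  -- The central binomial coefficient is the largest of 2m + 1 coefficients with sum 4^m.
  have hcb : 1 ≤ (2 * (m : ℝ) + 1) * ((2 * m).choose m / 4 ^ m : ℝ) := by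
    have := Nat.four_pow_le_two_mul_add_one_mul_central_binom m
    have h' : (4 : ℝ) ^ m ≤ (2 * m + 1) * (2 * m).choose m := by exact_mod_cast this
    rw [mul_div_assoc', le_div_iff₀ (by positivity)]; linarith
  have : (1 : ℝ) ≤ (2 * (m : ℝ) + 1) ^ k * ρ ^ m := by
    calc (1 : ℝ) ≤ ((2 * (m : ℝ) + 1) * ((2 * m).choose m / 4 ^ m : ℝ)) ^ k := one_le_pow₀ hcb
      _ = (2 * (m : ℝ) + 1) ^ k * ((2 * m).choose m / 4 ^ m : ℝ) ^ k := mul_pow _ _ _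
      _ ≤ _ := by gcongr
  linarith

/-! ## Small integer solutions of homogeneous systems -/

open scoped Matrix.Norms.Elementwise in
-- Siegel's lemma. Its exponent m / (n - m) is at most n, which yields a bound uniform in m; without
-- equations the vector of ones will do.
lemma exists_orthogonal {n m : ℕ} (hmn : m < n) (u : Fin m → Fin n → ℤ) (H : ℕ) (hH : 1 ≤ H)
    (hu : ∀ j i, |u j i| ≤ H) :
    ∃ g : Fin n → ℤ, g ≠ 0 ∧ (∀ j, u j ⬝ᵥ g = 0) ∧ ∀ i, |g i| ≤ ((n * H) ^ n : ℕ) := by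
  have hn : 0 < n := by omega
  rcases Nat.eq_zero_or_pos m with rfl | hm
  · refine ⟨fun _ => 1, fun h => ?_, fun j => j.elim0, fun i => ?_⟩
    · simpa using congrFun h ⟨0, hn⟩
    · have : 1 ≤ (n * H) ^ n := Nat.one_le_pow _ _ (Nat.mul_pos hn hH)
      simpa using (by exact_mod_cast this : (1 : ℤ) ≤ ((n * H) ^ n : ℕ))
  · obtain ⟨g, hg0, hg, hb⟩ := Int.Matrix.exists_ne_zero_int_vec_norm_le (Matrix.of u)
      (by simpa using hmn) (by simpa using hm)
    refine ⟨g, hg0, fun j => congrFun hg j, fun i => ?_⟩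
    have h1 : ‖Matrix.of u‖ ≤ H := by
      rw [Matrix.norm_le_iff (by positivity)]
      intro j i
      rw [Int.norm_eq_abs]
      exact_mod_cast hu j i
    have h2 : (1 : ℝ) ≤ n * H := by
      have : 1 ≤ n * H := Nat.mul_pos hn hH
      exact_mod_cast this
    have h3 : ((m : ℝ) / (n - m)) ≤ n := by
      have : (m : ℝ) + 1 ≤ n := by exact_mod_cast hmn
      rw [div_le_iff₀ (by linarith)]
      nlinarith
    have h4 : ‖g‖ ≤ ((n * H : ℝ)) ^ n := by
      refine hb.trans ?_
      simp only [Fintype.card_fin]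
      calc _ ≤ ((n * H : ℝ)) ^ ((m : ℝ) / (n - m)) := by
            have : (m : ℝ) + 1 ≤ n := by exact_mod_cast hmn
            apply Real.rpow_le_rpow (by positivity)
            · gcongr
              exact max_le (by exact_mod_cast hH) h1
            · apply div_nonneg <;> linarith [show (0 : ℝ) ≤ m by positivity]
        _ ≤ ((n * H : ℝ)) ^ (n : ℝ) := Real.rpow_le_rpow_of_exponent_le h2 h3
        _ = _ := Real.rpow_natCast _ _
    have h5 := (norm_le_pi_norm g i).trans h4
    rw [Int.norm_eq_abs] at h5
    exact_mod_cast h5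


/-! ## Frames of lattice vectors -/

lemma intPoint_dotProduct {n : ℕ} (a b : Fin n → ℤ) :
    intPoint a ⬝ᵥ intPoint b = ((a ⬝ᵥ b : ℤ) : ℝ) := by
  simp [intPoint, dotProduct]

lemma intPoint_add {n : ℕ} (a b : Fin n → ℤ) : intPoint (a + b) = intPoint a + intPoint b := by
  ext i; simp [intPoint]

lemma intPoint_sub {n : ℕ} (a b : Fin n → ℤ) : intPoint (a - b) = intPoint a - intPoint b := by
  ext i; simp [intPoint]

lemma intPoint_smul {n : ℕ} (c : ℤ) (a : Fin n → ℤ) :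
    intPoint (c • a) = (c : ℝ) • intPoint a := by
  ext i; simp [intPoint]

lemma intPoint_sum {n : ℕ} {ι : Type*} (s : Finset ι) (a : ι → Fin n → ℤ) :
    intPoint (∑ j ∈ s, a j) = ∑ j ∈ s, intPoint (a j) := by
  ext i; simp [intPoint]

lemma intPoint_injective {n : ℕ} : Function.Injective (intPoint (n := n)) := by
  intro a b h
  ext i
  exact Int.cast_injective (α := ℝ) (congrFun h i)

/-- In a triangular system dominated by its diagonal, the unknowns are bounded. -/
lemma sum_abs_le_of_triangular {k : ℕ} (a : Fin k → Fin k → ℝ) (μ : Fin k → ℝ) (δ : ℝ)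
    (htri : ∀ i j, j < i → a i j = 0) (hpos : ∀ i, 0 < a i i)
    (hle : ∀ i j, |a i j| ≤ a i i) (hμ : ∀ i, |∑ j, a i j * μ j| ≤ δ * a i i) :
    δ + ∑ j, |μ j| ≤ 2 ^ k * δ := by
  induction k with
  | zero => simp
  | succ k ih =>
    have h1 := ih (fun i j => a i.succ j.succ) (fun j => μ j.succ)
      (fun i j hij => htri _ _ (Fin.succ_lt_succ_iff.2 hij)) (fun i => hpos _)
      (fun i j => hle _ _) (fun i => by
        have := hμ i.succ
        rwa [Fin.sum_univ_succ, htri _ _ (Fin.succ_pos i), zero_mul, zero_add] at this)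
    have h2 := hμ 0
    rw [Fin.sum_univ_succ] at h2
    have h3 : |∑ j : Fin k, a 0 j.succ * μ j.succ| ≤ a 0 0 * ∑ j : Fin k, |μ j.succ| := by
      rw [Finset.mul_sum]
      refine (Finset.abs_sum_le_sum_abs _ _).trans (Finset.sum_le_sum fun j _ => ?_)
      rw [abs_mul]
      exact mul_le_mul_of_nonneg_right (hle _ _) (abs_nonneg _)
    have h4 : |a 0 0 * μ 0| ≤ δ * a 0 0 + a 0 0 * ∑ j : Fin k, |μ j.succ| := by
      have := abs_sub (a 0 0 * μ 0 + ∑ j : Fin k, a 0 j.succ * μ j.succ)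
        (∑ j : Fin k, a 0 j.succ * μ j.succ)
      rw [add_sub_cancel_right] at this
      linarith
    rw [abs_mul, abs_of_pos (hpos 0)] at h4
    -- Row 0, divided by its diagonal entry, bounds the first unknown by δ plus the later ones, so
    -- each further unknown at most doubles δ + Σ |μ j|.
    have h5 : |μ 0| ≤ δ + ∑ j : Fin k, |μ j.succ| := by
      refine le_of_mul_le_mul_left ?_ (hpos 0)
      linarith
    rw [Fin.sum_univ_succ, pow_succ]
    linarith

/-- Lattice vectors `w` spanning the orthogonal complement of the vectors `h`, with a triangular
family of functionals `ℓ` that take their largest value on the diagonal. -/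
structure Frame {n r k : ℕ} (h : Fin r → Fin n → ℤ) (w ℓ : Fin k → Fin n → ℤ) : Prop where
  card : r + k = n
  indep : LinearIndependent ℝ fun j => intPoint (h j)
  orth : ∀ l j, h l ⬝ᵥ w j = 0
  tri : ∀ i j, j < i → ℓ i ⬝ᵥ w j = 0
  pos : ∀ i, 0 < ℓ i ⬝ᵥ w i
  le : ∀ i j, |ℓ i ⬝ᵥ w j| ≤ ℓ i ⬝ᵥ w i

namespace Frame

variable {n r k : ℕ} {h : Fin r → Fin n → ℤ} {w ℓ : Fin k → Fin n → ℤ}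

/-- Converts bounds for the functionals ℓ, relative to their diagonal values, into bounds for the
coordinates with respect to w. This is the comparison between the box and the simplex. -/
lemma sum_abs_le (F : Frame h w ℓ) (μ : Fin k → ℝ) (δ : ℝ) (hδ : 0 ≤ δ)
    (hμ : ∀ i, |intPoint (ℓ i) ⬝ᵥ ∑ j, μ j • intPoint (w j)| ≤ δ * (ℓ i ⬝ᵥ w i : ℤ)) :
    ∑ j, |μ j| ≤ 2 ^ k * δ := by
  refine (le_add_of_nonneg_left hδ).trans
    (sum_abs_le_of_triangular (fun i j => ((ℓ i ⬝ᵥ w j : ℤ) : ℝ)) μ δ ?_ ?_ ?_ ?_)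
  · intro i j hij; simp [F.tri i j hij]
  · intro i; exact_mod_cast F.pos i
  · intro i j; exact_mod_cast F.le i j
  · intro i
    have := hμ i
    rw [dotProduct_sum] at this
    simpa only [dotProduct_smul, intPoint_dotProduct, smul_eq_mul, mul_comm] using this

lemma linearIndependent (F : Frame h w ℓ) : LinearIndependent ℝ fun j => intPoint (w j) := by
  rw [Fintype.linearIndependent_iff]
  intro μ hμ i
  have := F.sum_abs_le μ 0 le_rfl (fun i => by simp [hμ])
  have h2 := Finset.single_le_sum (f := fun j => |μ j|) (fun j _ => abs_nonneg _)
    (Finset.mem_univ i)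
  simp only [mul_zero] at this
  exact abs_eq_zero.1 (le_antisymm (h2.trans this) (abs_nonneg _))

lemma sum_dotProduct_sum (F : Frame h w ℓ) (μ : Fin k → ℝ) (c : Fin r → ℝ) :
    (∑ l, c l • intPoint (h l)) ⬝ᵥ (∑ j, μ j • intPoint (w j)) = 0 := by
  rw [sum_dotProduct]
  refine Finset.sum_eq_zero fun l _ => ?_
  rw [dotProduct_sum]
  refine Finset.sum_eq_zero fun j _ => ?_
  rw [smul_dotProduct, dotProduct_smul, intPoint_dotProduct, F.orth]
  simp

/-- The vectors h and w are independent families in orthogonal spaces, and r + k = n, so together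
they form a basis. -/
lemma exists_decomposition (F : Frame h w ℓ) (x : Fin n → ℝ) :
    ∃ (μ : Fin k → ℝ) (c : Fin r → ℝ),
      x = ∑ j, μ j • intPoint (w j) + ∑ l, c l • intPoint (h l) := by
  have hli : LinearIndependent ℝ (Sum.elim (fun j => intPoint (w j)) fun l => intPoint (h l)) := by
    rw [Fintype.linearIndependent_iff]
    intro g hg
    rw [Fintype.sum_sum_type] at hg
    simp only [Sum.elim_inl, Sum.elim_inr] at hg
    have h1 := F.sum_dotProduct_sum (fun j => g (.inl j)) (fun l => g (.inr l))
    have h2 : ∑ l, g (.inr l) • intPoint (h l) = 0 := by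
      rw [eq_neg_of_add_eq_zero_left hg, dotProduct_neg, neg_eq_zero, dotProduct_self_eq_zero] at h1
      exact h1
    have h3 : ∑ j, g (.inl j) • intPoint (w j) = 0 := by rwa [h2, add_zero] at hg
    rintro (j | l)
    · exact Fintype.linearIndependent_iff.1 F.linearIndependent _ h3 j
    · exact Fintype.linearIndependent_iff.1 F.indep _ h2 l
  have hspan := hli.span_eq_top_of_card_eq_finrank' (by simp [← F.card, add_comm])
  have hx : x ∈ Submodule.span ℝ
      (Set.range (Sum.elim (fun j => intPoint (w j)) fun l => intPoint (h l))) := by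
    rw [hspan]; trivial
  obtain ⟨g, hg⟩ := (Submodule.mem_span_range_iff_exists_fun ℝ).1 hx
  refine ⟨fun j => g (.inl j), fun l => g (.inr l), ?_⟩
  rw [← hg, Fintype.sum_sum_type]
  simp

/-- The h-component of x is orthogonal both to x and to the w-component, hence to itself. -/
lemma exists_real_coordinates (F : Frame h w ℓ) {x : Fin n → ℝ}
    (hx : ∀ l, intPoint (h l) ⬝ᵥ x = 0) : ∃ μ : Fin k → ℝ, x = ∑ j, μ j • intPoint (w j) := by
  obtain ⟨μ, c, hdec⟩ := F.exists_decomposition x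
  refine ⟨μ, ?_⟩
  have h1 : (∑ l, c l • intPoint (h l)) ⬝ᵥ x = 0 := by
    rw [sum_dotProduct]
    refine Finset.sum_eq_zero fun l _ => ?_
    rw [smul_dotProduct, hx, smul_zero]
  rw [hdec, dotProduct_add, F.sum_dotProduct_sum, zero_add, dotProduct_self_eq_zero] at h1
  rw [hdec, h1, add_zero]

lemma exists_coordinates (F : Frame h w ℓ) {z : Fin n → ℤ} (hz : ∀ l, h l ⬝ᵥ z = 0) :
    ∃ μ : Fin k → ℝ, intPoint z = ∑ j, μ j • intPoint (w j) :=
  F.exists_real_coordinates fun l => by rw [intPoint_dotProduct, hz]; simp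

/-- A functional that is small on the frame is small on the box given by the frame. -/
lemma abs_dotProduct_le (F : Frame h w ℓ) {z g : Fin n → ℤ} (hz : ∀ l, h l ⬝ᵥ z = 0)
    (hb : ∀ i, |ℓ i ⬝ᵥ z| ≤ ℓ i ⬝ᵥ w i) {M : ℕ} (hM : ∀ j, |g ⬝ᵥ w j| ≤ M) :
    |g ⬝ᵥ z| ≤ 2 ^ k * M := by
  obtain ⟨μ, hμ⟩ := F.exists_coordinates hz
  -- The box condition is the case δ = 1: the coordinates of z have absolute sum at most 2^k.
  have h1 := F.sum_abs_le μ 1 zero_le_one (fun i => by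
    rw [← hμ, intPoint_dotProduct, one_mul]; exact_mod_cast hb i)
  have h2 : ((g ⬝ᵥ z : ℤ) : ℝ) = ∑ j, μ j * (g ⬝ᵥ w j : ℤ) := by
    rw [← intPoint_dotProduct, hμ, dotProduct_sum]
    simp only [dotProduct_smul, intPoint_dotProduct, smul_eq_mul]
  have h3 : |((g ⬝ᵥ z : ℤ) : ℝ)| ≤ 2 ^ k * M := by
    rw [h2]
    calc _ ≤ ∑ j, |μ j| * M := by
          refine (Finset.abs_sum_le_sum_abs _ _).trans (Finset.sum_le_sum fun j _ => ?_)
          rw [abs_mul]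
          gcongr
          exact_mod_cast hM j
      _ = (∑ j, |μ j|) * M := by rw [Finset.sum_mul]
      _ ≤ _ := by gcongr; linarith
  exact_mod_cast h3

open Matrix in
/-- The coordinates in a frame of the lattice vectors orthogonal to `h` have a common
denominator. -/
lemma exists_integral_coordinates (F : Frame h w ℓ) : ∃ (Q : ℕ) (p : Fin k → Fin n → ℤ), 0 < Q ∧
    (∀ i j, p i ⬝ᵥ w j = if i = j then (Q : ℤ) else 0) ∧
    ∀ z, (∀ l, h l ⬝ᵥ z = 0) →
      (Q : ℝ) • intPoint z = ∑ j, ((p j ⬝ᵥ z : ℤ) : ℝ) • intPoint (w j) := by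
  -- Cramer's rule: the triangular matrix a has positive determinant Q, and its adjugate applied to
  -- ℓ gives a family p that is dual to w up to the factor Q.
  let a : Matrix (Fin k) (Fin k) ℤ := Matrix.of fun i j => ℓ i ⬝ᵥ w j
  have hdet : a.det = ∏ i, ℓ i ⬝ᵥ w i := Matrix.det_of_isUpperTriangular (fun i j hij => F.tri i j hij)
  have hdpos : 0 < a.det := by rw [hdet]; exact Finset.prod_pos fun i _ => F.pos i
  let p : Fin k → Fin n → ℤ := fun i => ∑ j, a.adjugate i j • ℓ j
  have hp : ∀ i j, p i ⬝ᵥ w j = if i = j then ((a.det.toNat : ℕ) : ℤ) else 0 := by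
    intro i j
    have h1 := congrFun (congrFun (Matrix.adjugate_mul a) i) j
    rw [Matrix.mul_apply] at h1
    simp only [p, sum_dotProduct, smul_dotProduct, smul_eq_mul]
    rw [Int.toNat_of_nonneg hdpos.le]
    simpa [a, Matrix.one_apply] using h1
  refine ⟨a.det.toNat, p, by omega, hp, fun z hz => ?_⟩
  obtain ⟨μ, hμ⟩ := F.exists_coordinates hz
  have h2 : ∀ i, ((p i ⬝ᵥ z : ℤ) : ℝ) = (a.det.toNat : ℕ) * μ i := by
    intro i
    rw [← intPoint_dotProduct, hμ, dotProduct_sum]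
    simp only [dotProduct_smul, intPoint_dotProduct, hp, smul_eq_mul, Int.cast_ite,
      Int.cast_natCast, Int.cast_zero, mul_ite, mul_zero, Finset.sum_ite_eq, Finset.mem_univ,
      if_true, mul_comm]
  rw [hμ, Finset.smul_sum]
  refine Finset.sum_congr rfl fun j _ => ?_
  rw [h2, smul_smul]

end Frame

/-- The image of ℤ^n under h is a submodule of ℤ^r, hence projective, so the kernel of h is a direct
summand. Composing q with the projection Θ to this summand gives a functional on all of ℤ^n with
values divisible by Q. -/
lemma exists_integral_extension {n r : ℕ} (h : Fin r → Fin n → ℤ) (Q : ℤ) (q : Fin n → ℤ)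
    (hq : ∀ z, (∀ l, h l ⬝ᵥ z = 0) → Q ∣ q ⬝ᵥ z) :
    ∃ g : Fin n → ℤ, ∀ z, (∀ l, h l ⬝ᵥ z = 0) → Q * (g ⬝ᵥ z) = q ⬝ᵥ z := by
  let f : (Fin n → ℤ) →ₗ[ℤ] (Fin r → ℤ) := (Matrix.of h).mulVecLin
  have hf : ∀ z l, f z l = h l ⬝ᵥ z := fun z l => rfl
  obtain ⟨s, hs⟩ := Module.projective_lifting_property f.rangeRestrict
    (LinearMap.id (R := ℤ) (M := LinearMap.range f)) f.surjective_rangeRestrict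
  let Θ : (Fin n → ℤ) →ₗ[ℤ] (Fin n → ℤ) := LinearMap.id - s ∘ₗ f.rangeRestrict
  have hΘ : ∀ z l, h l ⬝ᵥ Θ z = 0 := by
    intro z l
    have h1 : f.rangeRestrict (s (f.rangeRestrict z)) = f.rangeRestrict z :=
      LinearMap.congr_fun hs (f.rangeRestrict z)
    have h2 : f (Θ z) = 0 := by
      have := congrArg Subtype.val h1
      simp only [Θ, LinearMap.sub_apply, LinearMap.id_apply, LinearMap.comp_apply, map_sub]
      rw [sub_eq_zero]
      exact this.symm
    rw [← hf, h2]; rfl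
  have hΘ' : ∀ z, (∀ l, h l ⬝ᵥ z = 0) → Θ z = z := by
    intro z hz
    have h1 : f.rangeRestrict z = 0 := by
      ext l; exact hz l
    simp [Θ, h1]
  choose g hg using fun i : Fin n => hq (Θ (Pi.single i 1)) (hΘ _)
  refine ⟨g, fun z hz => ?_⟩
  let Ψ : (Fin n → ℤ) →ₗ[ℤ] ℤ := (dotProductBilin ℤ ℤ q) ∘ₗ Θ
  have hΨ : ∀ z, Ψ z = q ⬝ᵥ Θ z := fun z => rfl
  have h1 := LinearMap.pi_apply_eq_sum_univ Ψ z
  rw [hΨ, hΘ' z hz] at h1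
  rw [h1, dotProduct, Finset.mul_sum]
  refine Finset.sum_congr rfl fun i _ => ?_
  have : (fun j : Fin n => if i = j then (1 : ℤ) else 0) = Pi.single i 1 := by
    ext j; simp [Pi.single_apply, eq_comm]
  rw [this, hΨ, hg i, smul_eq_mul]
  ring


namespace Frame

variable {n r k : ℕ} {h : Fin r → Fin n → ℤ} {w ℓ : Fin k → Fin n → ℤ}

/-- An integral functional on the lattice of a frame has a small integral extension. -/
lemma exists_small_extension (F : Frame h w ℓ) (g₀ : Fin n → ℤ) (M R H : ℕ)
    (hM : ∀ j, |g₀ ⬝ᵥ w j| ≤ M) (hR : ∀ j i, |ℓ j i| ≤ R) (hH : ∀ l i, |h l i| ≤ H) :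
    ∃ g : Fin n → ℤ, (∀ j, g ⬝ᵥ w j = g₀ ⬝ᵥ w j) ∧
      ∀ i, |g i| ≤ M * 2 ^ k * (n * R) + r * H := by
  obtain ⟨μ, c, hdec⟩ := F.exists_decomposition (intPoint g₀)
  set p : Fin n → ℝ := ∑ j, μ j • intPoint (w j) with hp
  have hhw : ∀ (d : Fin r → ℝ) j, (∑ l, d l • intPoint (h l)) ⬝ᵥ intPoint (w j) = 0 := by
    intro d j
    rw [sum_dotProduct]
    refine Finset.sum_eq_zero fun l _ => ?_
    rw [smul_dotProduct, intPoint_dotProduct, F.orth]; simp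
  have hpw : ∀ j, p ⬝ᵥ intPoint (w j) = ((g₀ ⬝ᵥ w j : ℤ) : ℝ) := by
    intro j
    rw [← intPoint_dotProduct, hdec, add_dotProduct, hhw, add_zero]
  set m := ‖p‖ with hm
  have hm0 : 0 ≤ m := norm_nonneg _
  have hpi : ∀ i, |p i| ≤ m := fun i => norm_le_pi_norm p i
  -- Here δ = n R ‖p‖ is allowed because every ℓ i ⬝ᵥ w i is an integer ≥ 1. Consequently the size
  -- of w does not enter the bound.
  have hμ : ∑ j, |μ j| ≤ 2 ^ k * (n * R * m) := by
    refine F.sum_abs_le μ _ (by positivity) fun i => ?_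
    have h1 : |intPoint (ℓ i) ⬝ᵥ p| ≤ n * R * m := by
      calc |intPoint (ℓ i) ⬝ᵥ p| ≤ ∑ t : Fin n, |intPoint (ℓ i) t * p t| :=
            Finset.abs_sum_le_sum_abs _ _
        _ ≤ ∑ _t : Fin n, (R : ℝ) * m := by
            refine Finset.sum_le_sum fun t _ => ?_
            rw [abs_mul]
            have : |intPoint (ℓ i) t| ≤ R := by
              simp only [intPoint]; exact_mod_cast hR i t
            exact mul_le_mul this (hpi t) (abs_nonneg _) (by positivity)
        _ = n * R * m := by simp; ring
    have h2 : (1 : ℝ) ≤ (ℓ i ⬝ᵥ w i : ℤ) := by exact_mod_cast F.pos i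
    calc _ ≤ n * R * m := h1
      _ = n * R * m * 1 := (mul_one _).symm
      _ ≤ _ := by gcongr
  have hpp : p ⬝ᵥ p ≤ M * 2 ^ k * (n * R) * m := by
    have h1 : p ⬝ᵥ p = ∑ j, μ j * (g₀ ⬝ᵥ w j : ℤ) := by
      conv_lhs => rw [hp, ← hp]
      nth_rewrite 2 [hp]
      rw [dotProduct_sum]
      refine Finset.sum_congr rfl fun j _ => ?_
      rw [dotProduct_smul, hpw, smul_eq_mul]
    rw [h1]
    calc _ ≤ ∑ j, |μ j| * M := by
          refine Finset.sum_le_sum fun j _ => (le_abs_self _).trans ?_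
          rw [abs_mul]
          gcongr
          exact_mod_cast hM j
      _ = (∑ j, |μ j|) * M := by rw [Finset.sum_mul]
      _ ≤ (2 ^ k * (n * R * m)) * M := by gcongr
      _ = _ := by ring
  -- In the maximum norm, ‖p‖² ≤ p ⬝ᵥ p, which `hpp` bounds by a constant times ‖p‖; one factor ‖p‖
  -- cancels.
  have hmT : m ≤ M * 2 ^ k * (n * R) := by
    have h1 : m ≤ Real.sqrt (p ⬝ᵥ p) := by
      rw [hm, pi_norm_le_iff_of_nonneg (Real.sqrt_nonneg _)]
      intro i
      apply Real.le_sqrt_of_sq_le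
      rw [Real.norm_eq_abs, sq_abs, sq]
      exact Finset.single_le_sum (f := fun i => p i * p i)
        (fun j _ => mul_self_nonneg _) (Finset.mem_univ i)
    have h3 : 0 ≤ p ⬝ᵥ p := Finset.sum_nonneg fun j _ => mul_self_nonneg _
    have h2 : m ^ 2 ≤ p ⬝ᵥ p := by
      rw [← Real.sq_sqrt h3]
      gcongr
    by_contra hlt
    push Not at hlt
    have hm1 : 0 < m := lt_of_le_of_lt (by positivity) hlt
    nlinarith
  -- Integer multiples of h do not change values on w. What remains is p plus multiples of h with
  -- fractional coefficients.
  refine ⟨g₀ - ∑ l, ⌊c l⌋ • h l, fun j => ?_, fun i => ?_⟩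
  · rw [sub_dotProduct, sum_dotProduct, Finset.sum_eq_zero, sub_zero]
    intro l _
    rw [smul_dotProduct, F.orth, smul_zero]
  · have h1 : intPoint (g₀ - ∑ l, ⌊c l⌋ • h l) = p + ∑ l, Int.fract (c l) • intPoint (h l) := by
      rw [intPoint_sub, intPoint_sum, hdec, add_sub_assoc, ← Finset.sum_sub_distrib]
      congr 1
      refine Finset.sum_congr rfl fun l _ => ?_
      rw [intPoint_smul, ← sub_smul]; rfl
    have h2 := congrFun h1 i
    have h3 : |intPoint (g₀ - ∑ l, ⌊c l⌋ • h l) i| ≤ M * 2 ^ k * (n * R) + r * H := by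
      rw [h2, Pi.add_apply]
      refine (abs_add_le _ _).trans (add_le_add ((hpi i).trans hmT) ?_)
      rw [Finset.sum_apply]
      calc _ ≤ ∑ l : Fin r, |(Int.fract (c l) • intPoint (h l)) i| :=
            Finset.abs_sum_le_sum_abs _ _
        _ ≤ ∑ _l : Fin r, (H : ℝ) := by
            refine Finset.sum_le_sum fun l _ => ?_
            rw [Pi.smul_apply, smul_eq_mul, abs_mul, abs_of_nonneg (Int.fract_nonneg _)]
            have h4 : |intPoint (h l) i| ≤ H := by
              simp only [intPoint]; exact_mod_cast hH l i
            calc _ ≤ 1 * (H : ℝ) := mul_le_mul (Int.fract_lt_one _).le h4 (abs_nonneg _)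
                  zero_le_one
              _ = H := one_mul _
        _ = r * H := by simp
    simp only [intPoint] at h3
    exact_mod_cast h3

end Frame

/-- Flatness: if the box of a frame, scaled by `1 / N` and centered at the centroid, has no lattice
point, then some integral functional is small on the frame. -/
theorem exists_flatness_bound (k N : ℕ) (hN : 2 ≤ N) : ∃ M : ℕ, ∀ {n r : ℕ}
    {h : Fin r → Fin n → ℤ} {w ℓ : Fin k → Fin n → ℤ}, Frame h w ℓ →
    (∀ z, (∀ l, h l ⬝ᵥ z = 0) →
      ¬ ∀ i, |((k : ℤ) + 1) * N * (ℓ i ⬝ᵥ z) - N * (ℓ i ⬝ᵥ ∑ j, w j)| ≤ (k + 1) * (ℓ i ⬝ᵥ w i)) →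
    ∀ R H : ℕ, (∀ j i, |ℓ j i| ≤ R) → (∀ l i, |h l i| ≤ H) →
    ∃ g : Fin n → ℤ, (∀ j, |g ⬝ᵥ w j| ≤ M) ∧ (∃ j, 1 ≤ g ⬝ᵥ w j) ∧
      ∀ i, |g i| ≤ M * 2 ^ k * (n * R) + r * H := by
  -- Accuracy 1 / ((k + 1) N) per coordinate: the k errors add up to less than 1 / N times the
  -- diagonal value of each ℓ i.
  obtain ⟨M, hM⟩ := exists_frequency_bound k ((k + 1) * N) (by nlinarith)
  refine ⟨M, fun {n r h w ℓ} F hno R H hR hH => ?_⟩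
  obtain ⟨Q, p, hQ, hpw, hpz⟩ := F.exists_integral_coordinates
  have : NeZero Q := ⟨hQ.ne'⟩
  -- An annihilating frequency c makes (1 / Q) Σ c_i p_i integral on the lattice, with value c_j at
  -- w j. It is then extended to ℤ^n and shortened without changing these values.
  have key : ∀ c : Fin k → ℤ, (∀ i, |c i| ≤ M) → (∃ i, 1 ≤ c i) →
      (∀ z, (∀ l, h l ⬝ᵥ z = 0) → (Q : ℤ) ∣ ∑ i, c i * (p i ⬝ᵥ z)) →
      ∃ g : Fin n → ℤ, (∀ j, |g ⬝ᵥ w j| ≤ M) ∧ (∃ j, 1 ≤ g ⬝ᵥ w j) ∧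
        ∀ i, |g i| ≤ M * 2 ^ k * (n * R) + r * H := by
    rintro c hc ⟨i, hi⟩ hdvd
    have hq : ∀ z, (∑ i, c i • p i) ⬝ᵥ z = ∑ i, c i * (p i ⬝ᵥ z) := by
      intro z; rw [sum_dotProduct]; simp only [smul_dotProduct, smul_eq_mul]
    obtain ⟨g₀, hg₀⟩ := exists_integral_extension h Q (∑ i, c i • p i)
      (fun z hz => by rw [hq]; exact hdvd z hz)
    have hgw : ∀ j, g₀ ⬝ᵥ w j = c j := by
      intro j
      have h1 := hg₀ (w j) (fun l => F.orth l j)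
      rw [hq] at h1
      simp only [hpw, mul_ite, mul_zero, Finset.sum_ite_eq', Finset.mem_univ, if_true] at h1
      have hQ' : (Q : ℤ) ≠ 0 := by exact_mod_cast hQ.ne'
      exact mul_left_cancel₀ hQ' (h1.trans (mul_comm _ _))
    obtain ⟨g, hg1, hg2⟩ := F.exists_small_extension g₀ M R H
      (fun j => by rw [hgw]; exact hc j) hR hH
    exact ⟨g, fun j => by rw [hg1, hgw]; exact hc j, ⟨i, by rw [hg1, hgw]; exact hi⟩, hg2⟩
  by_contra hne
  -- The lattice modulo the span of w, with coordinates multiplied by Q.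
  let G : AddSubgroup (Fin k → ZMod Q) :=
    { carrier := {g | ∃ z, (∀ l, h l ⬝ᵥ z = 0) ∧ ∀ i, g i = ((p i ⬝ᵥ z : ℤ) : ZMod Q)}
      zero_mem' := ⟨0, by simp, by simp⟩
      add_mem' := by
        rintro a b ⟨z, hz, hz'⟩ ⟨y, hy, hy'⟩
        exact ⟨z + y, fun l => by rw [dotProduct_add, hz, hy, add_zero],
          fun i => by rw [Pi.add_apply, hz', hy', dotProduct_add]; push_cast; rfl⟩
      neg_mem' := by
        rintro a ⟨z, hz, hz'⟩
        exact ⟨-z, fun l => by rw [dotProduct_neg, hz, neg_zero],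
          fun i => by rw [Pi.neg_apply, hz', dotProduct_neg]; push_cast; rfl⟩ }
  -- The target, with all coordinates 1 / (k + 1), is the centroid of the simplex with vertices 0
  -- and w. An annihilating frequency is excluded by `hne`, since it or its negative has a positive
  -- entry.
  obtain ⟨g, ⟨z, hz, hgz⟩, hg⟩ := hM Q G (by
    intro c hc htriv
    by_contra hc0
    have hdvd : ∀ z, (∀ l, h l ⬝ᵥ z = 0) → (Q : ℤ) ∣ ∑ i, c i * (p i ⬝ᵥ z) := by
      intro z hz
      rw [← ZMod.intCast_zmod_eq_zero_iff_dvd]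
      have := htriv (fun i => ((p i ⬝ᵥ z : ℤ) : ZMod Q)) ⟨z, hz, fun i => rfl⟩
      push_cast
      exact this
    obtain ⟨i, hi⟩ := Function.ne_iff.1 hc0
    rw [Pi.zero_apply] at hi
    rcases lt_or_gt_of_ne hi with hi | hi
    · refine hne (key (-c) (fun j => by rw [Pi.neg_apply, abs_neg]; exact hc j)
        ⟨i, by rw [Pi.neg_apply]; omega⟩ fun z hz => ?_)
      simp only [Pi.neg_apply, neg_mul, Finset.sum_neg_distrib]
      exact (dvd_neg).2 (hdvd z hz)
    · exact hne (key c hc ⟨i, hi⟩ hdvd)) (fun _ => 1 / ((k : ℝ) + 1))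
  choose t ht using hg
  have hQr : (0 : ℝ) < Q := by exact_mod_cast hQ
  -- The translation changes the coordinates of z by integers, to the representatives near 1 / (k +
  -- 1).
  let z' : Fin n → ℤ := z + ∑ i, (t i - (p i ⬝ᵥ z) / (Q : ℤ)) • w i
  have hz' : ∀ l, h l ⬝ᵥ z' = 0 := by
    intro l
    simp only [z', dotProduct_add, hz, dotProduct_sum, dotProduct_smul, F.orth, smul_zero,
      Finset.sum_const_zero, add_zero]
  have hval : ∀ i, ((p i ⬝ᵥ z : ℤ) : ℝ) = (g i).val + Q * (((p i ⬝ᵥ z) / (Q : ℤ) : ℤ) : ℝ) := by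
    intro i
    have h1 : ((g i).val : ℤ) = (p i ⬝ᵥ z) % Q := by rw [hgz i, ZMod.val_intCast]
    have h2 := Int.emod_add_mul_ediv (p i ⬝ᵥ z) Q
    rw [← h1] at h2
    exact_mod_cast h2.symm
  have hcoord : intPoint z' = ∑ i, (((g i).val : ℝ) / Q + t i) • intPoint (w i) := by
    have h1 : intPoint z = ∑ j, (((p j ⬝ᵥ z : ℤ) : ℝ) / Q) • intPoint (w j) := by
      have := hpz z hz
      rw [← inv_smul_smul₀ hQr.ne' (intPoint z), this, Finset.smul_sum]
      refine Finset.sum_congr rfl fun j _ => ?_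
      rw [smul_smul]; congr 1; ring
    simp only [z']
    rw [intPoint_add, intPoint_sum, h1, ← Finset.sum_add_distrib]
    refine Finset.sum_congr rfl fun j _ => ?_
    rw [intPoint_smul, ← add_smul, hval j]
    congr 1
    push_cast
    field_simp
    ring
  refine hno z' hz' fun i => ?_
  have hNr : (0 : ℝ) < N := by positivity
  have hD : (0 : ℝ) < (ℓ i ⬝ᵥ w i : ℤ) := by exact_mod_cast F.pos i
  have h1 : ((ℓ i ⬝ᵥ z' : ℤ) : ℝ) = ∑ j, (((g j).val : ℝ) / Q + t j) * (ℓ i ⬝ᵥ w j : ℤ) := by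
    rw [← intPoint_dotProduct, hcoord, dotProduct_sum]
    simp only [dotProduct_smul, intPoint_dotProduct, smul_eq_mul]
  have h2 : ((k : ℝ) + 1) * N * (ℓ i ⬝ᵥ z' : ℤ) - N * (ℓ i ⬝ᵥ ∑ j, w j : ℤ) =
      -(((k : ℝ) + 1) * N *
        ∑ j, (1 / ((k : ℝ) + 1) - ((g j).val : ℝ) / Q - t j) * (ℓ i ⬝ᵥ w j : ℤ)) := by
    rw [h1, dotProduct_sum]
    push_cast
    rw [Finset.mul_sum, Finset.mul_sum, Finset.mul_sum, ← Finset.sum_sub_distrib,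
      ← Finset.sum_neg_distrib]
    refine Finset.sum_congr rfl fun j _ => ?_
    field_simp
    ring
  have h3 : |∑ j, (1 / ((k : ℝ) + 1) - ((g j).val : ℝ) / Q - t j) * (ℓ i ⬝ᵥ w j : ℤ)| ≤
      k * (1 / (((k : ℝ) + 1) * N) * (ℓ i ⬝ᵥ w i : ℤ)) := by
    calc _ ≤ ∑ j, |(1 / ((k : ℝ) + 1) - ((g j).val : ℝ) / Q - t j) * (ℓ i ⬝ᵥ w j : ℤ)| :=
          Finset.abs_sum_le_sum_abs _ _
      _ ≤ ∑ _j : Fin k, 1 / (((k : ℝ) + 1) * N) * (ℓ i ⬝ᵥ w i : ℤ) := by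
          refine Finset.sum_le_sum fun j _ => ?_
          rw [abs_mul]
          have h4 := ht j
          push_cast at h4
          exact mul_le_mul h4 (by exact_mod_cast F.le i j) (abs_nonneg _) (by positivity)
      _ = _ := by simp
  have h4 : |((k : ℝ) + 1) * N * (ℓ i ⬝ᵥ z' : ℤ) - N * (ℓ i ⬝ᵥ ∑ j, w j : ℤ)| ≤
      (k + 1) * (ℓ i ⬝ᵥ w i : ℤ) := by
    rw [h2, abs_neg, abs_mul, abs_of_pos (by positivity)]
    calc _ ≤ ((k : ℝ) + 1) * N * (k * (1 / (((k : ℝ) + 1) * N) * (ℓ i ⬝ᵥ w i : ℤ))) := by gcongr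
      _ = k * (ℓ i ⬝ᵥ w i : ℤ) := by field_simp
      _ ≤ _ := by nlinarith
  exact_mod_cast h4

/-- Around a deep point of the simplex spanned by a frame, a small box is contained in the simplex. -/
lemma Frame.add_mem_of_deep {n r k : ℕ} {h : Fin r → Fin n → ℤ} {w ℓ : Fin k → Fin n → ℤ}
    (F : Frame h w ℓ) (N : ℕ) (hN : N = 2 * (k + 1) * 2 ^ k) (X : Set (Fin n → ℤ))
    (o a : Fin n → ℤ)
    (hconv : ∀ z, ∀ μ : Fin k → ℝ, (∀ j, 0 ≤ μ j) → ∑ j, μ j ≤ 1 →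
      intPoint (z - o) = ∑ j, μ j • intPoint (w j) → z ∈ X)
    (ha : ∀ l, h l ⬝ᵥ (a - o) = 0)
    (hdeep : ∀ i, |((k : ℤ) + 1) * N * (ℓ i ⬝ᵥ (a - o)) - N * (ℓ i ⬝ᵥ ∑ j, w j)| ≤
      (k + 1) * (ℓ i ⬝ᵥ w i)) (d : Fin n → ℤ) (hd : ∀ l, h l ⬝ᵥ d = 0)
    (hd' : ∀ i, N * |ℓ i ⬝ᵥ d| ≤ ℓ i ⬝ᵥ w i) : a + d ∈ X := by
  have hN0 : (0 : ℝ) < N := by rw [hN]; positivity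
  obtain ⟨α, hα⟩ := F.exists_coordinates ha
  have hαs : ∑ j, |α j - 1 / ((k : ℝ) + 1)| ≤ 2 ^ k * (1 / N) := by
    refine F.sum_abs_le _ _ (by positivity) fun i => ?_
    have h1 : intPoint (ℓ i) ⬝ᵥ ∑ j, (α j - 1 / ((k : ℝ) + 1)) • intPoint (w j) =
        (((k : ℝ) + 1) * N * (ℓ i ⬝ᵥ (a - o) : ℤ) - N * (ℓ i ⬝ᵥ ∑ j, w j : ℤ)) /
          ((k + 1) * N) := by
      simp only [sub_smul, Finset.sum_sub_distrib, ← hα, ← Finset.smul_sum]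
      rw [← intPoint_sum, dotProduct_sub, dotProduct_smul, intPoint_dotProduct,
        intPoint_dotProduct, smul_eq_mul]
      field_simp
    rw [h1, abs_div, abs_of_pos (show (0 : ℝ) < (k + 1) * N by positivity),
      div_le_iff₀ (by positivity)]
    have h2 : |((k : ℝ) + 1) * N * (ℓ i ⬝ᵥ (a - o) : ℤ) - N * (ℓ i ⬝ᵥ ∑ j, w j : ℤ)| ≤
        (k + 1) * (ℓ i ⬝ᵥ w i : ℤ) := by exact_mod_cast hdeep i
    refine h2.trans (le_of_eq ?_)
    field_simp
  -- Choice of N: the deviation α of a from the centroid and the coordinates β of d each have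
  -- absolute sum at most half of 1 / (k + 1). So all α j + β j are nonnegative and their sum is at
  -- most k / (k + 1) + 1 / (k + 1) = 1.
  have h2N : (2 : ℝ) ^ k * (1 / N) = 1 / (2 * (k + 1)) := by
    rw [hN]; push_cast; field_simp
  rw [h2N] at hαs
  obtain ⟨β, hβ⟩ := F.exists_coordinates hd
  have hβs : ∑ j, |β j| ≤ 2 ^ k * (1 / N) := by
    refine F.sum_abs_le _ _ (by positivity) fun i => ?_
    rw [← hβ, intPoint_dotProduct, one_div, inv_mul_eq_div, le_div_iff₀ hN0]
    rw [mul_comm]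
    exact_mod_cast hd' i
  rw [h2N] at hβs
  have hk : (1 : ℝ) / (2 * (k + 1)) + 1 / (2 * (k + 1)) = 1 / (k + 1) := by field_simp; norm_num
  refine hconv (a + d) (fun j => α j + β j) (fun j => ?_) ?_ ?_
  · have h1 := Finset.single_le_sum (f := fun j => |α j - 1 / ((k : ℝ) + 1)|)
      (fun j _ => abs_nonneg _) (Finset.mem_univ j)
    have h2 := Finset.single_le_sum (f := fun j => |β j|)
      (fun j _ => abs_nonneg _) (Finset.mem_univ j)
    have h3 := neg_abs_le (α j - 1 / ((k : ℝ) + 1))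
    have h4 := neg_abs_le (β j)
    linarith
  · have h1 : ∑ j, (α j - 1 / ((k : ℝ) + 1)) ≤ ∑ j, |α j - 1 / ((k : ℝ) + 1)| :=
      Finset.sum_le_sum fun j _ => le_abs_self _
    have h2 : ∑ j, β j ≤ ∑ j, |β j| := Finset.sum_le_sum fun j _ => le_abs_self _
    rw [Finset.sum_sub_distrib] at h1
    simp only [Finset.sum_const, Finset.card_univ, Fintype.card_fin, nsmul_eq_mul] at h1
    rw [Finset.sum_add_distrib]
    have h3 : (k : ℝ) * (1 / (k + 1)) + 1 / (k + 1) = 1 := by field_simp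
    linarith
  · rw [add_sub_right_comm, intPoint_add, hα, hβ, ← Finset.sum_add_distrib]
    simp only [add_smul]

/-- A halfspace whose boundary contains a deep lattice point of the frame contains a constant
fraction of the lattice points of the box. -/
theorem Frame.card_le_mul_card_halfspace {n r k : ℕ} {h : Fin r → Fin n → ℤ}
    {w ℓ : Fin k → Fin n → ℤ} (F : Frame h w ℓ) (N : ℕ) (hN : N = 2 * (k + 1) * 2 ^ k)
    (X : Finset (Fin n → ℤ)) (o a c : Fin n → ℤ)
    (hX : ∀ x ∈ X, (∀ l, h l ⬝ᵥ (x - o) = 0) ∧ ∀ i, |ℓ i ⬝ᵥ (x - o)| ≤ ℓ i ⬝ᵥ w i)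
    (hconv : ∀ z, ∀ μ : Fin k → ℝ, (∀ j, 0 ≤ μ j) → ∑ j, μ j ≤ 1 →
      intPoint (z - o) = ∑ j, μ j • intPoint (w j) → z ∈ X)
    (ha : ∀ l, h l ⬝ᵥ (a - o) = 0)
    (hdeep : ∀ i, |((k : ℤ) + 1) * N * (ℓ i ⬝ᵥ (a - o)) - N * (ℓ i ⬝ᵥ ∑ j, w j)| ≤
      (k + 1) * (ℓ i ⬝ᵥ w i)) :
    X.card ≤ 2 * (2 * N + 1) ^ k * (X.filter fun x => c ⬝ᵥ a ≤ c ⬝ᵥ x).card := by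
  classical
  have hmem : ∀ d : Fin n → ℤ, (∀ l, h l ⬝ᵥ d = 0) → (∀ i, N * |ℓ i ⬝ᵥ d| ≤ ℓ i ⬝ᵥ w i) →
      a + d ∈ X := F.add_mem_of_deep N hN X o a hconv ha hdeep
  -- Index of the cell of x in the grid of mesh 1 / N of the box. Each index ranges over -N, …, N,
  -- where N occurs only at the upper end of the range.
  let φ : (Fin n → ℤ) → (Fin k → ℤ) := fun x i => (N * (ℓ i ⬝ᵥ (x - o))) / (ℓ i ⬝ᵥ w i)
  set Y := X.filter fun x => c ⬝ᵥ a ≤ c ⬝ᵥ x with hY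
  have himage : (X.image φ).card ≤ (2 * N + 1) ^ k := by
    have hsub : X.image φ ⊆ Fintype.piFinset fun _ : Fin k => Finset.Icc (-(N : ℤ)) N := by
      intro y hy
      obtain ⟨x, hx, rfl⟩ := Finset.mem_image.1 hy
      rw [Fintype.mem_piFinset]
      intro i
      have h1 := abs_le.1 ((hX x hx).2 i)
      rw [Finset.mem_Icc]
      constructor
      · rw [Int.le_ediv_iff_mul_le (F.pos i)]; nlinarith
      · refine Int.ediv_le_of_le_mul (F.pos i) ?_; nlinarith
    refine (Finset.card_le_card hsub).trans (le_of_eq ?_)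
    rw [Fintype.card_piFinset]
    simp only [Int.card_Icc, Finset.prod_const, Finset.card_univ, Fintype.card_fin]
    congr 1; omega
  -- Points of one cell differ from x₀ by short vectors. Attaching x - x₀ or its negative to a,
  -- whichever does not decrease c, gives a point of X in the halfspace. With the sign recorded the
  -- map is injective, hence the factor 2.
  have hfiber : ∀ y ∈ X.image φ, (X.filter fun x => φ x = y).card ≤ 2 * Y.card := by
    intro y hy
    obtain ⟨x₀, hx₀, rfl⟩ := Finset.mem_image.1 hy
    have hdiff : ∀ x ∈ X.filter fun x => φ x = φ x₀,
        (∀ l, h l ⬝ᵥ (x - x₀) = 0) ∧ ∀ i, N * |ℓ i ⬝ᵥ (x - x₀)| ≤ ℓ i ⬝ᵥ w i := by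
      intro x hx
      obtain ⟨hxX, hxφ⟩ := Finset.mem_filter.1 hx
      have hsub : x - x₀ = (x - o) - (x₀ - o) := by abel
      refine ⟨fun l => by rw [hsub, dotProduct_sub, (hX x hxX).1, (hX x₀ hx₀).1, sub_zero],
        fun i => ?_⟩
      have h1 : (N * (ℓ i ⬝ᵥ (x - o))) / (ℓ i ⬝ᵥ w i) =
        (N * (ℓ i ⬝ᵥ (x₀ - o))) / (ℓ i ⬝ᵥ w i) := congrFun hxφ i
      have h2 := Int.emod_add_mul_ediv (N * (ℓ i ⬝ᵥ (x - o))) (ℓ i ⬝ᵥ w i)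
      have h3 := Int.emod_add_mul_ediv (N * (ℓ i ⬝ᵥ (x₀ - o))) (ℓ i ⬝ᵥ w i)
      have h4 := Int.emod_nonneg (N * (ℓ i ⬝ᵥ (x - o))) (F.pos i).ne'
      have h5 := Int.emod_nonneg (N * (ℓ i ⬝ᵥ (x₀ - o))) (F.pos i).ne'
      have h6 := Int.emod_lt_of_pos (N * (ℓ i ⬝ᵥ (x - o))) (F.pos i)
      have h7 := Int.emod_lt_of_pos (N * (ℓ i ⬝ᵥ (x₀ - o))) (F.pos i)
      rw [h1] at h2
      rw [← abs_of_nonneg (show (0 : ℤ) ≤ N by positivity), ← abs_mul, hsub, dotProduct_sub,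
        abs_le]
      constructor <;> linarith
    let s : (Fin n → ℤ) → Bool := fun x => decide (0 ≤ c ⬝ᵥ (x - x₀))
    let ψ : (Fin n → ℤ) → Bool × (Fin n → ℤ) := fun x =>
      (s x, if 0 ≤ c ⬝ᵥ (x - x₀) then a + (x - x₀) else a + -(x - x₀))
    have hmaps : ∀ x ∈ X.filter fun x => φ x = φ x₀, ψ x ∈ (Finset.univ : Finset Bool) ×ˢ Y := by
      intro x hx
      obtain ⟨hd1, hd2⟩ := hdiff x hx
      rw [Finset.mem_product]
      refine ⟨Finset.mem_univ _, ?_⟩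
      simp only [ψ]
      split_ifs with hc
      · refine Finset.mem_filter.2 ⟨hmem _ hd1 hd2, ?_⟩
        rw [dotProduct_add]; linarith
      · refine Finset.mem_filter.2 ⟨hmem _ (fun l => by rw [dotProduct_neg, hd1, neg_zero])
          (fun i => by rw [dotProduct_neg, abs_neg]; exact hd2 i), ?_⟩
        rw [dotProduct_add, dotProduct_neg]; linarith
    have hinj : Set.InjOn ψ (X.filter fun x => φ x = φ x₀) := by
      intro x _ x' _ hxx
      simp only [ψ, s, Prod.mk.injEq, decide_eq_decide] at hxx
      obtain ⟨h1, h2⟩ := hxx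
      by_cases hc : 0 ≤ c ⬝ᵥ (x - x₀)
      · rw [if_pos hc, if_pos (h1.1 hc)] at h2
        simpa using h2
      · rw [if_neg hc, if_neg (fun h' => hc (h1.2 h'))] at h2
        simpa using h2
    have := Finset.card_le_card_of_injOn ψ hmaps hinj
    rwa [Finset.card_product, Finset.card_univ, Fintype.card_bool] at this
  calc X.card ≤ 2 * Y.card * (X.image φ).card := Finset.card_le_mul_card_image X _ hfiber
    _ ≤ 2 * Y.card * (2 * N + 1) ^ k := by gcongr
    _ = _ := by ring


/-! ### Cost calculus for the machine. -/

/-! ## Binary sizes -/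

lemma bits_le_iff {z : ℤ} {s : ℕ} : bits z ≤ s ↔ z.natAbs < 2 ^ s := Nat.size_le

lemma bits_le_of_natAbs_le {a b : ℤ} (h : a.natAbs ≤ b.natAbs) : bits a ≤ bits b :=
  Nat.size_le_size h

lemma bits_le_of_abs_le {a b : ℤ} (h : |a| ≤ b) : bits a ≤ bits b :=
  bits_le_of_natAbs_le (by have := abs_le.1 h; omega)

lemma lt_two_pow_bits (z : ℤ) : z.natAbs < 2 ^ bits z := Nat.lt_size_self _

@[simp] lemma bits_zero : bits 0 = 0 := by simp [bits]

@[simp] lemma bits_one : bits 1 = 1 := by simp [bits]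

@[simp] lemma bits_neg (z : ℤ) : bits (-z) = bits z := by simp [bits]

lemma bits_natCast_le (a : ℕ) : bits a ≤ a := by
  rw [bits_le_iff, Int.natAbs_natCast]; exact Nat.lt_two_pow_self

lemma bits_add_le (a b : ℤ) : bits (a + b) ≤ bits a + bits b + 1 := by
  rw [bits_le_iff]
  have h1 := lt_two_pow_bits a
  have h2 := lt_two_pow_bits b
  have h3 : 2 ^ bits a ≤ 2 ^ (bits a + bits b) := Nat.pow_le_pow_right (by norm_num) (by omega)
  have h4 : 2 ^ bits b ≤ 2 ^ (bits a + bits b) := Nat.pow_le_pow_right (by norm_num) (by omega)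
  have h5 := Int.natAbs_add_le a b
  rw [pow_succ]; omega

lemma bits_sub_le (a b : ℤ) : bits (a - b) ≤ bits a + bits b + 1 := by
  rw [sub_eq_add_neg]; simpa using bits_add_le a (-b)

lemma bits_mul_le (a b : ℤ) : bits (a * b) ≤ bits a + bits b := by
  rw [bits_le_iff, Int.natAbs_mul, pow_add]
  exact Nat.mul_lt_mul'' (lt_two_pow_bits a) (lt_two_pow_bits b)

lemma bits_ediv_le (a b : ℤ) : bits (a / b) ≤ bits a :=
  bits_le_of_natAbs_le (by
    have := Int.abs_ediv_le_abs a b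
    rw [Int.abs_eq_natAbs, Int.abs_eq_natAbs] at this
    exact_mod_cast this)

/-! ## Expressions -/

/-- All cells read by the expression belong to arrays of `A` and have at most `s` digits. -/
def Expr.Ok (σ : State) (s : ℕ) (A : Set ℕ) : Expr → Prop
  | .const _ => True
  | .get x i => x ∈ A ∧ bits (σ x (i.val σ)) ≤ s ∧ i.Ok σ s A
  | .add a b => a.Ok σ s A ∧ b.Ok σ s A
  | .sub a b => a.Ok σ s A ∧ b.Ok σ s A
  | .mul a b => a.Ok σ s A ∧ b.Ok σ s A
  | .div a b => a.Ok σ s A ∧ b.Ok σ s A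

/-- The weight of an expression: with operands of at most `s` digits, its evaluation costs at most
`weight * (s + 1)`. -/
def Expr.weight : Expr → ℕ
  | .const z => 1 + bits z
  | .get _ i => 2 + i.weight
  | .add a b => 2 + 2 * a.weight + 2 * b.weight
  | .sub a b => 2 + 2 * a.weight + 2 * b.weight
  | .mul a b => 2 + 2 * a.weight + 2 * b.weight
  | .div a b => 2 + 2 * a.weight + 2 * b.weight

lemma Expr.Ok.bits_val_le {σ : State} {s : ℕ} {A : Set ℕ} {e : Expr} (h : e.Ok σ s A) :
    bits (e.val σ) ≤ e.weight * (s + 1) := by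
  induction e with
  | const z => simp only [val, weight]; nlinarith
  | get x i ih => simp only [val, weight]; have := h.2.1; nlinarith
  | add a b iha ihb =>
    simp only [val, weight]
    have := bits_add_le (a.val σ) (b.val σ); have := iha h.1; have := ihb h.2; nlinarith
  | sub a b iha ihb =>
    simp only [val, weight]
    have := bits_sub_le (a.val σ) (b.val σ); have := iha h.1; have := ihb h.2; nlinarith
  | mul a b iha ihb =>
    simp only [val, weight]
    have := bits_mul_le (a.val σ) (b.val σ); have := iha h.1; have := ihb h.2; nlinarith
  | div a b iha ihb =>
    simp only [val, weight]
    have := bits_ediv_le (a.val σ) (b.val σ); have := iha h.1; nlinarith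

lemma Expr.Ok.cost_le {σ : State} {s : ℕ} {A : Set ℕ} {e : Expr} (h : e.Ok σ s A) :
    e.cost σ ≤ e.weight * (s + 1) := by
  induction e with
  | const z => simp only [cost, weight]; nlinarith
  | get x i ih => simp only [cost, weight]; have := h.2.1; have := ih h.2.2; nlinarith
  | add a b iha ihb =>
    simp only [cost, weight]
    have := bits_add_le (a.val σ) (b.val σ); have := iha h.1; have := ihb h.2
    have := Expr.Ok.bits_val_le h.1; have := Expr.Ok.bits_val_le h.2; nlinarith
  | sub a b iha ihb =>
    simp only [cost, weight]
    have := bits_sub_le (a.val σ) (b.val σ); have := iha h.1; have := ihb h.2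
    have := Expr.Ok.bits_val_le h.1; have := Expr.Ok.bits_val_le h.2; nlinarith
  | mul a b iha ihb =>
    simp only [cost, weight]
    have := bits_mul_le (a.val σ) (b.val σ); have := iha h.1; have := ihb h.2
    have := Expr.Ok.bits_val_le h.1; have := Expr.Ok.bits_val_le h.2; nlinarith
  | div a b iha ihb =>
    simp only [cost, weight]
    have := bits_ediv_le (a.val σ) (b.val σ); have := iha h.1; have := ihb h.2
    have := Expr.Ok.bits_val_le h.1; nlinarith

/-- The set A records the arrays read, so writing to other arrays leaves the value unchanged. -/
lemma Expr.Ok.val_eq {σ τ : State} {s : ℕ} {A : Set ℕ} {e : Expr} (h : e.Ok σ s A)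
    (hA : ∀ x ∈ A, τ x = σ x) : e.val τ = e.val σ := by
  induction e with
  | const z => rfl
  | get x i ih => simp only [val]; rw [ih h.2.2, hA x h.1]
  | add a b iha ihb => simp only [val]; rw [iha h.1, ihb h.2]
  | sub a b iha ihb => simp only [val]; rw [iha h.1, ihb h.2]
  | mul a b iha ihb => simp only [val]; rw [iha h.1, ihb h.2]
  | div a b iha ihb => simp only [val]; rw [iha h.1, ihb h.2]

lemma Expr.Ok.transfer {σ τ : State} {s : ℕ} {A : Set ℕ} {e : Expr} (h : e.Ok σ s A)
    (hA : ∀ x ∈ A, τ x = σ x) : e.Ok τ s A := by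
  induction e with
  | const z => trivial
  | get x i ih =>
    refine ⟨h.1, ?_, ih h.2.2⟩
    rw [h.2.2.val_eq hA, hA x h.1]; exact h.2.1
  | add a b iha ihb => exact ⟨iha h.1, ihb h.2⟩
  | sub a b iha ihb => exact ⟨iha h.1, ihb h.2⟩
  | mul a b iha ihb => exact ⟨iha h.1, ihb h.2⟩
  | div a b iha ihb => exact ⟨iha h.1, ihb h.2⟩

lemma Expr.Ok.mono {σ : State} {s s' : ℕ} {A A' : Set ℕ} {e : Expr} (h : e.Ok σ s A)
    (hs : s ≤ s') (hA : A ⊆ A') : e.Ok σ s' A' := by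
  induction e with
  | const z => trivial
  | get x i ih => exact ⟨hA h.1, h.2.1.trans hs, ih h.2.2⟩
  | add a b iha ihb => exact ⟨iha h.1, ihb h.2⟩
  | sub a b iha ihb => exact ⟨iha h.1, ihb h.2⟩
  | mul a b iha ihb => exact ⟨iha h.1, ihb h.2⟩
  | div a b iha ihb => exact ⟨iha h.1, ihb h.2⟩

/-- The sum of a list of expressions. -/
def sumE (l : List Expr) : Expr := l.foldr .add (.const 0)

lemma val_sumE (σ : State) (l : List Expr) : (sumE l).val σ = (l.map (Expr.val σ)).sum := by
  induction l with
  | nil => rfl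
  | cons a l ih => simp only [sumE, List.foldr_cons, Expr.val, List.map_cons, List.sum_cons] at *
                   rw [ih]

lemma ok_sumE {σ : State} {s : ℕ} {A : Set ℕ} {l : List Expr} (h : ∀ e ∈ l, e.Ok σ s A) :
    (sumE l).Ok σ s A := by
  induction l with
  | nil => trivial
  | cons a l ih => exact ⟨h a (by simp), ih fun e he => h e (by simp [he])⟩

/-- The product of a list of expressions. -/
def prodE (l : List Expr) : Expr := l.foldr .mul (.const 1)

lemma val_prodE (σ : State) (l : List Expr) : (prodE l).val σ = (l.map (Expr.val σ)).prod := by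
  induction l with
  | nil => rfl
  | cons a l ih => simp only [prodE, List.foldr_cons, Expr.val, List.map_cons, List.prod_cons] at *
                   rw [ih]

lemma ok_prodE {σ : State} {s : ℕ} {A : Set ℕ} {l : List Expr} (h : ∀ e ∈ l, e.Ok σ s A) :
    (prodE l).Ok σ s A := by
  induction l with
  | nil => trivial
  | cons a l ih => exact ⟨h a (by simp), ih fun e he => h e (by simp [he])⟩

/-- The dot product of two vectors of expressions. -/
def dotE {n : ℕ} (a b : Fin n → Expr) : Expr := sumE (List.ofFn fun j => .mul (a j) (b j))

lemma val_dotE {n : ℕ} (σ : State) (a b : Fin n → Expr) :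
    (dotE a b).val σ = (fun j => (a j).val σ) ⬝ᵥ fun j => (b j).val σ := by
  rw [dotE, val_sumE, List.map_ofFn, List.sum_ofFn]; rfl

lemma ok_dotE {n : ℕ} {σ : State} {s : ℕ} {A : Set ℕ} {a b : Fin n → Expr}
    (ha : ∀ j, (a j).Ok σ s A) (hb : ∀ j, (b j).Ok σ s A) : (dotE a b).Ok σ s A :=
  ok_sumE fun e he => by
    obtain ⟨j, rfl⟩ := (List.mem_ofFn' _ _).1 he
    exact ⟨ha j, hb j⟩

/-- The expressions reading `n` consecutive cells. -/
def cells (n x off : ℕ) : Fin n → Expr := fun j => .get x (.const (off + (j : ℕ)))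

@[simp] lemma val_cells (n x off : ℕ) (σ : State) (j : Fin n) :
    (cells n x off j).val σ = readIntVec n (σ x) off j := rfl

lemma ok_cells {n x off : ℕ} {σ : State} {s : ℕ} {A : Set ℕ} (hx : x ∈ A)
    (h : ∀ j, bits (readIntVec n (σ x) off j) ≤ s) (j : Fin n) : (cells n x off j).Ok σ s A :=
  ⟨hx, h j, trivial⟩

/-! ## Rows of expressions -/

/-- A row of expressions. -/
abbrev RowE (n : ℕ) : Type := (Fin n → Expr) × Expr

/-- The row of the values. -/
def RowE.val {n : ℕ} (σ : State) (r : RowE n) : Row n := (fun j => (r.1 j).val σ, r.2.val σ)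

/-- See `Expr.Ok`. -/
def RowE.Ok {n : ℕ} (σ : State) (s : ℕ) (A : Set ℕ) (r : RowE n) : Prop :=
  (∀ j, (r.1 j).Ok σ s A) ∧ r.2.Ok σ s A

lemma RowE.Ok.transfer {n : ℕ} {σ τ : State} {s : ℕ} {A : Set ℕ} {r : RowE n} (h : r.Ok σ s A)
    (hA : ∀ x ∈ A, τ x = σ x) : r.Ok τ s A :=
  ⟨fun j => (h.1 j).transfer hA, h.2.transfer hA⟩

lemma RowE.Ok.val_eq {n : ℕ} {σ τ : State} {s : ℕ} {A : Set ℕ} {r : RowE n} (h : r.Ok σ s A)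
    (hA : ∀ x ∈ A, τ x = σ x) : r.val τ = r.val σ :=
  Prod.ext (funext fun j => (h.1 j).val_eq hA) (h.2.val_eq hA)

/-- The entries of a list of rows, row by row. -/
def flatRows {n : ℕ} {α : Type} (l : List ((Fin n → α) × α)) : List α :=
  l.flatMap fun r => List.ofFn r.1 ++ [r.2]

lemma length_flatRows {n : ℕ} {α : Type} (l : List ((Fin n → α) × α)) :
    (flatRows l).length = l.length * (n + 1) := by
  induction l with
  | nil => simp [flatRows]
  | cons a l ih =>
    simp only [flatRows, List.flatMap_cons, List.length_append, List.length_ofFn,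
      List.length_cons, List.length_nil] at *
    rw [ih]; ring

lemma flatRows_append {n : ℕ} {α : Type} (l l' : List ((Fin n → α) × α)) :
    flatRows (l ++ l') = flatRows l ++ flatRows l' := List.flatMap_append

lemma map_flatRows {n : ℕ} (σ : State) (l : List (RowE n)) :
    (flatRows l).map (Expr.val σ) = flatRows (l.map (RowE.val σ)) := by
  simp only [flatRows, List.map_flatMap, List.flatMap_map, List.map_append, List.map_ofFn]
  rfl

lemma forall_mem_flatRows {n : ℕ} {α : Type} {l : List ((Fin n → α) × α)} {p : α → Prop} :
    (∀ e ∈ flatRows l, p e) ↔ ∀ r ∈ l, (∀ j, p (r.1 j)) ∧ p r.2 := by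
  simp only [flatRows, List.mem_flatMap, List.mem_append, List.mem_ofFn', List.mem_singleton,
    Set.mem_range]
  constructor
  · intro h r hr
    exact ⟨fun j => h _ ⟨r, hr, Or.inl ⟨j, rfl⟩⟩, h _ ⟨r, hr, Or.inr rfl⟩⟩
  · rintro h e ⟨r, hr, ⟨j, rfl⟩ | rfl⟩
    · exact (h r hr).1 j
    · exact (h r hr).2

/-! ## Contents of arrays -/

/-- The list `L` is stored in the cells from `s` on. -/
def Holds (a : ℤ → ℤ) (s : ℤ) (L : List ℤ) : Prop := ∀ t (h : t < L.length), a (s + t) = L[t]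

lemma holds_append {a : ℤ → ℤ} {s : ℤ} {L L' : List ℤ} :
    Holds a s (L ++ L') ↔ Holds a s L ∧ Holds a (s + L.length) L' := by
  constructor
  · intro h
    refine ⟨fun t ht => ?_, fun t ht => ?_⟩
    · rw [h t (by rw [List.length_append]; omega), List.getElem_append_left ht]
    · have := h (L.length + t) (by rw [List.length_append]; omega)
      rw [List.getElem_append_right (by omega)] at this
      simp only [Nat.add_sub_cancel_left] at this
      rw [← this]; push_cast; rw [add_assoc]
  · rintro ⟨h1, h2⟩ t ht
    rcases lt_or_ge t L.length with h | h
    · rw [List.getElem_append_left h, h1 t h]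
    · rw [List.getElem_append_right h, ← h2 _ (by rw [List.length_append] at ht; omega)]
      congr 1; omega

lemma holds_nil (a : ℤ → ℤ) (s : ℤ) : Holds a s [] := fun t ht => by simp at ht

lemma holds_singleton {a : ℤ → ℤ} {s z : ℤ} : Holds a s [z] ↔ a s = z := by
  constructor
  · intro h; simpa using h 0 (by simp)
  · intro h t ht
    have : t = 0 := by simpa using ht
    subst this; simpa using h

lemma holds_cons {a : ℤ → ℤ} {s z : ℤ} {L : List ℤ} :
    Holds a s (z :: L) ↔ a s = z ∧ Holds a (s + 1) L := by
  rw [← List.singleton_append, holds_append, holds_singleton]; simp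

lemma holds_ofFn {n : ℕ} {a : ℤ → ℤ} {s : ℤ} {v : Fin n → ℤ} :
    Holds a s (List.ofFn v) ↔ readIntVec n a s = v := by
  constructor
  · intro h; ext j
    have := h j (by simp)
    rw [List.getElem_ofFn] at this
    exact this
  · rintro rfl t ht
    rw [List.getElem_ofFn]; rfl

/-- In `readSystem` and `querySize` the list of indices is coerced from ℕ to ℤ through the list
monad; this turns the coercion into a map. -/
lemma bind_pure_cast_eq_map (l : List ℕ) :
    (do let a ← l; pure (a : ℤ)) = l.map fun a : ℕ => (a : ℤ) := by
  rw [List.bind_eq_flatMap]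
  induction l with
  | nil => rfl
  | cons a l ih => rw [List.flatMap_cons, ih]; rfl

lemma readSystem_eq_map (n : ℕ) (a : ℤ → ℤ) (s : ℤ) (k : ℕ) :
    readSystem n a s k = (List.range k).map fun i : ℕ =>
      (readIntVec n a (s + (i : ℤ) * (n + 1)), a (s + (i : ℤ) * (n + 1) + n)) := by
  unfold readSystem
  rw [bind_pure_cast_eq_map, List.map_map]
  rfl

lemma readSystem_succ (n : ℕ) (a : ℤ → ℤ) (s : ℤ) (k : ℕ) :
    readSystem n a s (k + 1) =
      (readIntVec n a s, a (s + n)) :: readSystem n a (s + (n + 1)) k := by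
  simp only [readSystem_eq_map, List.range_succ_eq_map, List.map_cons, List.map_map]
  congr 1
  · simp
  · refine List.map_congr_left fun i _ => ?_
    have : s + ((i.succ : ℕ) : ℤ) * (n + 1) = s + (n + 1) + (i : ℤ) * (n + 1) := by
      push_cast; ring
    simp only [Function.comp, this]

/-- The layout in which rows are written is the one in which the oracles read them. -/
lemma holds_flatRows {n : ℕ} {a : ℤ → ℤ} {s : ℤ} {l : List (Row n)} :
    Holds a s (flatRows l) ↔ readSystem n a s l.length = l := by
  induction l generalizing s with
  | nil => simp [flatRows, holds_nil, readSystem_eq_map]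
  | cons r l ih =>
    have h : flatRows (r :: l) = List.ofFn r.1 ++ ([r.2] ++ flatRows l) := by
      simp [flatRows]
    rw [h, holds_append, holds_append, holds_ofFn, holds_singleton,
      show (r :: l).length = l.length + 1 from rfl,
      readSystem_succ, List.cons.injEq, ← ih, List.length_ofFn, List.length_singleton]
    rw [Prod.ext_iff]
    simp only [and_assoc]
    rw [show s + (n : ℤ) + ((1 : ℕ) : ℤ) = s + (n + 1) by push_cast; ring]

lemma Holds.congr {a b : ℤ → ℤ} {s : ℤ} {L : List ℤ} (h : Holds a s L)
    (hab : ∀ t : ℕ, t < L.length → b (s + t) = a (s + t)) : Holds b s L :=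
  fun t ht => (hab t ht).trans (h t ht)

/-- Overwrites the cells `p, p + 1, …` of an array by the entries of a list. -/
def writeAt (a : ℤ → ℤ) (p : ℤ) (l : List ℤ) : ℤ → ℤ :=
  fun t => if p ≤ t then l.getD (t - p).toNat (a t) else a t

lemma writeAt_zero (a : ℤ → ℤ) (l : List ℤ) : writeAt a 0 l = writeList a l := by
  funext t; simp [writeAt, writeList]

lemma holds_writeAt (a : ℤ → ℤ) (p : ℤ) (l : List ℤ) : Holds (writeAt a p l) p l := by
  intro t ht
  have : (p + t - p).toNat = t := by omega
  simp only [writeAt]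
  rw [if_pos (by omega), this, List.getD_eq_getElem _ _ ht]

lemma holds_writeList (a : ℤ → ℤ) (l : List ℤ) : Holds (writeList a l) 0 l := by
  rw [← writeAt_zero]; exact holds_writeAt a 0 l

lemma writeAt_of_lt {a : ℤ → ℤ} {p t : ℤ} {l : List ℤ} (h : t < p) : writeAt a p l t = a t := by
  simp only [writeAt]; rw [if_neg (by omega)]

lemma writeAt_of_ge {a : ℤ → ℤ} {p t : ℤ} {l : List ℤ} (h : p + l.length ≤ t) :
    writeAt a p l t = a t := by
  simp only [writeAt]
  rw [if_pos (by omega), List.getD_eq_default]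
  omega

lemma writeAt_nil (a : ℤ → ℤ) (p : ℤ) : writeAt a p [] = a := by
  funext t; simp [writeAt]

lemma writeAt_cons (a : ℤ → ℤ) (p z : ℤ) (l : List ℤ) :
    writeAt a p (z :: l) = writeAt (Function.update a p z) (p + 1) l := by
  funext t
  simp only [writeAt]
  rcases lt_trichotomy t p with h | h | h
  · rw [if_neg (by omega), if_neg (by omega), Function.update_of_ne (by omega)]
  · subst h
    rw [if_pos le_rfl, if_neg (by omega)]; simp
  · rw [if_pos (by omega), if_pos (by omega), Function.update_of_ne (by omega)]
    have : (t - p).toNat = (t - (p + 1)).toNat + 1 := by omega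
    rw [this, List.getD_cons_succ]

lemma querySize_of_holds {n : ℕ} {a : ℤ → ℤ} {c : Call} {L : List ℤ} (h : Holds a 0 L)
    (hL : queryLength n a c = L.length) : querySize n a c = listSize L := by
  rw [querySize, hL]
  rw [bind_pure_cast_eq_map, List.map_map]
  congr 1
  apply List.ext_getElem
  · simp
  · intro t h1 h2
    simpa using h t h2

lemma listSize_append (l l' : List ℤ) : listSize (l ++ l') = listSize l + listSize l' := by
  simp [listSize]

lemma listSize_le {l : List ℤ} {s : ℕ} (h : ∀ z ∈ l, bits z ≤ s) :
    listSize l ≤ l.length * (s + 1) := by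
  induction l with
  | nil => simp [listSize]
  | cons a l ih =>
    have h1 := ih fun z hz => h z (by simp [hz])
    have h2 := h a (by simp)
    simp only [listSize, List.map_cons, List.sum_cons, List.length_cons] at *
    nlinarith

/-! ## Runs of programs -/

/-- With the oracles `O`, the program `p` started in `σ` terminates at a cost of at most `b` in a
memory that satisfies `Q`. -/
def Runs {n m : ℕ} (O : Oracles n m) (p : Prog) (σ : State) (Q : State → Prop) (b : ℕ) : Prop :=
  ∃ τ t, Exec O p σ τ t ∧ t ≤ b ∧ Q τ

namespace Runs

variable {n m : ℕ} {O : Oracles n m} {p q : Prog} {σ : State} {Q R : State → Prop} {b c : ℕ}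

lemma mono (h : Runs O p σ Q b) (hQ : ∀ τ, Q τ → R τ) (hb : b ≤ c) : Runs O p σ R c := by
  obtain ⟨τ, t, h1, h2, h3⟩ := h
  exact ⟨τ, t, h1, h2.trans hb, hQ τ h3⟩

lemma seq {Q' : State → Prop} {d : ℕ} (h : Runs O p σ Q b) (h' : ∀ τ, Q τ → Runs O q τ Q' c)
    (hd : 1 + b + c ≤ d) : Runs O (.seq p q) σ Q' d := by
  obtain ⟨τ, t, h1, h2, h3⟩ := h
  obtain ⟨υ, t', h4, h5, h6⟩ := h' τ h3
  exact ⟨υ, _, .seq h1 h4, by omega, h6⟩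

lemma skip (h : Q σ) (hb : 1 ≤ b) : Runs O .skip σ Q b := ⟨σ, 1, .skip σ, hb, h⟩

lemma assign {x : ℕ} {i e : Expr} {s : ℕ} {A : Set ℕ} (hi : i.Ok σ s A) (he : e.Ok σ s A)
    (hQ : Q (Function.update σ x (Function.update (σ x) (i.val σ) (e.val σ))))
    (hb : (1 + i.weight + e.weight) * (s + 1) ≤ b) : Runs O (.assign x i e) σ Q b :=
  ⟨_, _, .assign x i e σ, by have := hi.cost_le; have := he.cost_le; nlinarith, hQ⟩

lemma cond {e : Expr} {s d : ℕ} {A : Set ℕ} (he : e.Ok σ s A)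
    (hp : 0 < e.val σ → Runs O p σ Q c) (hq : ¬ 0 < e.val σ → Runs O q σ Q c)
    (hd : (1 + e.weight) * (s + 1) + c ≤ d) : Runs O (.cond e p q) σ Q d := by
  have h1 := he.cost_le
  by_cases h : 0 < e.val σ
  · obtain ⟨τ, t, h2, h3, h4⟩ := hp h
    exact ⟨τ, _, .cond_pos h h2, by nlinarith, h4⟩
  · obtain ⟨τ, t, h2, h3, h4⟩ := hq h
    exact ⟨τ, _, .cond_neg h h2, by nlinarith, h4⟩

end Runs

/-- The program may write to the array `y`. -/
def Prog.Mods (y : ℕ) : Prog → Prop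
  | .skip => False
  | .assign x _ _ => y = x
  | .seq p q => p.Mods y ∨ q.Mods y
  | .cond _ p q => p.Mods y ∨ q.Mods y
  | .loop _ p => p.Mods y
  | .call _ _ z => y = z

lemma Exec.frame {n m : ℕ} {O : Oracles n m} {p : Prog} {σ τ : State} {t : ℕ}
    (h : Exec O p σ τ t) {y : ℕ} (hy : ¬ p.Mods y) : τ y = σ y := by
  induction h with
  | skip σ => rfl
  | assign x i e σ => exact Function.update_of_ne hy _ _
  | seq _ _ ih1 ih2 =>
    simp only [Prog.Mods, not_or] at hy
    rw [ih2 hy.2, ih1 hy.1]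
  | cond_pos _ _ ih =>
    simp only [Prog.Mods, not_or] at hy
    exact ih hy.1
  | cond_neg _ _ ih =>
    simp only [Prog.Mods, not_or] at hy
    exact ih hy.2
  | loop_pos _ _ _ ih1 ih2 => rw [ih2 hy, ih1 hy]
  | loop_neg _ => rfl
  | call c x z σ => exact Function.update_of_ne hy _ _

/-- Arrays to which a program cannot write keep their contents. In this way the data of a level
survive calls of the levels below. -/
lemma Runs.frame {n m : ℕ} {O : Oracles n m} {p : Prog} {σ : State} {Q : State → Prop} {b : ℕ}
    (h : Runs O p σ Q b) : Runs O p σ (fun τ => Q τ ∧ ∀ y, ¬ p.Mods y → τ y = σ y) b := by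
  obtain ⟨τ, t, h1, h2, h3⟩ := h
  exact ⟨τ, t, h1, h2, h3, fun y hy => h1.frame hy⟩

/-! ## Filling arrays -/

/-- Writes the values of a list of expressions into the cells `base + p, base + p + 1, …` of the
array `x`. -/
def fill (x : ℕ) (base : Expr) : ℕ → List Expr → Prog
  | _, [] => .skip
  | p, e :: l => .seq (.assign x (.add base (.const p)) e) (fill x base (p + 1) l)

lemma eq_of_mods_fill {x y : ℕ} {base : Expr} {l : List Expr} {p : ℕ}
    (h : (fill x base p l).Mods y) : y = x := by
  induction l generalizing p with
  | nil => exact h.elim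
  | cons e l ih => exact h.elim id ih

/-- The constant precedes memory, oracles and sizes: it depends only on the expressions. As x is not
in A, the writes affect neither the base address nor the expressions still to be evaluated. -/
lemma exists_runs_fill (base : Expr) (l : List Expr) (p : ℕ) : ∃ c : ℕ, ∀ {n m : ℕ}
    (O : Oracles n m) (x : ℕ) (σ : State) (s : ℕ) (A : Set ℕ), x ∉ A → base.Ok σ s A →
    (∀ e ∈ l, e.Ok σ s A) → Runs O (fill x base p l) σ
      (fun τ => τ = Function.update σ x
        (writeAt (σ x) (base.val σ + p) (l.map (Expr.val σ)))) (c * (s + 1)) := by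
  induction l generalizing p with
  | nil =>
    refine ⟨1, fun O x σ s A _ _ _ => Runs.skip ?_ (by nlinarith)⟩
    simp [writeAt_nil]
  | cons e l ih =>
    obtain ⟨c, hc⟩ := ih (p + 1)
    refine ⟨1 + (1 + (Expr.add base (.const p)).weight + e.weight) + c,
      fun O x σ s A hx hb hl => ?_⟩
    refine Runs.seq (Runs.assign (A := A) (s := s) (Q := fun τ => τ = _) ⟨hb, trivial⟩
      (hl e (by simp)) rfl le_rfl) ?_ (c := c * (s + 1)) (by nlinarith)
    rintro τ rfl
    have hA : ∀ y ∈ A, Function.update σ x (Function.update (σ x)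
        ((base.add (.const p)).val σ) (e.val σ)) y = σ y := fun y hy =>
      Function.update_of_ne (by rintro rfl; exact hx hy) _ _
    refine (hc O x _ s A hx (hb.transfer hA)
      (fun e' he' => (hl e' (by simp [he'])).transfer hA)).mono ?_ le_rfl
    rintro τ rfl
    rw [Function.update_idem, Function.update_self, hb.val_eq hA, List.map_cons, writeAt_cons]
    congr 2
    · push_cast; ring
    · exact List.map_congr_left fun e' he' => (hl e' (by simp [he'])).val_eq hA

lemma runs_call {n m : ℕ} (O : Oracles n m) (c : Call) (x y : ℕ) (σ : State) {a b : ℕ}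
    (ha : querySize n (σ x) c ≤ a) (hb : listSize (O.reply (σ x) c) ≤ b) :
    Runs O (.call c x y) σ
      (fun τ => τ = Function.update σ y (writeList (σ y) (O.reply (σ x) c))) (1 + a + b) :=
  ⟨_, _, .call c x y σ, by omega, rfl⟩

/-! ## Polynomially bounded functions -/

/-- The function is bounded by a polynomial. -/
def PolyBdd (g : ℕ → ℕ) : Prop := ∃ C d : ℕ, ∀ s, g s ≤ C * (s + 1) ^ d

namespace PolyBdd

lemma const (c : ℕ) : PolyBdd fun _ => c := ⟨c, 0, fun s => by simp⟩

lemma id : PolyBdd fun s => s := ⟨1, 1, fun s => by simp⟩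

lemma add {f g : ℕ → ℕ} (hf : PolyBdd f) (hg : PolyBdd g) : PolyBdd fun s => f s + g s := by
  obtain ⟨C, d, h⟩ := hf
  obtain ⟨C', d', h'⟩ := hg
  refine ⟨C + C', d + d', fun s => ?_⟩
  have h1 : (s + 1) ^ d ≤ (s + 1) ^ (d + d') := Nat.pow_le_pow_right (by omega) (by omega)
  have h2 : (s + 1) ^ d' ≤ (s + 1) ^ (d + d') := Nat.pow_le_pow_right (by omega) (by omega)
  calc f s + g s ≤ C * (s + 1) ^ d + C' * (s + 1) ^ d' := Nat.add_le_add (h s) (h' s)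
    _ ≤ C * (s + 1) ^ (d + d') + C' * (s + 1) ^ (d + d') := by gcongr
    _ = _ := by ring

lemma mul {f g : ℕ → ℕ} (hf : PolyBdd f) (hg : PolyBdd g) : PolyBdd fun s => f s * g s := by
  obtain ⟨C, d, h⟩ := hf
  obtain ⟨C', d', h'⟩ := hg
  refine ⟨C * C', d + d', fun s => (Nat.mul_le_mul (h s) (h' s)).trans (le_of_eq ?_)⟩
  ring

lemma pow {f : ℕ → ℕ} (hf : PolyBdd f) (e : ℕ) : PolyBdd fun s => f s ^ e := by
  induction e with
  | zero => simpa using const 1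
  | succ e ih => simpa [pow_succ] using ih.mul hf

lemma comp {f g : ℕ → ℕ} (hf : PolyBdd f) (hg : PolyBdd g) : PolyBdd fun s => f (g s) := by
  obtain ⟨C, d, h⟩ := hf
  obtain ⟨C', d', h'⟩ := ((const C).mul ((hg.add (const 1)).pow d))
  exact ⟨C', d', fun s => (h (g s)).trans (h' s)⟩

end PolyBdd


/-! ### Queries to the integer optimization oracle. -/

/-! ## Integer points of polyhedra and affine spaces -/

lemma sum_mul_intPoint {n : ℕ} (a z : Fin n → ℤ) :
    ∑ j, (a j : ℝ) * intPoint z j = ((a ⬝ᵥ z : ℤ) : ℝ) := by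
  simp [intPoint, dotProduct]

lemma intPoint_mem_polyhedron {n : ℕ} {S : List (Row n)} {z : Fin n → ℤ} :
    intPoint z ∈ polyhedron S ↔ ∀ r ∈ S, r.1 ⬝ᵥ z ≤ r.2 := by
  simp only [polyhedron, Set.mem_ofPred_eq, sum_mul_intPoint, Int.cast_le]

lemma intPoint_mem_affineSpace {n : ℕ} {S : List (Row n)} {z : Fin n → ℤ} :
    intPoint z ∈ affineSpace S ↔ ∀ r ∈ S, r.1 ⬝ᵥ z = r.2 := by
  simp only [affineSpace, Set.mem_ofPred_eq, sum_mul_intPoint, Int.cast_inj]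

/-- The inequalities of the box with radius `R`. -/
def boxRows (n : ℕ) (R : ℤ) : List (Row n) :=
  (List.finRange n).flatMap fun j => [(Pi.single j 1, R), (Pi.single j (-1), R)]

/-- The inequalities of the box with radius `R`, as expressions. -/
def boxE (n : ℕ) (R : Expr) : List (RowE n) :=
  (List.finRange n).flatMap fun j =>
    [(fun i => .const (if i = j then 1 else 0), R), (fun i => .const (if i = j then -1 else 0), R)]

lemma map_val_boxE (n : ℕ) (R : Expr) (σ : State) :
    (boxE n R).map (RowE.val σ) = boxRows n (R.val σ) := by
  simp only [boxE, boxRows, List.map_flatMap]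
  congr 1
  funext j
  simp only [List.map_cons, List.map_nil, RowE.val, Expr.val]
  congr 2
  · ext i; simp [Pi.single_apply]
  · congr 2; ext i; simp [Pi.single_apply]

lemma ok_boxE {n : ℕ} {R : Expr} {σ : State} {s : ℕ} {A : Set ℕ} (h : R.Ok σ s A) :
    ∀ r ∈ boxE n R, r.Ok σ s A := by
  intro r hr
  simp only [boxE, List.mem_flatMap, List.mem_cons, List.not_mem_nil, or_false] at hr
  obtain ⟨j, _, rfl | rfl⟩ := hr <;> exact ⟨fun i => trivial, h⟩

lemma forall_mem_boxRows {n : ℕ} {R : ℤ} {z : Fin n → ℤ} :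
    (∀ r ∈ boxRows n R, r.1 ⬝ᵥ z ≤ r.2) ↔ ∀ j, |z j| ≤ R := by
  simp only [boxRows, List.mem_flatMap, List.mem_cons, List.not_mem_nil, or_false,
    List.mem_finRange, true_and, abs_le]
  constructor
  · intro h j
    have h1 := h _ ⟨j, Or.inl rfl⟩
    have h2 := h _ ⟨j, Or.inr rfl⟩
    rw [single_dotProduct] at h1 h2
    constructor <;> linarith
  · rintro h r ⟨j, rfl | rfl⟩ <;> rw [single_dotProduct] <;> have := h j <;> linarith

lemma isBounded_polyhedron {n : ℕ} {R : ℤ} {S : List (Row n)} (h : boxRows n R ⊆ S) :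
    Bornology.IsBounded (polyhedron S) := by
  refine (Metric.isBounded_iff_subset_closedBall 0).2 ⟨|(R : ℝ)|, fun x hx => ?_⟩
  rw [mem_closedBall_zero_iff, pi_norm_le_iff_of_nonneg (abs_nonneg _)]
  intro j
  have hr : ∀ c : ℤ, ∑ i, ((Pi.single j c : Fin n → ℤ) i : ℝ) * x i = c * x j := by
    intro c
    rw [Finset.sum_eq_single j]
    · simp
    · intro i _ hij; simp [hij]
    · simp
  have h1 := hx (Pi.single j 1, R) (h (List.mem_flatMap.2 ⟨j, List.mem_finRange j, by simp⟩))
  have h2 := hx (Pi.single j (-1), R) (h (List.mem_flatMap.2 ⟨j, List.mem_finRange j, by simp⟩))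
  rw [hr] at h1 h2
  push_cast at h1 h2
  have := le_abs_self (R : ℝ)
  rw [Real.norm_eq_abs, abs_le]
  constructor <;> linarith

lemma subset_box_of_boxRows {n : ℕ} {R : ℤ} {S : List (Row n)} (h : boxRows n R ⊆ S)
    {z : Fin n → ℤ} (hz : intPoint z ∈ polyhedron S) : ∀ j, |z j| ≤ R :=
  forall_mem_boxRows.1 fun r hr => intPoint_mem_polyhedron.1 hz r (h hr)

/-! ## Integer feasibility queries with a constant number of rows -/

lemma listSize_map_val_le {σ : State} {s : ℕ} {A : Set ℕ} {l : List Expr}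
    (h : ∀ e ∈ l, e.Ok σ s A) :
    listSize (l.map (Expr.val σ)) ≤ (l.map fun e => 1 + e.weight).sum * (s + 1) := by
  induction l with
  | nil => simp [listSize]
  | cons e l ih =>
    have h1 := ih fun e' he' => h e' (by simp [he'])
    have h2 := (h e (by simp)).bits_val_le
    simp only [listSize, List.map_cons, List.sum_cons, List.map_map] at *
    nlinarith

lemma listSize_encodeOption_le {n : ℕ} {o : Option (Fin n → ℤ)} {b : ℕ}
    (h : ∀ z, o = some z → ∀ j, bits (z j) ≤ b) :
    listSize (encodeOption List.ofFn o) ≤ 2 + n * (b + 1) := by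
  cases o with
  | none => simp [encodeOption, listSize]; omega
  | some z =>
    have h1 : listSize (List.ofFn z) ≤ (List.ofFn z).length * (b + 1) :=
      listSize_le fun y hy => by
        obtain ⟨j, rfl⟩ := (List.mem_ofFn' _ _).1 hy
        exact h z rfl j
    rw [List.length_ofFn] at h1
    simp only [encodeOption, listSize, List.map_cons, List.sum_cons, bits_one] at *
    omega

/-- Asks for an integer point of the polyhedron given by a list of rows, stored in `x`; the answer
is stored in `y`. -/
def intQuery {n : ℕ} (x y : ℕ) (rows : List (RowE n)) : Prog :=
  .seq (fill x (.const 0) 0 (.const rows.length ::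
    (List.ofFn (fun _ : Fin n => Expr.const 0) ++ flatRows rows))) (.call .opt x y)

lemma eq_or_eq_of_mods_intQuery {n : ℕ} {x y z : ℕ} {rows : List (RowE n)}
    (h : (intQuery x y rows).Mods z) : z = x ∨ z = y := by
  rcases h with h | h
  · exact Or.inl (eq_of_mods_fill h)
  · exact Or.inr h

/-- The array holds an answer to the question for an integer point with property `p`. -/
def IsAnswer {n : ℕ} (p : (Fin n → ℤ) → Prop) (a : ℤ → ℤ) : Prop :=
  (a 0 = 1 ∧ p (readIntVec n a 1)) ∨ (a 0 = 0 ∧ ∀ z, ¬ p z)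

lemma isAnswer_writeList {n : ℕ} {p : (Fin n → ℤ) → Prop} {o : Option (Fin n → ℤ)}
    (h1 : ∀ z, o = some z → p z) (h2 : o = none → ∀ z, ¬ p z) (a : ℤ → ℤ) :
    IsAnswer p (writeList a (encodeOption List.ofFn o)) := by
  have hw := holds_writeList a (encodeOption List.ofFn o)
  cases o with
  | none =>
    right
    simp only [encodeOption, holds_singleton] at hw
    exact ⟨hw, h2 rfl⟩
  | some z =>
    left
    simp only [encodeOption, holds_cons, holds_ofFn] at hw
    refine ⟨hw.1, ?_⟩
    rw [show (1 : ℤ) = 0 + 1 by norm_num]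
    simp only [encodeOption]
    rw [hw.2]; exact h1 z rfl

lemma IsAnswer.congr {n : ℕ} {p q : (Fin n → ℤ) → Prop} {a : ℤ → ℤ} (h : IsAnswer p a)
    (hpq : ∀ z, p z ↔ q z) : IsAnswer q a := by
  rcases h with ⟨h1, h2⟩ | ⟨h1, h2⟩
  · exact Or.inl ⟨h1, (hpq _).1 h2⟩
  · exact Or.inr ⟨h1, fun z hz => h2 z ((hpq z).2 hz)⟩

/-- The box rows serve twice: they make the polyhedron bounded, so that the answer is meaningful,
and they bound the digits of the answer. The objective is zero. -/
lemma exists_runs_intQuery {n : ℕ} (R : Expr) (rows : List (RowE n)) : ∃ c : ℕ, ∀ {m : ℕ}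
    {f : Fin (m + 1) → (Fin n → ℝ) → ℝ} {ε : ℝ} {B Δ : ℕ} {O : Oracles n m}
    (_ : O.Valid f ε B Δ) (x y : ℕ) (σ : State) (s : ℕ) (A : Set ℕ),
    x ∉ A → R.Ok σ s A → (∀ r ∈ rows, r.Ok σ s A) →
    Runs O (intQuery x y (boxE n R ++ rows)) σ
      (fun τ => (∀ z, z ≠ x → z ≠ y → τ z = σ z) ∧
        IsAnswer (fun z => (∀ j, |z j| ≤ R.val σ) ∧
          ∀ r ∈ rows, (r.val σ).1 ⬝ᵥ z ≤ (r.val σ).2) (τ y))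
      (c * (s + 1)) := by
  set L : List Expr := .const (boxE n R ++ rows).length ::
    (List.ofFn (fun _ : Fin n => Expr.const 0) ++ flatRows (boxE n R ++ rows)) with hL
  obtain ⟨c, hc⟩ := exists_runs_fill (.const 0) L 0
  refine ⟨1 + c + (1 + (L.map fun e => 1 + e.weight).sum + (2 + n * (R.weight + 1))),
    fun {m f ε B Δ O} hO x y σ s A hx hR hrows => ?_⟩
  have hrowsE : ∀ r ∈ boxE n R ++ rows, r.Ok σ s A := by
    intro r hr
    rcases List.mem_append.1 hr with hr | hr
    · exact ok_boxE hR r hr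
    · exact hrows r hr
  have hok : ∀ e ∈ L, e.Ok σ s A := by
    intro e he
    rcases List.mem_cons.1 he with rfl | he
    · trivial
    rcases List.mem_append.1 he with he | he
    · obtain ⟨j, rfl⟩ := (List.mem_ofFn' _ _).1 he
      trivial
    · exact forall_mem_flatRows.2 hrowsE e he
  have hfill := hc O x σ s A hx trivial hok
  refine (Runs.seq (c := 1 + (L.map fun e => 1 + e.weight).sum * (s + 1) +
    (2 + n * (R.weight * (s + 1) + 1))) hfill ?_ le_rfl).frame.mono
    (fun τ h => ⟨fun z hzx hzy => h.2 z ?_, h.1⟩) ?_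
  rotate_left
  · intro hz
    rcases eq_or_eq_of_mods_intQuery hz with h | h
    · exact hzx h
    · exact hzy h
  · nlinarith
  rintro τ rfl
  set ρ : State := Function.update σ x
    (writeAt (σ x) ((Expr.const 0).val σ + ((0 : ℕ) : ℤ)) (L.map (Expr.val σ))) with hρ
  have hholds : Holds (ρ x) 0 (L.map (Expr.val σ)) := by
    simp only [hρ, Function.update_self, Expr.val, Nat.cast_zero, add_zero]
    exact holds_writeAt _ _ _
  set S : List (Row n) := boxRows n (R.val σ) ++ rows.map (RowE.val σ) with hS
  have hSlen : S.length = (boxE n R ++ rows).length := by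
    rw [hS, ← map_val_boxE]; simp
  have hLval : L.map (Expr.val σ) =
      (S.length : ℤ) :: (List.ofFn (fun _ : Fin n => (0 : ℤ)) ++ flatRows S) := by
    rw [hL, List.map_cons, List.map_append, map_flatRows, List.map_append, map_val_boxE,
      List.map_ofFn, ← hS, hSlen]
    rfl
  have hholds' := hholds
  rw [hLval, holds_cons, holds_append, holds_ofFn, List.length_ofFn, holds_flatRows] at hholds'
  obtain ⟨h0, hobj, hsys⟩ := hholds'
  have hqs : querySize n (ρ x) .opt ≤ (L.map fun e => 1 + e.weight).sum * (s + 1) := by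
    rw [querySize_of_holds hholds]
    · exact listSize_map_val_le hok
    · rw [queryLength, h0, hLval]
      simp [length_flatRows]; ring
  have hreply : O.reply (ρ x) .opt = encodeOption List.ofFn (O.opt S (fun _ => 0)) := by
    simp only [Oracles.reply, h0, Int.toNat_natCast]
    rw [show (1 : ℤ) + n = 0 + 1 + n by ring, hsys, show (1 : ℤ) = 0 + 1 by ring, hobj]
  have hbd : Bornology.IsBounded (polyhedron S) :=
    isBounded_polyhedron (R := R.val σ) (List.subset_append_left _ _)
  have hmem : ∀ z, intPoint z ∈ polyhedron S ↔ (∀ j, |z j| ≤ R.val σ) ∧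
      ∀ r ∈ rows, (r.val σ).1 ⬝ᵥ z ≤ (r.val σ).2 := by
    intro z
    rw [intPoint_mem_polyhedron, hS, List.forall_mem_append, forall_mem_boxRows,
      List.forall_mem_map]
  have hsize : listSize (O.reply (ρ x) .opt) ≤ 2 + n * (R.weight * (s + 1) + 1) := by
    rw [hreply]
    refine listSize_encodeOption_le fun z hz j => ?_
    have := ((hmem z).1 (hO.opt_some S _ z hbd hz).1).1 j
    exact (bits_le_of_abs_le this).trans hR.bits_val_le
  refine (runs_call O .opt x y ρ hqs hsize).mono ?_ le_rfl
  rintro τ rfl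
  rw [Function.update_self, hreply]
  exact isAnswer_writeList (fun z hz => (hmem z).1 (hO.opt_some S _ z hbd hz).1)
    (fun hn z hz => hO.opt_none S _ hbd hn z ((hmem z).2 hz)) _

/-- Searches for an integer point in the box with radius `R` that satisfies the rows and at least
one of the candidate rows. -/
def search {n : ℕ} (x y : ℕ) (R : Expr) (rows : List (RowE n)) : List (RowE n) → Prog
  | [] => .assign y (.const 0) (.const 0)
  | r :: l => .seq (intQuery x y (boxE n R ++ (r :: rows)))
      (.cond (.get y (.const 0)) .skip (search x y R rows l))

lemma eq_or_eq_of_mods_search {n : ℕ} {x y z : ℕ} {R : Expr} {rows l : List (RowE n)}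
    (h : (search x y R rows l).Mods z) : z = x ∨ z = y := by
  induction l with
  | nil => exact Or.inr h
  | cons r l ih =>
    rcases h with h | h | h
    · exact eq_or_eq_of_mods_intQuery h
    · exact h.elim
    · exact ih h

/-- A disjunction of inequalities is not convex, so each candidate gets its own query. Their number
is fixed with the program, hence the cost is linear in s. -/
lemma exists_runs_search {n : ℕ} (R : Expr) (rows l : List (RowE n)) : ∃ c : ℕ, ∀ {m : ℕ}
    {f : Fin (m + 1) → (Fin n → ℝ) → ℝ} {ε : ℝ} {B Δ : ℕ} {O : Oracles n m}
    (_ : O.Valid f ε B Δ) (x y : ℕ) (σ : State) (s : ℕ) (A : Set ℕ),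
    x ∉ A → y ∉ A → R.Ok σ s A → (∀ r ∈ rows, r.Ok σ s A) → (∀ r ∈ l, r.Ok σ s A) →
    Runs O (search x y R rows l) σ
      (fun τ => (∀ z, z ≠ x → z ≠ y → τ z = σ z) ∧
        IsAnswer (fun z => (∀ j, |z j| ≤ R.val σ) ∧
          (∀ r ∈ rows, (r.val σ).1 ⬝ᵥ z ≤ (r.val σ).2) ∧
          ∃ r ∈ l, (r.val σ).1 ⬝ᵥ z ≤ (r.val σ).2) (τ y))
      (c * (s + 1)) := by
  induction l with
  | nil =>
    refine ⟨3, fun hO x y σ s A hx hy hR hrows _ => ?_⟩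
    refine Runs.assign (s := s) (A := A) trivial trivial ⟨fun z _ hz =>
      Function.update_of_ne hz _ _, Or.inr ⟨?_, ?_⟩⟩ ?_
    · simp [Expr.val]
    · simp
    · simp [Expr.weight]
  | cons r l ih =>
    obtain ⟨c₁, h₁⟩ := exists_runs_intQuery R (r :: rows)
    obtain ⟨c₂, h₂⟩ := ih
    refine ⟨1 + c₁ + (8 + (1 + c₂)), fun {m f ε B Δ O} hO x y σ s A hx hy hR hrows hl => ?_⟩
    refine Runs.seq (h₁ hO x y σ s A hx hR (by
      intro r' hr'
      rcases List.mem_cons.1 hr' with rfl | hr'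
      · exact hl _ (by simp)
      · exact hrows _ hr')) (c := (8 + (1 + c₂)) * (s + 1)) ?_ (by nlinarith)
    rintro τ ⟨hfr, hans⟩
    have hA : ∀ z ∈ A, τ z = σ z := fun z hz => hfr z (by rintro rfl; exact hx hz)
      (by rintro rfl; exact hy hz)
    have hget : (Expr.get y (.const 0)).Ok τ (s + 1) {y} := by
      refine ⟨rfl, ?_, trivial⟩
      rcases hans with ⟨h, _⟩ | ⟨h, _⟩ <;> simp [Expr.val, h]
    refine Runs.cond hget (c := (1 + c₂) * (s + 1)) (fun hpos => ?_) (fun hneg => ?_)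
      (by simp [Expr.weight]; nlinarith)
    · refine Runs.skip ⟨hfr, Or.inl ?_⟩ (by nlinarith)
      rcases hans with ⟨h, hz⟩ | ⟨h, _⟩
      · exact ⟨h, hz.1, fun r' hr' => hz.2 r' (by simp [hr']), r, by simp, hz.2 r (by simp)⟩
      · simp [Expr.val, h] at hpos
    · have hnone : ∀ z, ¬((∀ j, |z j| ≤ R.val σ) ∧
          ∀ r' ∈ r :: rows, (r'.val σ).1 ⬝ᵥ z ≤ (r'.val σ).2) := by
        rcases hans with ⟨h, _⟩ | ⟨_, h⟩
        · simp [Expr.val, h] at hneg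
        · exact h
      refine (h₂ hO x y τ s A hx hy (hR.transfer hA)
        (fun r' hr' => (hrows r' hr').transfer hA)
        (fun r' hr' => (hl r' (by simp [hr'])).transfer hA)).mono ?_ (by nlinarith)
      rintro υ ⟨hfr', hans'⟩
      refine ⟨fun z hzx hzy => (hfr' z hzx hzy).trans (hfr z hzx hzy), hans'.congr fun z => ?_⟩
      rw [hR.val_eq hA]
      refine and_congr_right fun hbox => ?_
      have e1 : ∀ r' ∈ rows, r'.val τ = r'.val σ := fun r' hr' => (hrows r' hr').val_eq hA
      have e2 : ∀ r' ∈ l, r'.val τ = r'.val σ := fun r' hr' =>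
        (hl r' (by simp [hr'])).val_eq hA
      constructor
      · rintro ⟨h3, r', hr', h4⟩
        exact ⟨fun q hq => by rw [← e1 q hq]; exact h3 q hq, r', by simp [hr'],
          by rw [← e2 r' hr']; exact h4⟩
      · rintro ⟨h3, r', hr', h4⟩
        refine ⟨fun q hq => by rw [e1 q hq]; exact h3 q hq, ?_⟩
        rcases List.mem_cons.1 hr' with rfl | hr'
        · exact (hnone z ⟨hbox, fun q hq => by
            rcases List.mem_cons.1 hq with rfl | hq
            · exact h4
            · exact h3 q hq⟩).elim
        · exact ⟨r', hr', by rw [e2 r' hr']; exact h4⟩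


/-! ### The interface between a level and the next one. -/

/-! ## Specification of the recursive levels -/

/-- The oracles satisfy their specification and answer separation queries at polynomial length. -/
structure Setting {n m : ℕ} (C₀ d₀ : ℕ) (f : Fin (m + 1) → (Fin n → ℝ) → ℝ) (ε : ℝ) (B Δ : ℕ)
    (O : Oracles n m) : Prop where
  valid : O.Valid f ε B Δ
  pos : 0 < ε
  one_le : 1 ≤ Δ
  subset_box : levelSet f 0 ⊆ box n B
  size : O.SepPolySize B Δ C₀ d₀

/-- The `j`-th row of `n + 1` cells of an array. -/
def hrow (n : ℕ) (E : ℤ → ℤ) (j : ℕ) : Row n :=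
  (readIntVec n E ((j * (n + 1) : ℕ) : ℤ), E ((j * (n + 1) + n : ℕ) : ℤ))

/-- The first `r` rows of an array. -/
def eqs (n : ℕ) (E : ℤ → ℤ) (r : ℕ) : List (Row n) := (List.range r).map (hrow n E)

lemma eqs_eq_readSystem (n : ℕ) (E : ℤ → ℤ) (r : ℕ) : eqs n E r = readSystem n E 0 r := by
  rw [readSystem_eq_map, eqs]
  refine List.map_congr_left fun j _ => ?_
  simp [hrow]

@[simp] lemma length_eqs (n : ℕ) (E : ℤ → ℤ) (r : ℕ) : (eqs n E r).length = r := by simp [eqs]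

/-- Admissible input of a level: `r` independent rows with entries of at most `s` digits. -/
structure LevelPre (n r : ℕ) (E : ℤ → ℤ) (B Δ s : ℕ) : Prop where
  bits_B : bits B ≤ s
  log_Δ : Nat.log 2 Δ ≤ s
  bits_fst : ∀ j < r, ∀ i, bits ((hrow n E j).1 i) ≤ s
  bits_snd : ∀ j < r, bits (hrow n E j).2 ≤ s
  indep : LinearIndependent ℝ fun j : Fin r => intPoint (hrow n E j).1

/-- The output in array `0` is correct for the affine space of `S`. -/
def Post {n m : ℕ} (f : Fin (m + 1) → (Fin n → ℝ) → ℝ) (ε : ℝ) (S : List (Row n))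
    (σ : State) : Prop :=
  (σ 0 0 = 1 ∧ intPoint (readIntVec n (σ 0) 1) ∈ levelSet f ε) ∨
  (σ 0 0 = 0 ∧ ∀ z : Fin n → ℤ, intPoint z ∈ affineSpace S → intPoint z ∉ levelSet f 0)

/-- The program with input array `e` solves the problem for `r` equations of size `S` at cost
`U`. -/
def ChildOk {n m : ℕ} (f : Fin (m + 1) → (Fin n → ℝ) → ℝ) (ε : ℝ) (B Δ : ℕ) (O : Oracles n m)
    (ch : Prog) (e r S U : ℕ) : Prop :=
  ∀ (E : ℤ → ℤ) (τ : State), LevelPre n r E B Δ S → τ e = E → τ 3 0 = (B : ℤ) → Runs O ch τ (Post f ε (eqs n E r)) U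

/-- Bounds for the sizes of numbers and for the costs within a level: `s` bounds the input, `s₁`
the derived directions, `S` the derived rows, and `U` is the unit of cost. -/
structure Sizes (c C₀ d₀ s s₁ S U : ℕ) : Prop where
  le₁ : (c + 1) * (s + 1) ≤ s₁
  sep : C₀ * (c * (s + 1)) ^ d₀ ≤ s₁
  le₂ : (c + 1) * (s₁ + 1) ≤ S
  le₃ : (S + 1) ^ 2 ≤ U

lemma Sizes.mono {c c' C₀ d₀ s s₁ S U : ℕ} (h : Sizes c C₀ d₀ s s₁ S U) (hc : c' ≤ c) :
    Sizes c' C₀ d₀ s s₁ S U where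
  le₁ := le_trans (by gcongr) h.le₁
  sep := le_trans (by gcongr) h.sep
  le₂ := le_trans (by gcongr) h.le₂
  le₃ := h.le₃

lemma Sizes.s_le {c C₀ d₀ s s₁ S U : ℕ} (h : Sizes c C₀ d₀ s s₁ S U) : s ≤ s₁ := by
  have := h.le₁; nlinarith

lemma Sizes.s₁_le {c C₀ d₀ s s₁ S U : ℕ} (h : Sizes c C₀ d₀ s s₁ S U) : s₁ ≤ S := by
  have := h.le₂; nlinarith

lemma Sizes.S_le {c C₀ d₀ s s₁ S U : ℕ} (h : Sizes c C₀ d₀ s s₁ S U) : S + 1 ≤ U := by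
  have := h.le₃; nlinarith

lemma Sizes.mul_le {c C₀ d₀ s s₁ S U w : ℕ} (h : Sizes c C₀ d₀ s s₁ S U) (hw : w ≤ c) :
    w * (s₁ + 1) ≤ S :=
  le_trans (Nat.mul_le_mul_right _ (by omega)) h.le₂

/-! ## Expressions for the equations of a level -/

/-- The rows stored in array `b`. -/
def eqE (n b r : ℕ) : List (RowE n) :=
  (List.range r).map fun j => (cells n b (j * (n + 1)), .get b (.const (j * (n + 1) + n : ℕ)))

lemma map_val_eqE (n b r : ℕ) (σ : State) : (eqE n b r).map (RowE.val σ) = eqs n (σ b) r := by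
  rw [eqE, eqs, List.map_map]
  rfl

lemma ok_eqE {n b r B Δ s : ℕ} {σ : State} (h : LevelPre n r (σ b) B Δ s) {A : Set ℕ}
    (hb : b ∈ A) : ∀ q ∈ eqE n b r, q.Ok σ s A := by
  intro q hq
  obtain ⟨j, hj, rfl⟩ := List.mem_map.1 hq
  rw [List.mem_range] at hj
  exact ⟨ok_cells hb (h.bits_fst j hj), hb, h.bits_snd j hj, trivial⟩

lemma RowE.Ok.mono {n : ℕ} {σ : State} {s s' : ℕ} {A A' : Set ℕ} {r : RowE n} (h : r.Ok σ s A)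
    (hs : s ≤ s') (hA : A ⊆ A') : r.Ok σ s' A' :=
  ⟨fun j => (h.1 j).mono hs hA, h.2.mono hs hA⟩

lemma ok_flatRows {n : ℕ} {σ : State} {s : ℕ} {A : Set ℕ} {l : List (RowE n)}
    (h : ∀ r ∈ l, r.Ok σ s A) : ∀ e ∈ flatRows l, e.Ok σ s A :=
  forall_mem_flatRows.2 h

lemma eqs_of_holds {n : ℕ} {E : ℤ → ℤ} {l : List (Row n)} (h : Holds E 0 (flatRows l)) :
    eqs n E l.length = l := by
  rw [eqs_eq_readSystem]; exact holds_flatRows.1 h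

lemma hrow_eq_getElem {n r j : ℕ} {E : ℤ → ℤ} {l : List (Row n)} (h : eqs n E r = l)
    (hj : j < r) : hrow n E j = l[j]'(by rw [← h]; simpa using hj) := by
  subst h; simp [eqs]

/-! ## Calling the next level -/

/-- Adds an equation to those stored in `b`, hands them to the program `ch` with input array `e`
and runs it. -/
def callChild {n : ℕ} (b e r : ℕ) (ch : Prog) (v : Fin n → Expr) (β : Expr) : Prog :=
  .seq (fill e (.const 0) 0 (flatRows (eqE n b r ++ [(v, β)]))) ch

/-- Pairing a linear relation with w isolates the last coefficient. -/
lemma linearIndependent_extend {n r : ℕ} {h : ℕ → Fin n → ℤ}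
    (hind : LinearIndependent ℝ fun j : Fin r => intPoint (h j)) {w : Fin n → ℤ}
    (hw : ∀ j < r, h j ⬝ᵥ w = 0) (hw' : h r ⬝ᵥ w ≠ 0) :
    LinearIndependent ℝ fun j : Fin (r + 1) => intPoint (h j) := by
  rw [Fintype.linearIndependent_iff] at hind ⊢
  intro g hg
  rw [Fin.sum_univ_castSucc] at hg
  have h1 : g (Fin.last r) = 0 := by
    have h2 := congrArg (fun x => x ⬝ᵥ intPoint w) hg
    simp only [add_dotProduct, sum_dotProduct, smul_dotProduct, intPoint_dotProduct,
      zero_dotProduct, Fin.val_castSucc, Fin.val_last] at h2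
    rw [Finset.sum_eq_zero fun j _ => by rw [hw j j.2]; simp, zero_add, smul_eq_mul,
      mul_eq_zero] at h2
    exact h2.resolve_right (by exact_mod_cast hw')
  rw [h1, zero_smul, add_zero] at hg
  have h3 := hind (fun j => g j.castSucc) hg
  intro j
  refine Fin.lastCases h1 h3 j

/-- The vector w certifies that the new equation is independent of the old ones, so the dimension
drops by exactly one. Array 3 and the arrays from b on are beyond the reach of the child. -/
lemma exists_runs_callChild {n : ℕ} (b e r : ℕ) (ch : Prog) (v : Fin n → Expr) (β : Expr)
    (heb : e < b) (he : 4 ≤ e) (hmods : ∀ y, ch.Mods y → y = 0 ∨ 4 ≤ y ∧ y < b) :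
    ∃ c : ℕ, ∀ {m C₀ d₀ : ℕ} {f : Fin (m + 1) → (Fin n → ℝ) → ℝ} {ε : ℝ} {B Δ : ℕ}
    {O : Oracles n m} {s s₁ S U : ℕ}, Sizes c C₀ d₀ s s₁ S U →
    ChildOk f ε B Δ O ch e (r + 1) S U → ∀ (σ : State), LevelPre n r (σ b) B Δ s → σ 3 0 = B →
    (∀ j, (v j).Ok σ s₁ {e}ᶜ) → β.Ok σ s₁ {e}ᶜ →
    (∃ w, (∀ j < r, (hrow n (σ b) j).1 ⬝ᵥ w = 0) ∧ (fun j => (v j).val σ) ⬝ᵥ w ≠ 0) →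
    Runs O (callChild b e r ch v β) σ (fun τ => (∀ y, b ≤ y ∨ y = 3 → τ y = σ y) ∧
      Post f ε (eqs n (σ b) r ++ [(fun j => (v j).val σ, β.val σ)]) τ) (c * U) := by
  obtain ⟨c, hc⟩ := exists_runs_fill (.const 0) (flatRows (eqE n b r ++ [(v, β)])) 0
  set W := β.weight + ∑ j, (v j).weight with hW
  refine ⟨2 + c + W, fun {m C₀ d₀ f ε B Δ O s s₁ S U} hs hch σ hpre h3 hv hβ hw => ?_⟩
  have hne : b ≠ e := by omega
  have hrows : ∀ q ∈ eqE n b r ++ [(v, β)], q.Ok σ s₁ {e}ᶜ := by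
    intro q hq
    rcases List.mem_append.1 hq with hq | hq
    · exact (ok_eqE hpre (A := {e}ᶜ) hne q hq).mono hs.s_le le_rfl
    · rw [List.mem_singleton.1 hq]; exact ⟨hv, hβ⟩
  have hmods' : ∀ y, b ≤ y ∨ y = 3 → ¬ (callChild b e r ch v β).Mods y := by
    intro y hy h
    rcases h with h | h
    · have := eq_of_mods_fill h; omega
    · have := hmods y h; omega
  refine (Runs.seq (hc O e σ s₁ {e}ᶜ (by simp) trivial (ok_flatRows hrows)) (c := U) ?_
    ?_).frame.mono (fun τ h => ⟨fun y hy => h.2 y (hmods' y hy), h.1⟩) le_rfl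
  swap
  · have := hs.s₁_le; have := hs.S_le
    nlinarith
  rintro τ rfl
  have hval : (flatRows (eqE n b r ++ [(v, β)])).map (Expr.val σ) =
      flatRows (eqs n (σ b) r ++ [(fun j => (v j).val σ, β.val σ)]) := by
    rw [map_flatRows, List.map_append, map_val_eqE]; rfl
  rw [hval]
  set l : List (Row n) := eqs n (σ b) r ++ [(fun j => (v j).val σ, β.val σ)] with hl
  set E' : ℤ → ℤ := writeAt (σ e) ((Expr.const 0).val σ + ((0 : ℕ) : ℤ)) (flatRows l) with hE'
  have hlen : l.length = r + 1 := by simp [hl]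
  have heqs : eqs n E' (r + 1) = l := by
    rw [← hlen]
    apply eqs_of_holds
    simp only [hE', Expr.val, Nat.cast_zero, add_zero]
    exact holds_writeAt _ _ _
  have hlt : ∀ j < r, hrow n E' j = hrow n (σ b) j := by
    intro j hj
    rw [hrow_eq_getElem heqs (by omega)]
    simp only [hl]
    rw [List.getElem_append_left (by simpa using hj)]
    simp [eqs]
  have hlast : hrow n E' r = (fun j => (v j).val σ, β.val σ) := by
    rw [hrow_eq_getElem heqs (by omega)]
    simp only [hl]
    rw [List.getElem_append_right (by simp)]
    simp
  have hvW : ∀ j, (v j).weight ≤ W := fun j =>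
    (Finset.single_le_sum (f := fun j => (v j).weight) (fun _ _ => Nat.zero_le _)
      (Finset.mem_univ j)).trans (Nat.le_add_left _ _)
  have hsS : s ≤ S := hs.s_le.trans hs.s₁_le
  have hpre' : LevelPre n (r + 1) E' B Δ S := by
    refine ⟨hpre.bits_B.trans hsS, hpre.log_Δ.trans hsS, fun j hj i => ?_, fun j hj => ?_, ?_⟩
    · rcases Nat.lt_succ_iff_lt_or_eq.1 hj with hj | rfl
      · rw [hlt j hj]; exact (hpre.bits_fst j hj i).trans hsS
      · rw [hlast]
        exact (hv i).bits_val_le.trans (hs.mul_le (by have := hvW i; omega))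
    · rcases Nat.lt_succ_iff_lt_or_eq.1 hj with hj | rfl
      · rw [hlt j hj]; exact (hpre.bits_snd j hj).trans hsS
      · rw [hlast]
        exact hβ.bits_val_le.trans (hs.mul_le (by omega))
    · obtain ⟨w, hw1, hw2⟩ := hw
      refine linearIndependent_extend (h := fun j => (hrow n E' j).1) ?_ (w := w)
        (fun j hj => ?_) ?_
      · have := hpre.indep
        convert this using 3 with j
        rw [hlt j j.2]
      · rw [hlt j hj]; exact hw1 j hj
      · rw [hlast]; exact hw2
  have := hch E' (Function.update σ e E') hpre' (Function.update_self _ _ _)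
    (by rw [Function.update_of_ne (by omega)]; exact h3)
  rwa [heqs] at this

/-! ## Sweeping parallel hyperplanes -/

/-- Solves the problem on the hyperplanes `v · x = v · o + t - W` for `t < T`, where `v` is stored
in array `b + 7` and `o` in array `b + 10`. -/
def sweepLoop (n b e r : ℕ) (ch : Prog) (W : ℕ) : ℕ → Prog
  | 0 => .assign 0 (.const 0) (.const 0)
  | T + 1 => .seq (callChild b e r ch (cells n (b + 7) 0)
      (.add (dotE (cells n (b + 7) 0) (cells n (b + 10) 0)) (.const ((T : ℤ) - W))))
      (.cond (.get 0 (.const 0)) .skip (sweepLoop n b e r ch W T))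

/-- Stops the main loop and solves the problem on the hyperplanes `v · x = v · o + t` for
`|t| ≤ W`. -/
def sweep {n : ℕ} (b e r : ℕ) (ch : Prog) (W : ℕ) (v : Fin n → Expr) : Prog :=
  .seq (.assign (b + 9) (.const 0) (.const 0)) (.seq (fill (b + 7) (.const 0) 0 (List.ofFn v))
    (sweepLoop n b e r ch W (2 * W + 1)))

lemma mods_sweepLoop {n b e r W T : ℕ} {ch : Prog} (heb : e < b) (he : 4 ≤ e)
    (hmods : ∀ y, ch.Mods y → y = 0 ∨ 4 ≤ y ∧ y < b) {y : ℕ}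
    (h : (sweepLoop n b e r ch W T).Mods y) : y = 0 ∨ 4 ≤ y ∧ y < b := by
  induction T with
  | zero => exact Or.inl h
  | succ T ih =>
    rcases h with (h | h) | h | h
    · have := eq_of_mods_fill h; omega
    · exact hmods y h
    · exact h.elim
    · exact ih h

lemma Post.val_zero {n m : ℕ} {f : Fin (m + 1) → (Fin n → ℝ) → ℝ} {ε : ℝ} {S : List (Row n)}
    {σ : State} (h : Post f ε S σ) : σ 0 0 = 0 ∨ σ 0 0 = 1 := by
  rcases h with ⟨h, _⟩ | ⟨h, _⟩ <;> omega

lemma Post.ok_get {n m : ℕ} {f : Fin (m + 1) → (Fin n → ℝ) → ℝ} {ε : ℝ} {S : List (Row n)}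
    {σ : State} (h : Post f ε S σ) : (Expr.get 0 (.const 0)).Ok σ 1 Set.univ := by
  refine ⟨trivial, ?_, trivial⟩
  rcases h.val_zero with h | h <;> simp [Expr.val, h]

lemma intPoint_mem_affineSpace_append {n : ℕ} {S : List (Row n)} {q : Row n} {z : Fin n → ℤ} :
    intPoint z ∈ affineSpace (S ++ [q]) ↔ intPoint z ∈ affineSpace S ∧ q.1 ⬝ᵥ z = q.2 := by
  simp only [intPoint_mem_affineSpace, List.forall_mem_append, List.forall_mem_singleton]

lemma exists_runs_sweepLoop (n b e r : ℕ) (ch : Prog) (W T : ℕ)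
    (heb : e < b) (he : 4 ≤ e) (hmods : ∀ y, ch.Mods y → y = 0 ∨ 4 ≤ y ∧ y < b) :
    ∃ c : ℕ, ∀ {m C₀ d₀ : ℕ} {f : Fin (m + 1) → (Fin n → ℝ) → ℝ} {ε : ℝ} {B Δ : ℕ}
    {O : Oracles n m} {s s₁ S U : ℕ}, Sizes c C₀ d₀ s s₁ S U →
    ChildOk f ε B Δ O ch e (r + 1) S U → ∀ (σ : State), LevelPre n r (σ b) B Δ s → σ 3 0 = B →
    ∀ v o : Fin n → ℤ, readIntVec n (σ (b + 7)) 0 = v → readIntVec n (σ (b + 10)) 0 = o →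
    (∀ j, bits (v j) ≤ s₁) → (∀ j, bits (o j) ≤ s₁) →
    (∃ w, (∀ j < r, (hrow n (σ b) j).1 ⬝ᵥ w = 0) ∧ v ⬝ᵥ w ≠ 0) →
    Runs O (sweepLoop n b e r ch W T) σ (fun τ =>
      (τ 0 0 = 1 ∧ intPoint (readIntVec n (τ 0) 1) ∈ levelSet f ε) ∨
      (τ 0 0 = 0 ∧ ∀ z : Fin n → ℤ, intPoint z ∈ affineSpace (eqs n (σ b) r) →
        (∃ t < T, v ⬝ᵥ z = v ⬝ᵥ o + ((t : ℤ) - W)) → intPoint z ∉ levelSet f 0)) (c * U) := by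
  induction T with
  | zero =>
    refine ⟨3, fun {m C₀ d₀ f ε B Δ O s s₁ S U} hs hch σ hpre h3 v o hv ho hvb hob hw => ?_⟩
    refine Runs.assign (s := 0) (A := Set.univ) trivial trivial (Or.inr ⟨?_, ?_⟩) ?_
    · simp [Expr.val]
    · rintro z _ ⟨t, ht, _⟩; omega
    · have := hs.S_le; simp [Expr.weight]; omega
  | succ T ih =>
    obtain ⟨c₁, h₁⟩ := exists_runs_callChild b e r ch (cells n (b + 7) 0)
      (.add (dotE (cells n (b + 7) 0) (cells n (b + 10) 0)) (.const ((T : ℤ) - W))) heb he hmods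
    obtain ⟨c₂, h₂⟩ := ih
    refine ⟨10 + c₁ + c₂,
      fun {m C₀ d₀ f ε B Δ O s s₁ S U} hs hch σ hpre h3 v o hv ho hvb hob hw => ?_⟩
    have hokv : ∀ j, (cells n (b + 7) 0 j).Ok σ s₁ {e}ᶜ :=
      ok_cells (by simp; omega) (fun j => by rw [Nat.cast_zero, hv]; exact hvb j)
    have hoko : ∀ j, (cells n (b + 10) 0 j).Ok σ s₁ {e}ᶜ :=
      ok_cells (by simp; omega) (fun j => by rw [Nat.cast_zero, ho]; exact hob j)
    have hvv : (fun j => (cells n (b + 7) 0 j).val σ) = v := by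
      funext j; rw [val_cells, Nat.cast_zero, hv]
    have hoo : (fun j => (cells n (b + 10) 0 j).val σ) = o := by
      funext j; rw [val_cells, Nat.cast_zero, ho]
    have hU := hs.S_le
    refine Runs.seq (h₁ (hs.mono (by omega)) hch σ hpre h3 hokv ⟨ok_dotE hokv hoko, trivial⟩
      (by rwa [hvv])) (c := (9 + c₂) * U) ?_ (by nlinarith)
    rintro τ ⟨hfr, hpost⟩
    refine Runs.cond hpost.ok_get (c := (1 + c₂) * U) (fun hpos => ?_) (fun hneg => ?_) ?_
    · refine Runs.skip (Or.inl ?_) (by nlinarith)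
      rcases hpost with h | ⟨h, _⟩
      · exact h
      · simp [Expr.val, h] at hpos
    · have hnone := hpost.resolve_left (fun h => by simp [Expr.val, h.1] at hneg)
      have hb := hfr b (Or.inl le_rfl)
      refine (h₂ (hs.mono (by omega)) hch τ (by rwa [hb]) (by rw [hfr 3 (Or.inr rfl)]; exact h3)
        v o (by rw [hfr _ (by omega)]; exact hv) (by rw [hfr _ (by omega)]; exact ho) hvb hob
        (by rwa [hb])).mono ?_ (by nlinarith)
      rintro υ (h | ⟨h, hz⟩)
      · exact Or.inl h
      · refine Or.inr ⟨h, fun z hzA ⟨t, ht, hvz⟩ => ?_⟩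
        rcases Nat.lt_succ_iff_lt_or_eq.1 ht with ht | rfl
        · exact hz z (by rwa [hb]) ⟨t, ht, hvz⟩
        · refine hnone.2 z (intPoint_mem_affineSpace_append.2 ⟨hzA, ?_⟩)
          simp only [Expr.val, val_dotE, hvv, hoo]
          exact hvz
    · simp [Expr.weight]; nlinarith

/-- By integrality, v ⬝ᵥ (z - o) is one of the 2W + 1 integers between -W and W, so these
hyperplanes cover all integer points of K_0 in the space. W is part of the program and does not
depend on the input. -/
lemma exists_runs_sweep {n : ℕ} (b e r : ℕ) (ch : Prog) (W : ℕ) (v : Fin n → Expr)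
    (heb : e < b) (he : 4 ≤ e) (hmods : ∀ y, ch.Mods y → y = 0 ∨ 4 ≤ y ∧ y < b) :
    ∃ c : ℕ, ∀ {m C₀ d₀ : ℕ} {f : Fin (m + 1) → (Fin n → ℝ) → ℝ} {ε : ℝ} {B Δ : ℕ}
    {O : Oracles n m} {s s₁ S U : ℕ}, Sizes c C₀ d₀ s s₁ S U →
    ChildOk f ε B Δ O ch e (r + 1) S U → ∀ (σ : State), LevelPre n r (σ b) B Δ s → σ 3 0 = B →
    ∀ o : Fin n → ℤ, (∀ j, (v j).Ok σ s₁ {b + 7, b + 9}ᶜ) → readIntVec n (σ (b + 10)) 0 = o →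
    (∀ j, bits ((v j).val σ) ≤ s₁) → (∀ j, bits (o j) ≤ s₁) →
    (∃ w, (∀ j < r, (hrow n (σ b) j).1 ⬝ᵥ w = 0) ∧ (fun j => (v j).val σ) ⬝ᵥ w ≠ 0) →
    (∀ z : Fin n → ℤ, intPoint z ∈ affineSpace (eqs n (σ b) r) → intPoint z ∈ levelSet f 0 →
      |(fun j => (v j).val σ) ⬝ᵥ (z - o)| ≤ W) →
    Runs O (sweep b e r ch W v) σ (fun τ => τ (b + 9) 0 = 0 ∧ Post f ε (eqs n (σ b) r) τ)
      (c * U) := by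
  obtain ⟨c₁, h₁⟩ := exists_runs_fill (.const 0) (List.ofFn v) 0
  obtain ⟨c₂, h₂⟩ := exists_runs_sweepLoop n b e r ch W (2 * W + 1) heb he hmods
  refine ⟨5 + c₁ + c₂,
    fun {m C₀ d₀ f ε B Δ O s s₁ S U} hs hch σ hpre h3 o hv ho hvb hob hw hW => ?_⟩
  have hU := hs.S_le
  have hs₁ := hs.s₁_le
  refine Runs.seq (Runs.assign (s := 0) (A := Set.univ) (b := 3) (Q := fun τ => τ = _) trivial
    trivial rfl (by simp [Expr.weight])) (c := (1 + c₁ + c₂) * U) ?_ (by nlinarith)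
  rintro τ rfl
  set ρ : State := Function.update σ (b + 9) (Function.update (σ (b + 9))
    ((Expr.const 0).val σ) ((Expr.const 0).val σ)) with hρ
  have hA : ∀ y ∈ ({b + 7, b + 9}ᶜ : Set ℕ), ρ y = σ y := by
    intro y hy
    simp only [Set.mem_compl_iff, Set.mem_insert_iff, Set.mem_singleton_iff, not_or] at hy
    exact Function.update_of_ne hy.2 _ _
  refine Runs.seq (h₁ O (b + 7) ρ s₁ {b + 7, b + 9}ᶜ (by simp) trivial (fun q hq => by
    obtain ⟨j, rfl⟩ := (List.mem_ofFn' _ _).1 hq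
    exact (hv j).transfer hA)) (c := c₂ * U) ?_ (by nlinarith)
  rintro τ rfl
  set ρ' : State := Function.update ρ (b + 7) (writeAt (ρ (b + 7))
    ((Expr.const 0).val ρ + ((0 : ℕ) : ℤ)) ((List.ofFn v).map (Expr.val ρ))) with hρ'
  have hfr : ∀ y, y ≠ b + 7 → y ≠ b + 9 → ρ' y = σ y := by
    intro y h7 h9
    rw [hρ', Function.update_of_ne h7, hρ, Function.update_of_ne h9]
  have hread : readIntVec n (ρ' (b + 7)) 0 = fun j => (v j).val σ := by
    rw [← holds_ofFn]
    simp only [hρ', Function.update_self, Expr.val, Nat.cast_zero, add_zero, List.map_ofFn]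
    have : List.ofFn (Expr.val ρ ∘ v) = List.ofFn fun j => (v j).val σ := by
      congr 1; funext j; exact (hv j).val_eq hA
    rw [this]
    exact holds_writeAt _ _ _
  have hb : ρ' b = σ b := hfr b (by omega) (by omega)
  refine (h₂ (hs.mono (by omega)) hch ρ' (by rwa [hb])
    (by rw [hfr 3 (by omega) (by omega)]; exact h3) _ o hread
    (by rw [hfr _ (by omega) (by omega)]; exact ho) hvb hob (by rwa [hb])).frame.mono ?_ le_rfl
  rintro τ ⟨hpost, hframe⟩
  refine ⟨?_, ?_⟩
  · rw [hframe _ (fun h => by have := mods_sweepLoop heb he hmods h; omega)]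
    rw [hρ', Function.update_of_ne (by omega), hρ, Function.update_self]
    simp [Expr.val]
  · rcases hpost with h | ⟨h, hz⟩
    · exact Or.inl h
    · refine Or.inr ⟨h, fun z hzA hzK => hz z (by rwa [hb]) ?_ hzK⟩
      have h4 := abs_le.1 (hW z hzA hzK)
      rw [dotProduct_sub] at h4
      -- The hyperplane of z, with its index shifted by W to start at 0.
      refine ⟨((fun j => (v j).val σ) ⬝ᵥ z - (fun j => (v j).val σ) ⬝ᵥ o + W).toNat, ?_, ?_⟩
      · omega
      · rw [Int.toNat_of_nonneg (by omega)]; ring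


/-! ## The polytope of a level -/

/-- The integer points of a polyhedron. -/
def intPoints {n : ℕ} (S : List (Row n)) : Set (Fin n → ℤ) := {z | intPoint z ∈ polyhedron S}

lemma mem_intPoints {n : ℕ} {S : List (Row n)} {z : Fin n → ℤ} :
    z ∈ intPoints S ↔ ∀ q ∈ S, q.1 ⬝ᵥ z ≤ q.2 := intPoint_mem_polyhedron

/-- The negative of a row. -/
def negRow {n : ℕ} (q : RowE n) : RowE n :=
  (fun j => .sub (.const 0) (q.1 j), .sub (.const 0) q.2)

/-- The two inequalities for every equation of a list. -/
def pairE {n : ℕ} (l : List (RowE n)) : List (RowE n) := l.flatMap fun q => [q, negRow q]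

lemma val_negRow {n : ℕ} (σ : State) (q : RowE n) :
    (negRow q).val σ = (-(q.val σ).1, -(q.val σ).2) := by
  simp only [negRow, RowE.val, Expr.val, zero_sub]
  rfl

lemma ok_pairE {n : ℕ} {σ : State} {s : ℕ} {A : Set ℕ} {l : List (RowE n)}
    (h : ∀ q ∈ l, q.Ok σ s A) : ∀ q ∈ pairE l, q.Ok σ s A := by
  intro q hq
  simp only [pairE, List.mem_flatMap, List.mem_cons, List.not_mem_nil, or_false] at hq
  obtain ⟨p, hp, rfl | rfl⟩ := hq
  · exact h _ hp
  · exact ⟨fun j => ⟨trivial, (h _ hp).1 j⟩, trivial, (h _ hp).2⟩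

lemma forall_mem_pairE {n : ℕ} {σ : State} {l : List (RowE n)} {z : Fin n → ℤ} :
    (∀ q ∈ pairE l, (q.val σ).1 ⬝ᵥ z ≤ (q.val σ).2) ↔
      ∀ q ∈ l, (q.val σ).1 ⬝ᵥ z = (q.val σ).2 := by
  simp only [pairE, List.mem_flatMap, List.mem_cons, List.not_mem_nil, or_false]
  constructor
  · intro h q hq
    have h1 := h q ⟨q, hq, Or.inl rfl⟩
    have h2 := h (negRow q) ⟨q, hq, Or.inr rfl⟩
    rw [val_negRow, neg_dotProduct] at h2
    linarith
  · rintro h q ⟨p, hp, rfl | rfl⟩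
    · exact (h _ hp).le
    · rw [val_negRow, neg_dotProduct, h p hp]

lemma forall_mem_eqE {n b r : ℕ} {σ : State} {z : Fin n → ℤ} :
    (∀ q ∈ eqE n b r, (q.val σ).1 ⬝ᵥ z = (q.val σ).2) ↔
      intPoint z ∈ affineSpace (eqs n (σ b) r) := by
  rw [intPoint_mem_affineSpace, ← map_val_eqE, List.forall_mem_map]

/-- The array holds the rows `PS` in the format of a query for linear optimization, except for the
objective function. -/
structure PInv {n : ℕ} (a : ℤ → ℤ) (PS : List (Row n)) (S : ℕ) : Prop where
  zero : a 0 = PS.length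
  rows : Holds a (1 + n) (flatRows PS)
  bits_le : ∀ e ∈ flatRows PS, bits e ≤ S

/-- Minimizes the linear function `v` over the polytope stored in array `b + 1`; the answer is stored
in `y`. -/
def pQuery {n : ℕ} (b y : ℕ) (v : Fin n → Expr) : Prog :=
  .seq (fill (b + 1) (.const 1) 0 (List.ofFn v)) (.call .opt (b + 1) y)

lemma eq_or_eq_of_mods_pQuery {n b y z : ℕ} {v : Fin n → Expr} (h : (pQuery b y v).Mods z) :
    z = b + 1 ∨ z = y := by
  rcases h with h | h
  · exact Or.inl (eq_of_mods_fill h)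
  · exact Or.inr h

lemma weight_le_sum {n : ℕ} (v : Fin n → Expr) (j : Fin n) : (v j).weight ≤ ∑ i, (v i).weight :=
  Finset.single_le_sum (f := fun i => (v i).weight) (fun _ _ => Nat.zero_le _) (Finset.mem_univ j)

/-- Only the objective in cells 1, …, n is rewritten; the rows stay in place for the next query. Up
to S rows with entries of up to S digits are sent, which accounts for the square in `Sizes`. -/
lemma exists_runs_pQuery {n : ℕ} (b y : ℕ) (v : Fin n → Expr) (hy : y ≠ b + 1) : ∃ c : ℕ,
    ∀ {m C₀ d₀ : ℕ} {f : Fin (m + 1) → (Fin n → ℝ) → ℝ} {ε : ℝ} {B Δ : ℕ}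
    {O : Oracles n m} {s s₁ S U : ℕ}, Setting C₀ d₀ f ε B Δ O → Sizes c C₀ d₀ s s₁ S U →
    ∀ (σ : State) (PS : List (Row n)), PInv (σ (b + 1)) PS S → PS.length ≤ S →
    boxRows n B ⊆ PS → bits B ≤ s → (∀ j, (v j).Ok σ s₁ {b + 1}ᶜ) →
    Runs O (pQuery b y v) σ (fun τ => (∀ z, z ≠ b + 1 → z ≠ y → τ z = σ z) ∧
      PInv (τ (b + 1)) PS S ∧ IsAnswer (· ∈ intPoints PS) (τ y) ∧
      (τ y 0 = 1 → ∀ w ∈ intPoints PS,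
        (fun j => (v j).val σ) ⬝ᵥ readIntVec n (τ y) 1 ≤ (fun j => (v j).val σ) ⬝ᵥ w)) (c * U) := by
  obtain ⟨c, hc⟩ := exists_runs_fill (.const 1) (List.ofFn v) 0
  refine ⟨2 + c + (n + 1) + (2 + n) + ∑ j, (v j).weight,
    fun {m C₀ d₀ f ε B Δ O s s₁ S U} hset hs σ PS hP hlen hbox hB hv => ?_⟩
  have hU := hs.S_le
  have hs₁ := hs.s₁_le
  refine (Runs.seq (hc O (b + 1) σ s₁ {b + 1}ᶜ (by simp) trivial (fun e he => by
    obtain ⟨j, rfl⟩ := (List.mem_ofFn' _ _).1 he; exact hv j))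
    (c := 1 + (n + 1) * U + (2 + n * (s + 1))) ?_ ?_).frame.mono
    (fun τ h => ⟨fun z h1 h2 => h.2 z (fun h3 => ?_), h.1⟩) le_rfl
  rotate_left
  · have hsU : s + 1 ≤ U := by have := hs.s_le; omega
    have hs₁U : s₁ + 1 ≤ U := by omega
    nlinarith [Nat.mul_le_mul_left c hs₁U, Nat.mul_le_mul_left n hsU,
      Nat.zero_le ((∑ j, (v j).weight) * U)]
  · rcases eq_or_eq_of_mods_pQuery h3 with h3 | h3
    · exact h1 h3
    · exact h2 h3
  rintro τ rfl
  set obj : Fin n → ℤ := fun j => (v j).val σ with hobj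
  have hmap : (List.ofFn v).map (Expr.val σ) = List.ofFn obj := by rw [List.map_ofFn]; rfl
  rw [hmap]
  set a : ℤ → ℤ := writeAt (σ (b + 1)) ((Expr.const 1).val σ + ((0 : ℕ) : ℤ)) (List.ofFn obj)
    with ha
  have hone : (Expr.const 1).val σ + ((0 : ℕ) : ℤ) = 1 := by simp [Expr.val]
  have ha0 : a 0 = PS.length := by
    rw [ha, hone, writeAt_of_lt (by norm_num)]; exact hP.zero
  have harows : Holds a (1 + n) (flatRows PS) := by
    refine hP.rows.congr fun t _ => ?_
    rw [ha, hone, writeAt_of_ge]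
    rw [List.length_ofFn]; omega
  have haobj : Holds a 1 (List.ofFn obj) := by
    rw [ha, hone]; exact holds_writeAt _ _ _
  have hall : Holds a 0 ((PS.length : ℤ) :: (List.ofFn obj ++ flatRows PS)) := by
    rw [holds_cons, holds_append]
    refine ⟨ha0, by simpa using haobj, ?_⟩
    rw [List.length_ofFn, zero_add]; exact harows
  set ρ : State := Function.update σ (b + 1) a with hρ
  have hρ1 : ρ (b + 1) = a := Function.update_self _ _ _
  have hqs : querySize n (ρ (b + 1)) .opt ≤ (n + 1) * U := by
    rw [hρ1, querySize_of_holds hall (by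
      rw [queryLength, ha0, Int.toNat_natCast]; simp [length_flatRows]; ring)]
    refine (listSize_le (s := S) fun z hz => ?_).trans ?_
    · rcases List.mem_cons.1 hz with rfl | hz
      · exact (bits_natCast_le _).trans hlen
      · rcases List.mem_append.1 hz with hz | hz
        · obtain ⟨j, rfl⟩ := (List.mem_ofFn' _ _).1 hz
          exact (hv j).bits_val_le.trans (hs.mul_le (by have := weight_le_sum v j; omega))
        · exact hP.bits_le z hz
    · have h1 := hs.le₃
      simp only [List.length_cons, List.length_append, List.length_ofFn, length_flatRows]
      calc (n + PS.length * (n + 1) + 1) * (S + 1) ≤ ((n + 1) * (S + 1)) * (S + 1) := by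
            gcongr; nlinarith
        _ = (n + 1) * (S + 1) ^ 2 := by ring
        _ ≤ _ := by gcongr
  have hsys : readSystem n a (1 + n) PS.length = PS := holds_flatRows.1 harows
  have hreply : O.reply (ρ (b + 1)) .opt = encodeOption List.ofFn (O.opt PS obj) := by
    rw [hρ1]
    simp only [Oracles.reply, ha0, Int.toNat_natCast]
    rw [hsys, holds_ofFn.1 haobj]
  have hbd : Bornology.IsBounded (polyhedron PS) := isBounded_polyhedron hbox
  have hsize : listSize (O.reply (ρ (b + 1)) .opt) ≤ 2 + n * (s + 1) := by
    rw [hreply]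
    refine listSize_encodeOption_le fun z hz j => ?_
    have := subset_box_of_boxRows hbox (hset.valid.opt_some PS _ z hbd hz).1 j
    exact (bits_le_of_abs_le this).trans hB
  refine (runs_call O .opt (b + 1) y ρ hqs hsize).mono ?_ le_rfl
  rintro τ rfl
  refine ⟨?_, ?_, ?_⟩
  · rw [Function.update_of_ne hy.symm, hρ1]
    exact ⟨ha0, harows, hP.bits_le⟩
  · rw [Function.update_self, hreply]
    exact isAnswer_writeList (fun z hz => (hset.valid.opt_some PS _ z hbd hz).1)
      (fun hn z hz => hset.valid.opt_none PS _ hbd hn z hz) _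
  · rw [Function.update_self, hreply]
    have hw := holds_writeList (ρ y) (encodeOption List.ofFn (O.opt PS obj))
    cases hopt : O.opt PS obj with
    | none =>
      rw [hopt] at hw
      simp only [encodeOption, holds_singleton] at hw
      intro h1
      simp only [encodeOption] at h1
      omega
    | some u =>
      rw [hopt] at hw
      simp only [encodeOption, holds_cons, holds_ofFn, zero_add] at hw
      intro _ w hwX
      simp only [encodeOption]
      rw [hw.2]
      exact (hset.valid.opt_some PS _ u hbd hopt).2 w hwX

/-- Stores the polytope given by the box and the equations in array `b + 1`. -/
def initPolytope (n b r : ℕ) : Prog :=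
  fill (b + 1) (.const 0) 0 (.const (boxE n (.get 3 (.const 0)) ++ pairE (eqE n b r)).length ::
    (List.ofFn (fun _ : Fin n => Expr.const 0) ++
      flatRows (boxE n (.get 3 (.const 0)) ++ pairE (eqE n b r))))

lemma exists_runs_initPolytope (n b r : ℕ) (hb : 4 ≤ b) : ∃ c : ℕ,
    ∀ {m C₀ d₀ : ℕ} {O : Oracles n m} {B Δ s s₁ S U : ℕ}, Sizes c C₀ d₀ s s₁ S U →
    ∀ (σ : State), LevelPre n r (σ b) B Δ s → σ 3 0 = B →
    Runs O (initPolytope n b r) σ (fun τ => (∀ z, z ≠ b + 1 → τ z = σ z) ∧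
      ∃ PS : List (Row n), PInv (τ (b + 1)) PS S ∧ PS.length = 2 * n + 2 * r ∧
        boxRows n B ⊆ PS ∧ ∀ z, z ∈ intPoints PS ↔
          (∀ j, |z j| ≤ B) ∧ intPoint z ∈ affineSpace (eqs n (σ b) r)) (c * U) := by
  set rows := boxE n (.get 3 (.const 0)) ++ pairE (eqE n b r) with hrows
  obtain ⟨c, hc⟩ := exists_runs_fill (.const 0) (.const rows.length ::
    (List.ofFn (fun _ : Fin n => Expr.const 0) ++ flatRows rows)) 0
  refine ⟨c + ((flatRows rows).map Expr.weight).sum,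
    fun {m C₀ d₀ O B Δ s s₁ S U} hs σ hpre h3 => ?_⟩
  have hokB : (Expr.get 3 (.const 0)).Ok σ s {b + 1}ᶜ :=
    ⟨by simp; omega, by simp only [Expr.val, h3]; exact hpre.bits_B, trivial⟩
  have hok : ∀ q ∈ rows, q.Ok σ s {b + 1}ᶜ := by
    intro q hq
    rcases List.mem_append.1 hq with hq | hq
    · exact ok_boxE hokB q hq
    · exact ok_pairE (ok_eqE hpre (by simp)) q hq
  have hoke : ∀ e ∈ (Expr.const rows.length ::
      (List.ofFn (fun _ : Fin n => Expr.const 0) ++ flatRows rows)), e.Ok σ s {b + 1}ᶜ := by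
    intro e he
    rcases List.mem_cons.1 he with rfl | he
    · trivial
    rcases List.mem_append.1 he with he | he
    · obtain ⟨j, rfl⟩ := (List.mem_ofFn' _ _).1 he
      trivial
    · exact ok_flatRows hok e he
  have hss := hs.s_le
  have hs₁ := hs.s₁_le
  have hU := hs.S_le
  refine (hc O (b + 1) σ s {b + 1}ᶜ (by simp) trivial hoke).frame.mono ?_
    (Nat.mul_le_mul (Nat.le_add_right _ _) (by omega))
  rintro τ ⟨rfl, hfr⟩
  refine ⟨fun z hz => hfr z fun h => hz (eq_of_mods_fill h), rows.map (RowE.val σ), ?_, ?_, ?_, ?_⟩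
  · rw [Function.update_self]
    have hL : (Expr.const rows.length ::
        (List.ofFn (fun _ : Fin n => Expr.const 0) ++ flatRows rows)).map (Expr.val σ) =
        (rows.length : ℤ) :: (List.ofFn (fun _ : Fin n => (0 : ℤ)) ++
          flatRows (rows.map (RowE.val σ))) := by
      rw [List.map_cons, List.map_append, map_flatRows, List.map_ofFn]; rfl
    have hz0 : (Expr.const 0).val σ + ((0 : ℕ) : ℤ) = 0 := by simp [Expr.val]
    rw [hz0, hL]
    have h2 := holds_writeAt (σ (b + 1)) 0 ((rows.length : ℤ) ::
      (List.ofFn (fun _ : Fin n => (0 : ℤ)) ++ flatRows (rows.map (RowE.val σ))))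
    obtain ⟨h21, h22⟩ := holds_cons.1 h2
    have h23 := (holds_append.1 h22).2
    rw [List.length_ofFn, zero_add] at h23
    refine ⟨?_, h23, ?_⟩
    · rw [List.length_map]; exact h21
    · rw [← map_flatRows]
      intro e he
      obtain ⟨e', he', rfl⟩ := List.mem_map.1 he
      refine (ok_flatRows hok e' he').bits_val_le.trans ?_
      have h3 : e'.weight ≤ ((flatRows rows).map Expr.weight).sum :=
        List.single_le_sum (fun _ _ => Nat.zero_le _) _ (List.mem_map_of_mem he')
      exact (Nat.mul_le_mul_left _ (by omega)).trans (hs.mul_le (w := e'.weight) (by omega))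
  · have : ∀ l : List (RowE n), (pairE l).length = 2 * l.length := by
      intro l
      induction l with
      | nil => rfl
      | cons a l ih => simp only [pairE, List.flatMap_cons, List.length_append,
          List.length_cons, List.length_nil] at *; omega
    have h2 : (boxE n (.get 3 (.const 0))).length = 2 * n := by
      simp [boxE, List.length_flatMap, mul_comm]
    rw [List.length_map, hrows, List.length_append, h2, this]
    simp [eqE]
  · rw [hrows, List.map_append, map_val_boxE]
    simp only [Expr.val, h3]
    exact List.subset_append_left _ _
  · intro z
    rw [mem_intPoints, hrows, List.map_append, map_val_boxE, List.forall_mem_append,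
      forall_mem_boxRows, List.forall_mem_map, forall_mem_pairE, forall_mem_eqE]
    simp only [Expr.val, h3]

/-- Appends a row to the polytope stored in array `b + 1`. -/
def appendRow {n : ℕ} (b : ℕ) (v : Fin n → Expr) (β : Expr) : Prog :=
  .seq (.assign (b + 9) (.const 1) (.get (b + 1) (.const 0)))
    (.seq (fill (b + 1) (.add (.const (1 + n)) (.mul (.get (b + 9) (.const 1)) (.const (n + 1)))) 0
        (List.ofFn v ++ [β]))
      (.assign (b + 1) (.const 0) (.add (.get (b + 9) (.const 1)) (.const 1))))

lemma eq_or_eq_of_mods_appendRow {n b z : ℕ} {v : Fin n → Expr} {β : Expr}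
    (h : (appendRow b v β).Mods z) : z = b + 1 ∨ z = b + 9 := by
  rcases h with h | h | h
  · exact Or.inr h
  · exact Or.inl (eq_of_mods_fill h)
  · exact Or.inl h

/-- The old number of rows is saved in cell 1 of array b + 9, since `fill` needs a base address that
does not depend on the array being written. Cell 0 of that array is the loop flag and must survive.
-/
lemma exists_runs_appendRow {n : ℕ} (b : ℕ) (v : Fin n → Expr) (β : Expr) : ∃ c : ℕ,
    ∀ {m C₀ d₀ : ℕ} {O : Oracles n m} {s s₁ S U : ℕ}, Sizes c C₀ d₀ s s₁ S U →
    ∀ (σ : State) (PS : List (Row n)), PInv (σ (b + 1)) PS S → PS.length ≤ S →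
    (∀ j, (v j).Ok σ s₁ {b + 1, b + 9}ᶜ) → β.Ok σ s₁ {b + 1, b + 9}ᶜ →
    Runs O (appendRow b v β) σ (fun τ => (∀ z, z ≠ b + 1 → z ≠ b + 9 → τ z = σ z) ∧
      τ (b + 9) 0 = σ (b + 9) 0 ∧
      PInv (τ (b + 1)) (PS ++ [(fun j => (v j).val σ, β.val σ)]) S) (c * U) := by
  set base : Expr := .add (.const (1 + n)) (.mul (.get (b + 9) (.const 1)) (.const (n + 1)))
    with hbase
  obtain ⟨c, hc⟩ := exists_runs_fill base (List.ofFn v ++ [β]) 0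
  set W := β.weight + ∑ j, (v j).weight with hW
  refine ⟨30 + c + W, fun {m C₀ d₀ O s s₁ S U} hs σ PS hP hlen hv hβ => ?_⟩
  have hU := hs.S_le
  have hs₁ := hs.s₁_le
  have hlenb : bits (PS.length : ℤ) ≤ S := (bits_natCast_le _).trans hlen
  have hget1 : (Expr.get (b + 1) (.const 0)).Ok σ S Set.univ :=
    ⟨trivial, by simp only [Expr.val, hP.zero]; exact hlenb, trivial⟩
  refine (Runs.seq (Runs.assign (s := S) (A := Set.univ) (b := 7 * U)
    (i := .const 1) (Q := fun τ => τ = _)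
    trivial hget1 rfl (by simp [Expr.weight]; nlinarith)) (c := (20 + c) * U) ?_
    (by nlinarith)).frame.mono
    (fun τ h => ⟨fun z h1 h2 => h.2 z (fun h3 => ?_), h.1⟩) le_rfl
  swap
  · rcases eq_or_eq_of_mods_appendRow h3 with h3 | h3
    · exact h1 h3
    · exact h2 h3
  rintro τ rfl
  set ρ : State := Function.update σ (b + 9) (Function.update (σ (b + 9)) ((Expr.const 1).val σ)
    ((Expr.get (b + 1) (.const 0)).val σ)) with hρ
  have hρ9 : ρ (b + 9) 1 = PS.length := by
    rw [hρ, Function.update_self]; simp [Expr.val, hP.zero]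
  have hρ90 : ρ (b + 9) 0 = σ (b + 9) 0 := by
    rw [hρ, Function.update_self]; simp [Expr.val]
  have hρ1 : ρ (b + 1) = σ (b + 1) := Function.update_of_ne (by omega) _ _
  have hA : ∀ z ∈ ({b + 1, b + 9}ᶜ : Set ℕ), ρ z = σ z := by
    intro z hz
    simp only [Set.mem_compl_iff, Set.mem_insert_iff, Set.mem_singleton_iff, not_or] at hz
    exact Function.update_of_ne hz.2 _ _
  have hget9 : (Expr.get (b + 9) (.const 1)).Ok ρ S {b + 1}ᶜ :=
    ⟨by simp, by simp only [Expr.val, hρ9]; exact hlenb, trivial⟩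
  have hsub : ({b + 1, b + 9}ᶜ : Set ℕ) ⊆ {b + 1}ᶜ := by
    intro z hz
    simp only [Set.mem_compl_iff, Set.mem_insert_iff, Set.mem_singleton_iff, not_or] at hz ⊢
    exact hz.1
  have hoke : ∀ e ∈ List.ofFn v ++ [β], e.Ok ρ S {b + 1}ᶜ := by
    intro e he
    rcases List.mem_append.1 he with he | he
    · obtain ⟨j, rfl⟩ := (List.mem_ofFn' _ _).1 he
      exact ((hv j).transfer hA).mono hs₁ hsub
    · rw [List.mem_singleton.1 he]
      exact (hβ.transfer hA).mono hs₁ hsub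
  refine Runs.seq (hc O (b + 1) ρ S {b + 1}ᶜ (by simp) ⟨trivial, hget9, trivial⟩ hoke)
    (c := 18 * U) ?_ (by nlinarith)
  rintro τ rfl
  have hvals : (List.ofFn v ++ [β]).map (Expr.val ρ) =
      flatRows [((fun j => (v j).val σ, β.val σ) : Row n)] := by
    rw [List.map_append, List.map_ofFn]
    simp only [flatRows, List.flatMap_cons, List.flatMap_nil, List.append_nil, List.map_cons,
      List.map_nil]
    rw [hβ.val_eq hA]
    congr 2
    funext j
    exact (hv j).val_eq hA
  have hbv : base.val ρ + ((0 : ℕ) : ℤ) = 1 + n + (flatRows PS).length := by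
    rw [length_flatRows]
    simp only [hbase, Expr.val, hρ9]
    push_cast; ring
  rw [hvals, hbv, hρ1]
  set q : Row n := (fun j => (v j).val σ, β.val σ) with hq
  set ρ' : State := Function.update ρ (b + 1)
    (writeAt (σ (b + 1)) (1 + n + (flatRows PS).length) (flatRows [q])) with hρ'
  have hρ'9 : ρ' (b + 9) = ρ (b + 9) := Function.update_of_ne (by omega) _ _
  have hget9' : (Expr.get (b + 9) (.const 1)).Ok ρ' S Set.univ :=
    ⟨trivial, by simp only [Expr.val, hρ'9, hρ9]; exact hlenb, trivial⟩
  refine Runs.assign (s := S) (A := Set.univ) trivial ⟨hget9', trivial⟩ ⟨?_, ?_⟩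
    (by simp [Expr.weight]; nlinarith)
  · rw [Function.update_of_ne (by omega), hρ'9, hρ90]
  · rw [Function.update_self]
    simp only [Expr.val, hρ'9, hρ9]
    rw [hρ', Function.update_self]
    refine ⟨?_, ?_, ?_⟩
    · simp
    · rw [flatRows_append, holds_append]
      constructor
      · refine hP.rows.congr fun t ht => ?_
        rw [Function.update_of_ne (by omega), writeAt_of_lt (by omega)]
      · refine (holds_writeAt (σ (b + 1)) (1 + n + (flatRows PS).length) (flatRows [q])).congr
          fun t ht => ?_
        rw [Function.update_of_ne (by omega)]
    · rw [flatRows_append]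
      intro e he
      rcases List.mem_append.1 he with he | he
      · exact hP.bits_le e he
      · refine (forall_mem_flatRows (l := [q]) (p := fun e => bits e ≤ S)).2 ?_ e he
        simp only [List.forall_mem_singleton, hq]
        exact ⟨fun j => (hv j).bits_val_le.trans
            (hs.mul_le (by have := weight_le_sum v j; omega)),
          hβ.bits_val_le.trans (hs.mul_le (by omega))⟩


/-! ### One round: the choice of a frame. -/

/-! ## Stages of the construction of a frame -/

/-- The first `i` directions `ℓ j` and points `v j` of a triangular system at the point `o` of the
set `X`: on `X`, the point `v j` maximizes the absolute value of `ℓ j` relative to `o`. -/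
structure Stage {n : ℕ} (X : Set (Fin n → ℤ)) (o : Fin n → ℤ) (v ℓ : ℕ → Fin n → ℤ) (R : ℤ)
    (i : ℕ) : Prop where
  base : o ∈ X
  mem : ∀ j < i, v j ∈ X
  size : ∀ j < i, ∀ t, |ℓ j t| ≤ R
  tri : ∀ j < i, ∀ j' < j, ℓ j ⬝ᵥ (v j' - o) = 0
  pos : ∀ j < i, 0 < ℓ j ⬝ᵥ (v j - o)
  le : ∀ j < i, ∀ x ∈ X, |ℓ j ⬝ᵥ (x - o)| ≤ ℓ j ⬝ᵥ (v j - o)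

lemma Stage.succ {n : ℕ} {X : Set (Fin n → ℤ)} {o : Fin n → ℤ} {v ℓ : ℕ → Fin n → ℤ} {R : ℤ}
    {i : ℕ} (h : Stage X o v ℓ R i) (hv : v i ∈ X) (hℓ : ∀ t, |ℓ i t| ≤ R)
    (htri : ∀ j < i, ℓ i ⬝ᵥ (v j - o) = 0) (hpos : 0 < ℓ i ⬝ᵥ (v i - o))
    (hle : ∀ x ∈ X, |ℓ i ⬝ᵥ (x - o)| ≤ ℓ i ⬝ᵥ (v i - o)) : Stage X o v ℓ R (i + 1) where
  base := h.base
  mem j hj := by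
    rcases Nat.lt_succ_iff_lt_or_eq.1 hj with hj | rfl
    exacts [h.mem j hj, hv]
  size j hj := by
    rcases Nat.lt_succ_iff_lt_or_eq.1 hj with hj | rfl
    exacts [h.size j hj, hℓ]
  tri j hj := by
    rcases Nat.lt_succ_iff_lt_or_eq.1 hj with hj | rfl
    exacts [h.tri j hj, htri]
  pos j hj := by
    rcases Nat.lt_succ_iff_lt_or_eq.1 hj with hj | rfl
    exacts [h.pos j hj, hpos]
  le j hj := by
    rcases Nat.lt_succ_iff_lt_or_eq.1 hj with hj | rfl
    exacts [h.le j hj, hle]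

lemma Stage.congr {n : ℕ} {X : Set (Fin n → ℤ)} {o : Fin n → ℤ} {v ℓ v' ℓ' : ℕ → Fin n → ℤ}
    {R : ℤ} {i : ℕ} (h : Stage X o v ℓ R i) (hv : ∀ j < i, v' j = v j)
    (hℓ : ∀ j < i, ℓ' j = ℓ j) : Stage X o v' ℓ' R i where
  base := h.base
  mem j hj := by rw [hv j hj]; exact h.mem j hj
  size j hj := by rw [hℓ j hj]; exact h.size j hj
  tri j hj j' hj' := by rw [hℓ j hj, hv j' (hj'.trans hj)]; exact h.tri j hj j' hj'
  pos j hj := by rw [hℓ j hj, hv j hj]; exact h.pos j hj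
  le j hj := by rw [hℓ j hj, hv j hj]; exact h.le j hj

/-- Differences of points of X solve the homogeneous equations, and the domination by the diagonal
holds because the points v j themselves belong to X. -/
lemma Stage.frame {n r k : ℕ} {X : Set (Fin n → ℤ)} {o : Fin n → ℤ} {v ℓ : ℕ → Fin n → ℤ} {R : ℤ}
    (h : Stage X o v ℓ R k) (hk : r + k = n) {H : ℕ → Row n}
    (hind : LinearIndependent ℝ fun j : Fin r => intPoint (H j).1)
    (hX : ∀ x ∈ X, ∀ j < r, (H j).1 ⬝ᵥ x = (H j).2) :
    Frame (fun j : Fin r => (H j).1) (fun j : Fin k => v j - o) (fun i : Fin k => ℓ i) where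
  card := hk
  indep := hind
  orth l j := by
    rw [dotProduct_sub, hX _ (h.mem j j.2) l l.2, hX _ h.base l l.2, sub_self]
  tri i j hij := h.tri i i.2 j hij
  pos i := h.pos i i.2
  le i j := h.le i i.2 _ (h.mem j j.2)

/-! ## The state within a level -/

/-- The setting of a level: oracles, sizes, the program for the next level, and the equations. -/
structure Ctx {n m : ℕ} (c C₀ d₀ : ℕ) (f : Fin (m + 1) → (Fin n → ℝ) → ℝ) (ε : ℝ) (B Δ : ℕ)
    (O : Oracles n m) (s s₁ S U : ℕ) (ch : Prog) (e r : ℕ) (E : ℤ → ℤ) : Prop where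
  set : Setting C₀ d₀ f ε B Δ O
  sizes : Sizes c C₀ d₀ s s₁ S U
  child : ChildOk f ε B Δ O ch e (r + 1) S U
  pre : LevelPre n r E B Δ s

lemma Ctx.mono {n m : ℕ} {c c' C₀ d₀ : ℕ} {f : Fin (m + 1) → (Fin n → ℝ) → ℝ} {ε : ℝ} {B Δ : ℕ}
    {O : Oracles n m} {s s₁ S U : ℕ} {ch : Prog} {e r : ℕ} {E : ℤ → ℤ}
    (h : Ctx c C₀ d₀ f ε B Δ O s s₁ S U ch e r E) (hc : c' ≤ c) :
    Ctx c' C₀ d₀ f ε B Δ O s s₁ S U ch e r E :=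
  ⟨h.set, h.sizes.mono hc, h.child, h.pre⟩

/-- The memory holds a polytope within the affine space of the level that contains the relevant
integer points. -/
structure Inv {n m : ℕ} (f : Fin (m + 1) → (Fin n → ℝ) → ℝ) (B S b r : ℕ) (E : ℤ → ℤ)
    (PS : List (Row n)) (σ : State) : Prop where
  row : σ b = E
  three : σ 3 0 = B
  poly : PInv (σ (b + 1)) PS S
  box : boxRows n B ⊆ PS
  sub : ∀ z ∈ intPoints PS, intPoint z ∈ affineSpace (eqs n E r)
  all : ∀ z, intPoint z ∈ affineSpace (eqs n E r) → intPoint z ∈ levelSet f 0 → z ∈ intPoints PS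

lemma mem_affineSpace_eqs {n r : ℕ} {E : ℤ → ℤ} {z : Fin n → ℤ} :
    intPoint z ∈ affineSpace (eqs n E r) ↔ ∀ j < r, (hrow n E j).1 ⬝ᵥ z = (hrow n E j).2 := by
  rw [intPoint_mem_affineSpace, eqs, List.forall_mem_map]
  simp only [List.mem_range]

section

variable {n m : ℕ} {f : Fin (m + 1) → (Fin n → ℝ) → ℝ} {B S b r : ℕ} {E : ℤ → ℤ}
  {PS : List (Row n)} {σ : State}

lemma Inv.abs_le (h : Inv f B S b r E PS σ) {z : Fin n → ℤ} (hz : z ∈ intPoints PS) (t : Fin n) :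
    |z t| ≤ B := subset_box_of_boxRows h.box hz t

lemma Inv.dot_eq (h : Inv f B S b r E PS σ) {z : Fin n → ℤ} (hz : z ∈ intPoints PS) :
    ∀ j < r, (hrow n E j).1 ⬝ᵥ z = (hrow n E j).2 := mem_affineSpace_eqs.1 (h.sub z hz)

lemma Inv.dot_sub (h : Inv f B S b r E PS σ) {z o : Fin n → ℤ} (hz : z ∈ intPoints PS)
    (ho : o ∈ intPoints PS) (j : ℕ) (hj : j < r) : (hrow n E j).1 ⬝ᵥ (z - o) = 0 := by
  rw [dotProduct_sub, h.dot_eq hz j hj, h.dot_eq ho j hj, sub_self]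

lemma Inv.frame (h : Inv f B S b r E PS σ) {τ : State} (hb : τ b = σ b) (h3 : τ 3 = σ 3)
    (h1 : PInv (τ (b + 1)) PS S) : Inv f B S b r E PS τ :=
  ⟨hb.trans h.row, by rw [h3, h.three], h1, h.box, h.sub, h.all⟩

end

/-- The point `o` of a level. -/
abbrev oE (n b : ℕ) : Fin n → Expr := cells n (b + 10) 0

/-- The point `v i` of a level. -/
abbrev vE (n b i : ℕ) : Fin n → Expr := cells n (b + 11 + 2 * i) 0

/-- The direction `ℓ i` of a level. -/
abbrev lE (n b i : ℕ) : Fin n → Expr := cells n (b + 12 + 2 * i) 0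

/-- The difference of two vectors. -/
def subE {n : ℕ} (a b : Fin n → Expr) : Fin n → Expr := fun t => .sub (a t) (b t)

/-- The negative of a vector. -/
def negE {n : ℕ} (a : Fin n → Expr) : Fin n → Expr := fun t => .sub (.const 0) (a t)

lemma val_subE {n : ℕ} (σ : State) (a b : Fin n → Expr) :
    (fun t => (subE a b t).val σ) = (fun t => (a t).val σ) - fun t => (b t).val σ := rfl

lemma val_negE {n : ℕ} (σ : State) (a : Fin n → Expr) :
    (fun t => (negE a t).val σ) = -fun t => (a t).val σ := by
  funext t; simp [negE, Expr.val]

lemma val_cells_fun (n x off : ℕ) (σ : State) :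
    (fun j => (cells n x off j).val σ) = readIntVec n (σ x) off := rfl

/-- The memory holds a stage for the integer points of the polytope. -/
abbrev StageAt {n : ℕ} (b : ℕ) (PS : List (Row n)) (R : ℤ) (i : ℕ) (σ : State) : Prop :=
  Stage (intPoints PS) (readIntVec n (σ (b + 10)) 0) (fun j => readIntVec n (σ (b + 11 + 2 * j)) 0)
    (fun j => readIntVec n (σ (b + 12 + 2 * j)) 0) R i

/-- A bound for the coefficients of the equations and for differences of points of the box. -/
def height (n r : ℕ) (E : ℤ → ℤ) (B : ℕ) : ℕ :=
  1 + 2 * B + ((flatRows (eqs n E r)).map fun z => z.natAbs ^ 2).sum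

/-- See `height`. -/
def heightE (n b r : ℕ) : Expr :=
  .add (.add (.const 1) (.mul (.const 2) (.get 3 (.const 0))))
    (sumE ((flatRows (eqE n b r)).map fun e => .mul e e))

/-- A bound for short integer directions. -/
def radius (n r : ℕ) (E : ℤ → ℤ) (B : ℕ) : ℕ := (n * height n r E B) ^ n

/-- See `radius`. -/
def radiusE (n b r : ℕ) : Expr := prodE (List.replicate n (.mul (.const n) (heightE n b r)))

/-- Squares replace absolute values, which are not among the operations of the machine: |z| ≤ z² for
integers. -/
lemma abs_le_height {n r : ℕ} {E : ℤ → ℤ} {B j : ℕ} (hj : j < r) (i : Fin n) :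
    |(hrow n E j).1 i| ≤ height n r E B := by
  have h1 : (hrow n E j).1 i ∈ flatRows (eqs n E r) := by
    simp only [flatRows, List.mem_flatMap]
    exact ⟨hrow n E j, List.mem_map_of_mem (List.mem_range.2 hj),
      List.mem_append_left _ ((List.mem_ofFn' _ _).2 ⟨i, rfl⟩)⟩
  have h2 : ((hrow n E j).1 i).natAbs ^ 2 ≤
      ((flatRows (eqs n E r)).map fun z => z.natAbs ^ 2).sum :=
    List.single_le_sum (fun _ _ => Nat.zero_le _) _
      (List.mem_map_of_mem (f := fun z : ℤ => z.natAbs ^ 2) h1)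
  have h3 : ((hrow n E j).1 i).natAbs ≤ ((hrow n E j).1 i).natAbs ^ 2 := Nat.le_self_pow two_ne_zero _
  rw [Int.abs_eq_natAbs]
  exact Int.ofNat_le.2 (by rw [height]; omega)

lemma val_heightE {n b r B : ℕ} {σ : State} (h3 : σ 3 0 = B) :
    (heightE n b r).val σ = height n r (σ b) B := by
  simp only [heightE, Expr.val, val_sumE, List.map_map, h3, height]
  push_cast
  congr 1
  rw [← map_val_eqE, ← map_flatRows, List.map_map, List.map_map]
  congr 1
  refine List.map_congr_left fun e _ => ?_
  simp [Expr.val, sq]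

lemma val_radiusE {n b r B : ℕ} {σ : State} (h3 : σ 3 0 = B) :
    (radiusE n b r).val σ = radius n r (σ b) B := by
  rw [radiusE, val_prodE, List.map_replicate, List.prod_replicate]
  simp only [Expr.val, val_heightE h3, radius]
  push_cast; rfl

lemma ok_heightE {n b r B Δ s : ℕ} {σ : State} {A : Set ℕ} (hp : LevelPre n r (σ b) B Δ s)
    (h3 : σ 3 0 = B) (hb : b ∈ A) (hA : 3 ∈ A) : (heightE n b r).Ok σ s A := by
  refine ⟨⟨trivial, trivial, hA, by simp only [Expr.val, h3]; exact hp.bits_B, trivial⟩,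
    ok_sumE fun e he => ?_⟩
  obtain ⟨e', he', rfl⟩ := List.mem_map.1 he
  have := ok_flatRows (ok_eqE hp hb) e' he'
  exact ⟨this, this⟩

lemma ok_radiusE {n b r B Δ s : ℕ} {σ : State} {A : Set ℕ} (hp : LevelPre n r (σ b) B Δ s)
    (h3 : σ 3 0 = B) (hb : b ∈ A) (hA : 3 ∈ A) : (radiusE n b r).Ok σ s A :=
  ok_prodE fun e he => by
    rw [List.eq_of_mem_replicate he]
    exact ⟨trivial, ok_heightE hp h3 hb hA⟩

/-! ## The choice of a direction -/

/-- Searches for a short direction orthogonal to the equations and to `v j - o` for `j < i`. -/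
def findDirection (n b r i : ℕ) : Prog :=
  search (b + 3) (b + 2) (radiusE n b r)
    (pairE ((eqE n b r).map (fun q => (q.1, .const 0)) ++
      (List.range i).map fun j => (subE (vE n b j) (oE n b), .const 0)))
    ((List.finRange n).map fun j => (fun t => .const (if t = j then 1 else 0), .const (-1)))

/-- There are r + i < n homogeneous conditions, so a short nonzero solution exists. The candidates
express that it is nonzero: up to sign, some entry is at most -1. -/
lemma exists_runs_findDirection (n b r i : ℕ) (hb : 4 ≤ b) (hi : r + i < n) : ∃ c : ℕ,
    ∀ {m C₀ d₀ : ℕ} {f : Fin (m + 1) → (Fin n → ℝ) → ℝ} {ε : ℝ} {B Δ : ℕ} {O : Oracles n m}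
    {s s₁ S U : ℕ} {ch : Prog} {e : ℕ} {E : ℤ → ℤ},
    Ctx c C₀ d₀ f ε B Δ O s s₁ S U ch e r E → ∀ (σ : State) (PS : List (Row n)),
    Inv f B S b r E PS σ → StageAt b PS (radius n r E B) i σ →
    Runs O (findDirection n b r i) σ (fun τ => (∀ z, z ≠ b + 3 → z ≠ b + 2 → τ z = σ z) ∧
      (∀ t, |readIntVec n (τ (b + 2)) 1 t| ≤ radius n r E B) ∧
      (∀ j < r, (hrow n E j).1 ⬝ᵥ readIntVec n (τ (b + 2)) 1 = 0) ∧
      (∀ j < i, (readIntVec n (σ (b + 11 + 2 * j)) 0 - readIntVec n (σ (b + 10)) 0) ⬝ᵥ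
        readIntVec n (τ (b + 2)) 1 = 0) ∧ readIntVec n (τ (b + 2)) 1 ≠ 0) (c * U) := by
  set rows : List (RowE n) := (eqE n b r).map (fun q => (q.1, .const 0)) ++
      (List.range i).map fun j => (subE (vE n b j) (oE n b), .const 0) with hrows
  set cands : List (RowE n) :=
    (List.finRange n).map fun j => (fun t => .const (if t = j then 1 else 0), .const (-1))
    with hcands
  obtain ⟨c, hc⟩ := exists_runs_search (radiusE n b r) (pairE rows) cands
  refine ⟨c, fun {m C₀ d₀ f ε B Δ O s s₁ S U ch e E} hctx σ PS hI hS => ?_⟩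
  have hpre : LevelPre n r (σ b) B Δ s := by rw [hI.row]; exact hctx.pre
  have hbits : ∀ z ∈ intPoints PS, ∀ t, bits (z t) ≤ s := fun z hz t =>
    (bits_le_of_abs_le (hI.abs_le hz t)).trans hctx.pre.bits_B
  have hok : ∀ q ∈ rows, q.Ok σ s {b + 3, b + 2}ᶜ := by
    intro q hq
    rcases List.mem_append.1 hq with hq | hq
    · obtain ⟨p, hp, rfl⟩ := List.mem_map.1 hq
      exact ⟨(ok_eqE hpre (A := {b + 3, b + 2}ᶜ) (by simp) p hp).1, trivial⟩
    · obtain ⟨j, hj, rfl⟩ := List.mem_map.1 hq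
      rw [List.mem_range] at hj
      exact ⟨fun t => ⟨ok_cells (by simp; omega) (hbits _ (hS.mem j hj)) t,
        ok_cells (by simp) (hbits _ hS.base) t⟩, trivial⟩
  have hokc : ∀ q ∈ cands, q.Ok σ s {b + 3, b + 2}ᶜ := by
    intro q hq
    obtain ⟨j, _, rfl⟩ := List.mem_map.1 hq
    exact ⟨fun t => trivial, trivial⟩
  have hss := hctx.sizes.s_le
  have hs₁ := hctx.sizes.s₁_le
  have hU := hctx.sizes.S_le
  refine (hc hctx.set.valid (b + 3) (b + 2) σ s {b + 3, b + 2}ᶜ (by simp) (by simp)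
    (ok_radiusE hpre hI.three (by simp) (by simp; omega)) (ok_pairE hok) hokc).mono ?_
    (Nat.mul_le_mul_left _ (by omega))
  rintro τ ⟨hfr, hans⟩
  have key : ∀ g : Fin n → ℤ, (∀ q ∈ pairE rows, (q.val σ).1 ⬝ᵥ g ≤ (q.val σ).2) ↔
      (∀ j < r, (hrow n E j).1 ⬝ᵥ g = 0) ∧ ∀ j < i,
        (readIntVec n (σ (b + 11 + 2 * j)) 0 - readIntVec n (σ (b + 10)) 0) ⬝ᵥ g = 0 := by
    intro g
    rw [forall_mem_pairE, hrows, List.forall_mem_append, List.forall_mem_map,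
      List.forall_mem_map, eqE, List.forall_mem_map, ← hI.row]
    simp only [List.mem_range]
    rfl
  have keyc : ∀ g : Fin n → ℤ, (∃ q ∈ cands, (q.val σ).1 ⬝ᵥ g ≤ (q.val σ).2) ↔
      ∃ j, g j ≤ -1 := by
    intro g
    simp only [hcands, List.mem_map, List.mem_finRange, true_and, exists_exists_eq_and]
    refine exists_congr fun j => ?_
    simp [RowE.val, Expr.val, dotProduct]
  rw [val_radiusE hI.three, hI.row] at hans
  rcases hans with ⟨_, h1, h2, h3⟩ | ⟨_, hnone⟩
  · obtain ⟨h21, h22⟩ := (key _).1 h2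
    obtain ⟨j, hj⟩ := (keyc _).1 h3
    refine ⟨hfr, h1, h21, h22, fun h0 => ?_⟩
    rw [h0] at hj; simp at hj
  · exfalso
    -- An unsuccessful search would contradict Siegel's lemma for the equations and the edges; both
    -- have entries bounded by `height`, the edges because points of the box differ by at most 2B.
    let u : Fin (r + i) → Fin n → ℤ := Fin.append (fun j : Fin r => (hrow n E j).1)
      (fun j : Fin i => readIntVec n (σ (b + 11 + 2 * j)) 0 - readIntVec n (σ (b + 10)) 0)
    obtain ⟨g, hg0, hgu, hgR⟩ := exists_orthogonal hi u (height n r E B)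
      (by rw [height]; omega) (by
        intro j t
        refine Fin.addCases (fun j => ?_) (fun j => ?_) j
        · simp only [u, Fin.append_left]
          exact abs_le_height j.2 t
        · simp only [u, Fin.append_right, Pi.sub_apply]
          have h1 := abs_le.1 (hI.abs_le (hS.mem j j.2) t)
          have h2 := abs_le.1 (hI.abs_le hS.base t)
          have h3 : (2 : ℤ) * B ≤ height n r E B := by
            exact_mod_cast (by rw [height]; omega : 2 * B ≤ height n r E B)
          rw [_root_.abs_le]
          constructor <;> linarith)
    have hgu1 : ∀ j < r, (hrow n E j).1 ⬝ᵥ g = 0 := fun j hj => by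
      have := hgu (Fin.castAdd i ⟨j, hj⟩)
      simpa only [u, Fin.append_left] using this
    have hgu2 : ∀ j < i, (readIntVec n (σ (b + 11 + 2 * j)) 0 -
        readIntVec n (σ (b + 10)) 0) ⬝ᵥ g = 0 := fun j hj => by
      have := hgu (Fin.natAdd r ⟨j, hj⟩)
      simpa only [u, Fin.append_right] using this
    obtain ⟨j, hj⟩ : ∃ j, g j ≠ 0 := by
      by_contra! h
      exact hg0 (funext h)
    have hgR' : ∀ t, |g t| ≤ (radius n r E B : ℤ) := hgR
    rcases lt_or_gt_of_ne hj with hj | hj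
    · exact hnone g ⟨hgR', (key g).2 ⟨hgu1, hgu2⟩, (keyc g).2 ⟨j, by omega⟩⟩
    · refine hnone (-g) ⟨fun t => by rw [Pi.neg_apply, abs_neg]; exact hgR' t,
        (key _).2 ⟨fun j hj => by rw [dotProduct_neg, hgu1 j hj, neg_zero],
          fun j hj => by rw [dotProduct_neg, hgu2 j hj, neg_zero]⟩,
        (keyc _).2 ⟨j, by rw [Pi.neg_apply]; omega⟩⟩


lemma exists_runs_fillVec {n : ℕ} (v : Fin n → Expr) : ∃ c : ℕ, ∀ {m : ℕ} (O : Oracles n m) (x : ℕ)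
    (σ : State) (s : ℕ) (A : Set ℕ), x ∉ A → (∀ j, (v j).Ok σ s A) →
    Runs O (fill x (.const 0) 0 (List.ofFn v)) σ (fun τ => (∀ z, z ≠ x → τ z = σ z) ∧
      readIntVec n (τ x) 0 = fun j => (v j).val σ) (c * (s + 1)) := by
  obtain ⟨c, hc⟩ := exists_runs_fill (.const 0) (List.ofFn v) 0
  refine ⟨c, fun O x σ s A hx hv => (hc O x σ s A hx trivial fun e he => ?_).mono ?_ le_rfl⟩
  · obtain ⟨j, rfl⟩ := (List.mem_ofFn' _ _).1 he
    exact hv j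
  · rintro τ rfl
    refine ⟨fun z hz => Function.update_of_ne hz _ _, ?_⟩
    rw [← holds_ofFn, Function.update_self, List.map_ofFn]
    simp only [Expr.val, Nat.cast_zero, add_zero]
    exact holds_writeAt _ _ _

lemma ok_negE {n : ℕ} {σ : State} {s : ℕ} {A : Set ℕ} {a : Fin n → Expr}
    (h : ∀ t, (a t).Ok σ s A) (t : Fin n) : (negE a t).Ok σ s A := ⟨trivial, h t⟩

lemma ok_subE {n : ℕ} {σ : State} {s : ℕ} {A : Set ℕ} {a a' : Fin n → Expr}
    (h : ∀ t, (a t).Ok σ s A) (h' : ∀ t, (a' t).Ok σ s A) (t : Fin n) :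
    (subE a a' t).Ok σ s A := ⟨h t, h' t⟩

lemma Ctx.bits_radius_le {n m c C₀ d₀ : ℕ} {f : Fin (m + 1) → (Fin n → ℝ) → ℝ} {ε : ℝ} {B Δ : ℕ}
    {O : Oracles n m} {s s₁ S U : ℕ} {ch : Prog} {b e r : ℕ} {E : ℤ → ℤ}
    (h : Ctx c C₀ d₀ f ε B Δ O s s₁ S U ch e r E) (hc : (radiusE n b r).weight ≤ c) {σ : State}
    (hE : σ b = E) (h3 : σ 3 0 = B) {z : ℤ} (hz : |z| ≤ radius n r E B) : bits z ≤ s₁ := by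
  refine (bits_le_of_abs_le hz).trans ?_
  have h1 := (ok_radiusE (σ := σ) (b := b) (A := Set.univ) (by rw [hE]; exact h.pre) h3 trivial
    trivial).bits_val_le
  rw [val_radiusE h3, hE] at h1
  refine h1.trans (le_trans ?_ h.sizes.le₁)
  exact Nat.mul_le_mul_right _ (by omega)

/-- Stores a point and a direction as the `i`-th pair of a level. -/
def setPair {n : ℕ} (b i : ℕ) (u g : Fin n → Expr) : Prog :=
  .seq (fill (b + 11 + 2 * i) (.const 0) 0 (List.ofFn u))
    (fill (b + 12 + 2 * i) (.const 0) 0 (List.ofFn g))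

lemma exists_runs_setPair {n : ℕ} (b i : ℕ) (u g : Fin n → Expr) : ∃ c : ℕ, ∀ {m : ℕ}
    (O : Oracles n m) (σ : State) (s : ℕ), (∀ j, (u j).Ok σ s {x | x < b + 11}) →
    (∀ j, (g j).Ok σ s {x | x < b + 11}) →
    Runs O (setPair b i u g) σ
      (fun τ => (∀ z, z ≠ b + 11 + 2 * i → z ≠ b + 12 + 2 * i → τ z = σ z) ∧
        readIntVec n (τ (b + 11 + 2 * i)) 0 = (fun j => (u j).val σ) ∧
        readIntVec n (τ (b + 12 + 2 * i)) 0 = fun j => (g j).val σ) (c * (s + 1)) := by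
  obtain ⟨c₁, h₁⟩ := exists_runs_fillVec u
  obtain ⟨c₂, h₂⟩ := exists_runs_fillVec g
  refine ⟨1 + c₁ + c₂, fun O σ s hu hg => ?_⟩
  refine Runs.seq (h₁ O (b + 11 + 2 * i) σ s _ (by simp) hu) (c := c₂ * (s + 1)) ?_ (by nlinarith)
  rintro τ ⟨hfr, hτ⟩
  have hA : ∀ x ∈ {x | x < b + 11}, τ x = σ x := fun x hx => hfr x (by
    rw [Set.mem_ofPred_eq] at hx; omega)
  refine (h₂ O (b + 12 + 2 * i) τ s _ (by simp; omega) fun j => (hg j).transfer hA).mono ?_ le_rfl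
  rintro υ ⟨hfr', hυ⟩
  refine ⟨fun z h1 h2 => (hfr' z h2).trans (hfr z h1), ?_, ?_⟩
  · rw [hfr' _ (by omega), hτ]
  · rw [hυ]
    funext j
    exact (hg j).val_eq hA

/-- Chooses the `i`-th direction of a level, and a point of the polytope at which it is extremal. -/
def choosePair (n b r i : ℕ) : Prog :=
  .seq (findDirection n b r i) (.seq (pQuery b (b + 5) (cells n (b + 2) 1))
    (.seq (pQuery b (b + 6) (negE (cells n (b + 2) 1)))
      (.cond (.sub (dotE (cells n (b + 2) 1) (subE (cells n (b + 6) 1) (oE n b)))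
          (dotE (cells n (b + 2) 1) (subE (oE n b) (cells n (b + 5) 1))))
        (setPair b i (cells n (b + 6) 1) (cells n (b + 2) 1))
        (setPair b i (cells n (b + 5) 1) (negE (cells n (b + 2) 1))))))

/-- Minimizing and maximizing the direction g, and orienting it towards the extreme farther from o,
gives the largest value of |ℓ ⬝ᵥ (x - o)|. This value may be zero, in which case all points lie on
one hyperplane; therefore the next stage is asserted only if it is positive. -/
lemma exists_runs_choosePair (n b r i : ℕ) (hb : 4 ≤ b) (hi : r + i < n) : ∃ c : ℕ,
    ∀ {m C₀ d₀ : ℕ} {f : Fin (m + 1) → (Fin n → ℝ) → ℝ} {ε : ℝ} {B Δ : ℕ} {O : Oracles n m}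
    {s s₁ S U : ℕ} {ch : Prog} {e : ℕ} {E : ℤ → ℤ},
    Ctx c C₀ d₀ f ε B Δ O s s₁ S U ch e r E → ∀ (σ : State) (PS : List (Row n)),
    Inv f B S b r E PS σ → PS.length ≤ S → StageAt b PS (radius n r E B) i σ →
    Runs O (choosePair n b r i) σ (fun τ => Inv f B S b r E PS τ ∧ τ (b + 9) = σ (b + 9) ∧
      StageAt b PS (radius n r E B) i τ ∧
      (0 < readIntVec n (τ (b + 12 + 2 * i)) 0 ⬝ᵥ
        (readIntVec n (τ (b + 11 + 2 * i)) 0 - readIntVec n (τ (b + 10)) 0) →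
          StageAt b PS (radius n r E B) (i + 1) τ) ∧
      (∀ t, |readIntVec n (τ (b + 12 + 2 * i)) 0 t| ≤ radius n r E B) ∧
      readIntVec n (τ (b + 11 + 2 * i)) 0 ∈ intPoints PS ∧
      (∀ x ∈ intPoints PS, |readIntVec n (τ (b + 12 + 2 * i)) 0 ⬝ᵥ
        (x - readIntVec n (τ (b + 10)) 0)| ≤ readIntVec n (τ (b + 12 + 2 * i)) 0 ⬝ᵥ
        (readIntVec n (τ (b + 11 + 2 * i)) 0 - readIntVec n (τ (b + 10)) 0)) ∧
      (∀ j < r, (hrow n E j).1 ⬝ᵥ readIntVec n (τ (b + 12 + 2 * i)) 0 = 0) ∧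
      readIntVec n (τ (b + 12 + 2 * i)) 0 ≠ 0) (c * U) := by
  obtain ⟨c₁, h₁⟩ := exists_runs_findDirection n b r i hb hi
  obtain ⟨c₂, h₂⟩ := exists_runs_pQuery b (b + 5) (cells n (b + 2) 1) (by omega)
  obtain ⟨c₃, h₃⟩ := exists_runs_pQuery b (b + 6) (negE (cells n (b + 2) 1)) (by omega)
  obtain ⟨c₄, h₄⟩ := exists_runs_setPair b i (cells n (b + 6) 1) (cells n (b + 2) 1)
  obtain ⟨c₅, h₅⟩ := exists_runs_setPair b i (cells n (b + 5) 1) (negE (cells n (b + 2) 1))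
  -- Positive exactly if the maximizer in array b + 6 is farther from o, as measured by g, than the
  -- minimizer in array b + 5.
  set test : Expr := .sub (dotE (cells n (b + 2) 1) (subE (cells n (b + 6) 1) (oE n b)))
    (dotE (cells n (b + 2) 1) (subE (oE n b) (cells n (b + 5) 1))) with htest
  refine ⟨3 + c₁ + c₂ + c₃ + c₄ + c₅ + (1 + test.weight) + (radiusE n b r).weight,
    fun {m C₀ d₀ f ε B Δ O s s₁ S U ch e E} hctx σ PS hI hlen hS => ?_⟩
  set W := (radiusE n b r).weight
  have hss := hctx.sizes.s_le
  have hs₁ := hctx.sizes.s₁_le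
  have hU := hctx.sizes.S_le
  have hs₁U : s₁ + 1 ≤ U := by omega
  have hbits : ∀ z ∈ intPoints PS, ∀ t, bits (z t) ≤ s₁ := fun z hz t =>
    ((bits_le_of_abs_le (hI.abs_le hz t)).trans hctx.pre.bits_B).trans hss
  refine Runs.seq (h₁ (hctx.mono (by omega)) σ PS hI hS)
    (c := (2 + c₂ + c₃ + c₄ + c₅ + (1 + test.weight)) * U) ?_ (by nlinarith)
  rintro σ₁ ⟨hfr₁, hgR, hgh, hgw, hg0⟩
  set g := readIntVec n (σ₁ (b + 2)) 1 with hg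
  set o := readIntVec n (σ (b + 10)) 0 with ho
  have hI₁ : Inv f B S b r E PS σ₁ := hI.frame (hfr₁ _ (by omega) (by omega))
    (hfr₁ _ (by omega) (by omega)) (by rw [hfr₁ _ (by omega) (by omega)]; exact hI.poly)
  have hgb : ∀ t, bits (g t) ≤ s₁ := fun t =>
    hctx.bits_radius_le (b := b) (by omega) hI.row hI.three (hgR t)
  refine Runs.seq (h₂ hctx.set (hctx.sizes.mono (by omega)) σ₁ PS hI₁.poly hlen hI₁.box hctx.pre.bits_B
    (ok_cells (by simp) hgb)) (c := (1 + c₃ + c₄ + c₅ + (1 + test.weight)) * U) ?_ (by nlinarith)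
  rintro σ₂ ⟨hfr₂, hP₂, hans₂, hmin₂⟩
  have hX₂ : σ₂ (b + 5) 0 = 1 ∧ readIntVec n (σ₂ (b + 5)) 1 ∈ intPoints PS :=
    hans₂.resolve_right fun h => h.2 o hS.base
  set u₁ := readIntVec n (σ₂ (b + 5)) 1 with hu₁
  have hmin : ∀ w ∈ intPoints PS, g ⬝ᵥ u₁ ≤ g ⬝ᵥ w := hmin₂ hX₂.1
  have hg₂ : readIntVec n (σ₂ (b + 2)) 1 = g := by rw [hfr₂ _ (by omega) (by omega)]
  refine Runs.seq (h₃ hctx.set (hctx.sizes.mono (by omega)) σ₂ PS hP₂ hlen hI₁.box hctx.pre.bits_B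
    (ok_negE (ok_cells (by simp) (by rw [Nat.cast_one, hg₂]; exact hgb))))
    (c := (c₄ + c₅ + (1 + test.weight)) * U) ?_
    (by nlinarith)
  rintro σ₃ ⟨hfr₃, hP₃, hans₃, hmax₃⟩
  have hX₃ : σ₃ (b + 6) 0 = 1 ∧ readIntVec n (σ₃ (b + 6)) 1 ∈ intPoints PS :=
    hans₃.resolve_right fun h => h.2 o hS.base
  set u₂ := readIntVec n (σ₃ (b + 6)) 1 with hu₂
  have hmax : ∀ w ∈ intPoints PS, g ⬝ᵥ w ≤ g ⬝ᵥ u₂ := by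
    have h := hmax₃ hX₃.1
    rw [val_negE, val_cells_fun, Nat.cast_one, hg₂] at h
    intro w hw
    have := h w hw
    rw [neg_dotProduct, neg_dotProduct] at this
    exact neg_le_neg_iff.1 this
  have hfr : ∀ z, z ≠ b + 1 → z ≠ b + 2 → z ≠ b + 3 → z ≠ b + 5 → z ≠ b + 6 → σ₃ z = σ z :=
    fun z h1 h2 h3 h5 h6 => by rw [hfr₃ z h1 h6, hfr₂ z h1 h5, hfr₁ z h3 h2]
  have hg₃ : readIntVec n (σ₃ (b + 2)) 1 = g := by rw [hfr₃ _ (by omega) (by omega), hg₂]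
  have hu₁₃ : readIntVec n (σ₃ (b + 5)) 1 = u₁ := by rw [hfr₃ _ (by omega) (by omega)]
  have ho₃ : readIntVec n (σ₃ (b + 10)) 0 = o := by
    rw [hfr _ (by omega) (by omega) (by omega) (by omega) (by omega)]
  have hI₃ : Inv f B S b r E PS σ₃ :=
    hI.frame (hfr _ (by omega) (by omega) (by omega) (by omega) (by omega))
      (hfr _ (by omega) (by omega) (by omega) (by omega) (by omega)) hP₃
  have okg : ∀ t, (cells n (b + 2) 1 t).Ok σ₃ s₁ {x | x < b + 11} :=
    ok_cells (by simp) (by rw [Nat.cast_one, hg₃]; exact hgb)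
  have oku₁ : ∀ t, (cells n (b + 5) 1 t).Ok σ₃ s₁ {x | x < b + 11} :=
    ok_cells (by simp) (by rw [Nat.cast_one, hu₁₃]; exact hbits _ hX₂.2)
  have oku₂ : ∀ t, (cells n (b + 6) 1 t).Ok σ₃ s₁ {x | x < b + 11} :=
    ok_cells (by simp) (by rw [Nat.cast_one, ← hu₂]; exact hbits _ hX₃.2)
  have oko : ∀ t, (oE n b t).Ok σ₃ s₁ {x | x < b + 11} :=
    ok_cells (by simp) (by rw [Nat.cast_zero, ho₃]; exact hbits _ hS.base)
  have hval : test.val σ₃ = g ⬝ᵥ (u₂ - o) - g ⬝ᵥ (o - u₁) := by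
    simp only [htest, Expr.val, val_dotE, val_subE, val_cells_fun, Nat.cast_one, Nat.cast_zero]
    rw [hg₃, hu₁₃, ho₃]
  have hval' : test.val σ₃ = g ⬝ᵥ u₂ + g ⬝ᵥ u₁ - 2 * (g ⬝ᵥ o) := by
    rw [hval, dotProduct_sub, dotProduct_sub]; ring
  have finish : ∀ (τ : State) (v ℓ : Fin n → ℤ),
      (∀ z, z ≠ b + 11 + 2 * i → z ≠ b + 12 + 2 * i → τ z = σ₃ z) →
      readIntVec n (τ (b + 11 + 2 * i)) 0 = v → readIntVec n (τ (b + 12 + 2 * i)) 0 = ℓ →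
      v ∈ intPoints PS → (ℓ = g ∨ ℓ = -g) → (∀ x ∈ intPoints PS, |ℓ ⬝ᵥ (x - o)| ≤ ℓ ⬝ᵥ (v - o)) →
      Inv f B S b r E PS τ ∧ τ (b + 9) = σ (b + 9) ∧
      StageAt b PS (radius n r E B) i τ ∧
      (0 < readIntVec n (τ (b + 12 + 2 * i)) 0 ⬝ᵥ
        (readIntVec n (τ (b + 11 + 2 * i)) 0 - readIntVec n (τ (b + 10)) 0) →
          StageAt b PS (radius n r E B) (i + 1) τ) ∧
      (∀ t, |readIntVec n (τ (b + 12 + 2 * i)) 0 t| ≤ radius n r E B) ∧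
      readIntVec n (τ (b + 11 + 2 * i)) 0 ∈ intPoints PS ∧
      (∀ x ∈ intPoints PS, |readIntVec n (τ (b + 12 + 2 * i)) 0 ⬝ᵥ
        (x - readIntVec n (τ (b + 10)) 0)| ≤ readIntVec n (τ (b + 12 + 2 * i)) 0 ⬝ᵥ
        (readIntVec n (τ (b + 11 + 2 * i)) 0 - readIntVec n (τ (b + 10)) 0)) ∧
      (∀ j < r, (hrow n E j).1 ⬝ᵥ readIntVec n (τ (b + 12 + 2 * i)) 0 = 0) ∧
      readIntVec n (τ (b + 12 + 2 * i)) 0 ≠ 0 := by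
    intro τ v ℓ hτ hv hℓ hvX hℓg hle
    have hoτ : readIntVec n (τ (b + 10)) 0 = o := by rw [hτ _ (by omega) (by omega), ho₃]
    have hSτ : StageAt b PS (radius n r E B) i τ := by
      have h1 : ∀ j < i, readIntVec n (τ (b + 11 + 2 * j)) 0 =
          readIntVec n (σ (b + 11 + 2 * j)) 0 := fun j hj => by
        rw [hτ _ (by omega) (by omega),
          hfr _ (by omega) (by omega) (by omega) (by omega) (by omega)]
      have h2 : ∀ j < i, readIntVec n (τ (b + 12 + 2 * j)) 0 =
          readIntVec n (σ (b + 12 + 2 * j)) 0 := fun j hj => by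
        rw [hτ _ (by omega) (by omega),
          hfr _ (by omega) (by omega) (by omega) (by omega) (by omega)]
      have := hS.congr h1 h2
      rw [StageAt, hoτ]; exact this
    have hR : ∀ t, |ℓ t| ≤ radius n r E B := by
      rcases hℓg with rfl | rfl
      · exact hgR
      · intro t; rw [Pi.neg_apply, abs_neg]; exact hgR t
    have hdot : ∀ x : Fin n → ℤ, g ⬝ᵥ x = 0 → ℓ ⬝ᵥ x = 0 := by
      intro x hx
      rcases hℓg with rfl | rfl
      · exact hx
      · rw [neg_dotProduct, hx, neg_zero]
    rw [hv, hℓ, hoτ]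
    refine ⟨hI₃.frame (hτ _ (by omega) (by omega)) (hτ _ (by omega) (by omega))
      (by rw [hτ _ (by omega) (by omega)]; exact hP₃), ?_, hSτ, fun hpos => ?_, hR, hvX, hle,
      fun j hj => ?_, ?_⟩
    · rw [hτ _ (by omega) (by omega),
        hfr _ (by omega) (by omega) (by omega) (by omega) (by omega)]
    · refine hSτ.succ (by rwa [hv]) (by rwa [hℓ]) (fun j hj => ?_) (by rwa [hv, hℓ, hoτ])
        (by rwa [hv, hℓ, hoτ])
      rw [hℓ, hoτ, hτ _ (by omega) (by omega),
        hfr _ (by omega) (by omega) (by omega) (by omega) (by omega)]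
      refine hdot _ ?_
      rw [dotProduct_comm]; exact hgw j hj
    · rw [dotProduct_comm]
      refine hdot _ ?_
      rw [dotProduct_comm]; exact hgh j hj
    · rcases hℓg with rfl | rfl
      · exact hg0
      · exact neg_ne_zero.2 hg0
  refine Runs.cond (s := s₁) (A := {x | x < b + 11}) (c := (c₄ + c₅) * U)
    ⟨ok_dotE okg (ok_subE oku₂ oko), ok_dotE okg (ok_subE oko oku₁)⟩ (fun hpos => ?_)
    (fun hneg => ?_) (by nlinarith)
  · refine (h₄ O σ₃ s₁ oku₂ okg).mono ?_ (by nlinarith)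
    rintro τ ⟨hτ, hv, hℓ⟩
    refine finish τ u₂ g hτ hv (hℓ.trans hg₃) hX₃.2 (Or.inl rfl) fun x hx => ?_
    have h1 := hmin x hx
    have h2 := hmax x hx
    rw [← htest, hval'] at hpos
    rw [dotProduct_sub, dotProduct_sub, abs_le]
    constructor <;> linarith
  · refine (h₅ O σ₃ s₁ oku₁ (ok_negE okg)).mono ?_ (by nlinarith)
    rintro τ ⟨hτ, hv, hℓ⟩
    refine finish τ u₁ (-g) hτ (hv.trans hu₁₃) ?_ hX₂.2 (Or.inr rfl) fun x hx => ?_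
    · rw [hℓ, val_negE, val_cells_fun, Nat.cast_one, hg₃]
    have h1 := hmin x hx
    have h2 := hmax x hx
    rw [← htest, hval'] at hneg
    rw [neg_dotProduct, neg_dotProduct, dotProduct_sub, dotProduct_sub, abs_neg, abs_le]
    constructor <;> linarith


/-! ## Rational vectors in the memory -/

lemma Holds.flatMap_pair {a : ℤ → ℤ} {α : Type} {u v : α → ℤ} {l : List α} {s : ℤ}
    (h : Holds a s (l.flatMap fun q => [u q, v q])) (t : ℕ) (ht : t < l.length) :
    a (s + 2 * t) = u l[t] ∧ a (s + 2 * t + 1) = v l[t] := by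
  induction l generalizing s t with
  | nil => simp at ht
  | cons q l ih =>
    rw [List.flatMap_cons, holds_append, holds_cons, holds_singleton] at h
    obtain ⟨⟨h1, h2⟩, h3⟩ := h
    cases t with
    | zero => simpa using ⟨h1, h2⟩
    | succ t =>
      have := ih h3 t (by simpa using ht)
      simp only [List.length_cons, List.length_nil] at this
      rw [List.getElem_cons_succ, ← this.1, ← this.2]
      constructor <;> congr 1 <;> push_cast <;> ring

lemma Holds.encodeRat {n : ℕ} {a : ℤ → ℤ} {s : ℤ} {x : Fin n → ℚ}
    (h : Holds a s (encodeRat x)) (j : Fin n) :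
    a (s + 2 * (j : ℕ)) = (x j).num ∧ a (s + 2 * (j : ℕ) + 1) = (x j).den := by
  have := Holds.flatMap_pair (u := fun q : ℚ => q.num) (v := fun q : ℚ => (q.den : ℤ)) h j (by simp)
  simpa using this

lemma Holds.readRatVec {n : ℕ} {a : ℤ → ℤ} {s : ℤ} {x : Fin n → ℚ}
    (h : Holds a s (ConvexIntMin.encodeRat x)) : readRatVec n a s = x := by
  funext j
  simp only [ConvexIntMin.readRatVec, readRat]
  rw [(h.encodeRat j).1, (h.encodeRat j).2]
  exact_mod_cast Rat.num_div_den (x j)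

lemma encodeRat_intCast {n : ℕ} (z : Fin n → ℤ) :
    encodeRat (fun j => (z j : ℚ)) = (List.ofFn z).flatMap fun y => [y, 1] := by
  rw [encodeRat, show (List.ofFn fun j => (z j : ℚ)) = (List.ofFn z).map fun y : ℤ => (y : ℚ) by
    rw [List.map_ofFn]; rfl, List.flatMap_map]
  simp

lemma length_encodeRat {n : ℕ} (x : Fin n → ℚ) : (encodeRat x).length = 2 * n := by
  simp [encodeRat, List.length_flatMap, List.sum_ofFn, mul_comm]

lemma ratPoint_intCast {n : ℕ} (z : Fin n → ℤ) : ratPoint (fun j => (z j : ℚ)) = intPoint z := by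
  funext j; simp [ratPoint, intPoint]

lemma systemSize_eq {n : ℕ} (S : List (Row n)) : systemSize S = listSize (flatRows S) := by
  induction S with
  | nil => rfl
  | cons q S ih =>
    have h : flatRows (q :: S) = (List.ofFn q.1 ++ [q.2]) ++ flatRows S := by simp [flatRows]
    rw [h, listSize_append, listSize_append, ← ih]
    simp [systemSize]

lemma bits_le_listSize {l : List ℤ} {z : ℤ} (h : z ∈ l) : bits z ≤ listSize l := by
  have : 1 + bits z ≤ listSize l :=
    List.single_le_sum (fun _ _ => Nat.zero_le _) _
      (List.mem_map_of_mem (f := fun z => 1 + bits z) h)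
  omega

lemma mem_encodeRat {n : ℕ} (x : Fin n → ℚ) (j : Fin n) :
    (x j).num ∈ encodeRat x ∧ ((x j).den : ℤ) ∈ encodeRat x := by
  simp only [encodeRat, List.mem_flatMap, List.mem_cons, List.not_mem_nil, or_false]
  have h : x j ∈ List.ofFn x := (List.mem_ofFn' _ _).2 ⟨j, rfl⟩
  exact ⟨⟨x j, h, Or.inl rfl⟩, ⟨x j, h, Or.inr rfl⟩⟩

lemma log_le_bits (B : ℕ) : Nat.log 2 B ≤ bits B := by
  rw [bits, Int.natAbs_natCast]
  rcases Nat.eq_zero_or_pos B with rfl | h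
  · simp
  · exact (Nat.lt_size.2 (Nat.pow_log_le_self 2 h.ne')).le

/-! ### One round: deep lattice points, flat directions and cuts. -/

/-! ## Halving -/

/-- The integer points of a polytope are closed under taking integer convex combinations. -/
lemma mem_intPoints_of_convex {n k : ℕ} {PS : List (Row n)} {o z : Fin n → ℤ}
    {v : Fin k → Fin n → ℤ} (ho : o ∈ intPoints PS) (hv : ∀ j, v j ∈ intPoints PS) (μ : Fin k → ℝ)
    (hμ : ∀ j, 0 ≤ μ j) (hμ1 : ∑ j, μ j ≤ 1)
    (hz : intPoint (z - o) = ∑ j, μ j • intPoint (v j - o)) : z ∈ intPoints PS := by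
  rw [mem_intPoints]
  intro q hq
  have h0 : ((q.1 ⬝ᵥ o : ℤ) : ℝ) ≤ q.2 := by exact_mod_cast mem_intPoints.1 ho q hq
  have hj : ∀ j, ((q.1 ⬝ᵥ v j : ℤ) : ℝ) ≤ q.2 := fun j => by
    exact_mod_cast mem_intPoints.1 (hv j) q hq
  have h1 : ((q.1 ⬝ᵥ z : ℤ) : ℝ) - (q.1 ⬝ᵥ o : ℤ) =
      ∑ j, μ j * ((q.1 ⬝ᵥ v j : ℤ) - (q.1 ⬝ᵥ o : ℤ)) := by
    have := congrArg (fun x => intPoint q.1 ⬝ᵥ x) hz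
    simp only [dotProduct_sum, dotProduct_smul, intPoint_dotProduct, dotProduct_sub,
      smul_eq_mul] at this
    exact_mod_cast this
  have h2 : ∑ j, μ j * (((q.1 ⬝ᵥ v j : ℤ) : ℝ) - (q.1 ⬝ᵥ o : ℤ)) ≤
      ∑ j, μ j * ((q.2 : ℝ) - (q.1 ⬝ᵥ o : ℤ)) :=
    Finset.sum_le_sum fun j _ => mul_le_mul_of_nonneg_left (by linarith [hj j]) (hμ j)
  rw [← Finset.sum_mul] at h2
  have h3 : ((q.1 ⬝ᵥ z : ℤ) : ℝ) ≤ q.2 := by nlinarith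
  exact_mod_cast h3

lemma finite_intPoints {n : ℕ} {R : ℤ} {PS : List (Row n)} (h : boxRows n R ⊆ PS) :
    (intPoints PS).Finite := by
  refine (Set.finite_Icc (fun _ => -R : Fin n → ℤ) fun _ => R).subset fun z hz => ?_
  have := subset_box_of_boxRows h hz
  exact ⟨fun j => (abs_le.1 (this j)).1, fun j => (abs_le.1 (this j)).2⟩

lemma mem_intPoints_append {n : ℕ} {PS : List (Row n)} {q : Row n} {z : Fin n → ℤ} :
    z ∈ intPoints (PS ++ [q]) ↔ z ∈ intPoints PS ∧ q.1 ⬝ᵥ z ≤ q.2 := by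
  simp only [mem_intPoints, List.forall_mem_append, List.forall_mem_singleton]

/-- The denominator of the flatness scale. -/
def scale (k : ℕ) : ℕ := 2 * (k + 1) * 2 ^ k

/-- The point `a` is close to the centroid of the simplex of a stage. -/
def Deep {n : ℕ} (k : ℕ) (o : Fin n → ℤ) (v ℓ : ℕ → Fin n → ℤ) (a : Fin n → ℤ) : Prop :=
  ∀ i < k, |((k : ℤ) + 1) * scale k * (ℓ i ⬝ᵥ (a - o)) -
    scale k * (ℓ i ⬝ᵥ ∑ j : Fin k, (v j - o))| ≤ (k + 1) * (ℓ i ⬝ᵥ (v i - o))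

/-- A deep point has nonnegative barycentric coordinates in a simplex with vertices in the polytope.
Therefore the search for it can do without the growing list of cuts. -/
lemma Stage.mem_of_deep {n r k : ℕ} {PS : List (Row n)} {o a : Fin n → ℤ} {v ℓ : ℕ → Fin n → ℤ}
    {R : ℤ} (h : Stage (intPoints PS) o v ℓ R k) (hk : r + k = n) {H : ℕ → Row n}
    (hind : LinearIndependent ℝ fun j : Fin r => intPoint (H j).1)
    (hX : ∀ x ∈ intPoints PS, ∀ j < r, (H j).1 ⬝ᵥ x = (H j).2)
    (ha : ∀ j < r, (H j).1 ⬝ᵥ a = (H j).2) (hd : Deep k o v ℓ a) : a ∈ intPoints PS := by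
  have F := h.frame hk hind hX
  have := F.add_mem_of_deep (scale k) rfl (intPoints PS) o a
    (fun z μ h0 h1 hz => mem_intPoints_of_convex h.base (fun j => h.mem j j.2) μ h0 h1 hz)
    (fun l => by rw [dotProduct_sub, ha l l.2, hX o h.base l l.2, sub_self])
    (fun i => hd i i.2) 0 (fun l => by simp) (fun i => by simpa using (F.pos i).le)
  simpa using this

/-- A cut through a point close to the centroid removes a constant fraction of the points. -/
lemma Stage.ncard_le {n r k : ℕ} {PS : List (Row n)} {R' : ℤ} (hbox : boxRows n R' ⊆ PS)
    {o a : Fin n → ℤ} {v ℓ : ℕ → Fin n → ℤ}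
    {R : ℤ} (h : Stage (intPoints PS) o v ℓ R k) (hk : r + k = n) {H : ℕ → Row n}
    (hind : LinearIndependent ℝ fun j : Fin r => intPoint (H j).1)
    (hX : ∀ x ∈ intPoints PS, ∀ j < r, (H j).1 ⬝ᵥ x = (H j).2)
    (ha : ∀ j < r, (H j).1 ⬝ᵥ a = (H j).2) (hd : Deep k o v ℓ a) (c : Fin n → ℤ) {β : ℤ}
    (hβ : β < c ⬝ᵥ a) :
    2 * (2 * scale k + 1) ^ k * (intPoints (PS ++ [(c, β)])).ncard + (intPoints PS).ncard ≤
      2 * (2 * scale k + 1) ^ k * (intPoints PS).ncard := by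
  classical
  have F := h.frame hk hind hX
  have hfin := finite_intPoints hbox
  have h1 := F.card_le_mul_card_halfspace (scale k) rfl hfin.toFinset o a c
    (fun x hx => by
      rw [Set.Finite.mem_toFinset] at hx
      exact ⟨fun l => by rw [dotProduct_sub, hX x hx l l.2, hX o h.base l l.2, sub_self],
        fun i => h.le i i.2 x hx⟩)
    (fun z μ h0 h1 hz => by
      rw [Set.Finite.mem_toFinset]
      exact mem_intPoints_of_convex h.base (fun j => h.mem j j.2) μ h0 h1 hz)
    (fun l => by rw [dotProduct_sub, ha l l.2, hX o h.base l l.2, sub_self])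
    (fun i => hd i i.2)
  have hfin' : (intPoints (PS ++ [(c, β)])).Finite :=
    hfin.subset fun z hz => (mem_intPoints_append.1 hz).1
  rw [Set.ncard_eq_toFinset_card _ hfin, Set.ncard_eq_toFinset_card _ hfin']
  -- The surviving points satisfy c ⬝ᵥ z ≤ β < c ⬝ᵥ a, so they are disjoint from the halfspace that
  -- contains a constant fraction of the points.
  have h2 : hfin'.toFinset.card + (hfin.toFinset.filter fun x => c ⬝ᵥ a ≤ c ⬝ᵥ x).card ≤
      hfin.toFinset.card := by
    rw [← Finset.card_union_of_disjoint]
    · refine Finset.card_le_card (Finset.union_subset (fun z hz => ?_) (Finset.filter_subset _ _))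
      rw [Set.Finite.mem_toFinset] at hz ⊢
      exact (mem_intPoints_append.1 hz).1
    · rw [Finset.disjoint_left]
      intro z hz hz'
      rw [Set.Finite.mem_toFinset, mem_intPoints_append] at hz
      have := (Finset.mem_filter.1 hz').2
      have := hz.2
      simp only at this
      omega
  calc _ ≤ 2 * (2 * scale k + 1) ^ k * hfin'.toFinset.card + 2 * (2 * scale k + 1) ^ k *
        (hfin.toFinset.filter fun x => c ⬝ᵥ a ≤ c ⬝ᵥ x).card := Nat.add_le_add_left h1 _
    _ ≤ _ := by rw [← Nat.mul_add]; exact Nat.mul_le_mul_left _ h2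


/-! ## The search for a central lattice point -/

/-- A multiple of a vector. -/
def smulE {n : ℕ} (z : ℤ) (a : Fin n → Expr) : Fin n → Expr := fun t => .mul (.const z) (a t)

lemma val_smulE {n : ℕ} (σ : State) (z : ℤ) (a : Fin n → Expr) :
    (fun t => (smulE z a t).val σ) = z • fun t => (a t).val σ := rfl

lemma ok_smulE {n : ℕ} {σ : State} {s : ℕ} {A : Set ℕ} {z : ℤ} {a : Fin n → Expr}
    (h : ∀ t, (a t).Ok σ s A) (t : Fin n) : (smulE z a t).Ok σ s A := ⟨trivial, h t⟩

/-- The rows that express that a point is close to the centroid of the simplex of a stage. -/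
def deepRows (n b k : ℕ) : List (RowE n) :=
  (List.range k).flatMap fun i =>
    let α : Fin n → Expr := smulE ((k + 1) * scale k) (lE n b i)
    let β : Expr := .add (dotE α (oE n b)) (.mul (.const (scale k)) (dotE (lE n b i)
      fun t => sumE (List.ofFn fun j : Fin k => subE (vE n b j) (oE n b) t)))
    let γ : Expr := .mul (.const (k + 1)) (dotE (lE n b i) (subE (vE n b i) (oE n b)))
    [(α, .add β γ), (negE α, .sub γ β)]

lemma forall_mem_deepRows {n b k : ℕ} {σ : State} {a : Fin n → ℤ} :
    (∀ q ∈ deepRows n b k, (q.val σ).1 ⬝ᵥ a ≤ (q.val σ).2) ↔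
      Deep k (readIntVec n (σ (b + 10)) 0) (fun j => readIntVec n (σ (b + 11 + 2 * j)) 0)
        (fun j => readIntVec n (σ (b + 12 + 2 * j)) 0) a := by
  simp only [deepRows, List.mem_flatMap, List.mem_range, List.mem_cons, List.not_mem_nil, or_false,
    Deep]
  have key2 : (fun t => (sumE (List.ofFn fun j : Fin k => subE (vE n b j) (oE n b) t)).val σ) =
      ∑ j : Fin k, (readIntVec n (σ (b + 11 + 2 * j)) 0 - readIntVec n (σ (b + 10)) 0) := by
    funext t
    rw [val_sumE, List.map_ofFn, List.sum_ofFn, Finset.sum_apply]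
    rfl
  constructor
  · intro h i hi
    have h1 := h _ ⟨i, hi, Or.inl rfl⟩
    have h2 := h _ ⟨i, hi, Or.inr rfl⟩
    simp only [RowE.val, val_negE, Expr.val, val_dotE, val_smulE, key2, val_subE, val_cells_fun,
      Nat.cast_zero] at h1 h2
    simp only [neg_dotProduct, smul_dotProduct, smul_eq_mul] at h1 h2
    rw [dotProduct_sub, abs_le]
    constructor <;> linarith
  · rintro h q ⟨i, hi, hq⟩
    have h1 := abs_le.1 (h i hi)
    rw [dotProduct_sub _ a] at h1
    rcases hq with rfl | rfl <;>
    · simp only [RowE.val, val_negE, Expr.val, val_dotE, val_smulE, key2, val_subE, val_cells_fun,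
        Nat.cast_zero]
      simp only [neg_dotProduct, smul_dotProduct, smul_eq_mul]
      linarith

lemma ok_deepRows {n b k s : ℕ} {σ : State} {A : Set ℕ} (ho : ∀ t, (oE n b t).Ok σ s A)
    (hv : ∀ j < k, ∀ t, (vE n b j t).Ok σ s A) (hl : ∀ j < k, ∀ t, (lE n b j t).Ok σ s A) :
    ∀ q ∈ deepRows n b k, q.Ok σ s A := by
  intro q hq
  simp only [deepRows, List.mem_flatMap, List.mem_range, List.mem_cons, List.not_mem_nil,
    or_false] at hq
  obtain ⟨i, hi, hq⟩ := hq
  have h1 : (Expr.add (dotE (smulE ((k + 1) * scale k) (lE n b i)) (oE n b))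
      (.mul (.const (scale k)) (dotE (lE n b i)
      fun t => sumE (List.ofFn fun j : Fin k => subE (vE n b j) (oE n b) t)))).Ok σ s A := by
    refine ⟨ok_dotE (ok_smulE (hl i hi)) ho, trivial, ok_dotE (hl i hi) fun t => ok_sumE ?_⟩
    intro e he
    obtain ⟨j, rfl⟩ := (List.mem_ofFn' _ _).1 he
    exact ok_subE (hv j j.2) ho t
  have h2 : (Expr.mul (.const (k + 1)) (dotE (lE n b i) (subE (vE n b i) (oE n b)))).Ok σ s A :=
    ⟨trivial, ok_dotE (hl i hi) (ok_subE (hv i hi) ho)⟩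
  rcases hq with rfl | rfl
  · exact ⟨ok_smulE (hl i hi), h1, h2⟩
  · exact ⟨ok_negE (ok_smulE (hl i hi)), h2, h1⟩

/-- Searches for a lattice point close to the centroid of the simplex of the level. -/
def findDeep (n b r k : ℕ) : Prog :=
  search (b + 3) (b + 2) (.get 3 (.const 0)) (pairE (eqE n b r) ++ deepRows n b k)
    [(fun _ => .const 0, .const 0)]

section

variable {n m c C₀ d₀ : ℕ} {f : Fin (m + 1) → (Fin n → ℝ) → ℝ} {ε : ℝ} {B Δ : ℕ}
  {O : Oracles n m} {s s₁ S U : ℕ} {ch : Prog} {b e r : ℕ} {E : ℤ → ℤ} {σ : State}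
  {PS : List (Row n)} {k : ℕ}

lemma Ctx.bits_le (h : Ctx c C₀ d₀ f ε B Δ O s s₁ S U ch e r E) (hI : Inv f B S b r E PS σ)
    {z : Fin n → ℤ} (hz : z ∈ intPoints PS) (t : Fin n) : bits (z t) ≤ s :=
  (bits_le_of_abs_le (hI.abs_le hz t)).trans h.pre.bits_B

lemma Ctx.ok_oE (h : Ctx c C₀ d₀ f ε B Δ O s s₁ S U ch e r E) (hI : Inv f B S b r E PS σ)
    {i : ℕ} (hS : StageAt b PS (radius n r E B) i σ) {A : Set ℕ} (hA : b + 10 ∈ A) (t : Fin n) :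
    (oE n b t).Ok σ s A := ok_cells hA (fun t => h.bits_le hI hS.base t) t

lemma Ctx.ok_vE (h : Ctx c C₀ d₀ f ε B Δ O s s₁ S U ch e r E) (hI : Inv f B S b r E PS σ)
    {i : ℕ} (hS : StageAt b PS (radius n r E B) i σ) {A : Set ℕ} (hA : ∀ x, b + 11 ≤ x → x ∈ A)
    {j : ℕ} (hj : j < i) (t : Fin n) : (vE n b j t).Ok σ s A :=
  ok_cells (hA _ (by omega)) (fun t => h.bits_le hI (hS.mem j hj) t) t

lemma Ctx.ok_lE (h : Ctx c C₀ d₀ f ε B Δ O s s₁ S U ch e r E) (hI : Inv f B S b r E PS σ)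
    (hc : (radiusE n b r).weight ≤ c)
    {i : ℕ} (hS : StageAt b PS (radius n r E B) i σ) {A : Set ℕ} (hA : ∀ x, b + 11 ≤ x → x ∈ A)
    {j : ℕ} (hj : j < i) (t : Fin n) : (lE n b j t).Ok σ s₁ A :=
  ok_cells (hA _ (by omega))
    (fun t => h.bits_radius_le (b := b) hc hI.row hI.three (hS.size j hj t)) t

end

/-- The constraint to the box loses nothing, as deep points lie in the polytope and hence in the
box. The only candidate row is the trivial inequality 0 ≤ 0. -/
lemma exists_runs_findDeep (n b r k : ℕ) (hb : 4 ≤ b) (hk : r + k = n) : ∃ c : ℕ,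
    ∀ {m C₀ d₀ : ℕ} {f : Fin (m + 1) → (Fin n → ℝ) → ℝ} {ε : ℝ} {B Δ : ℕ} {O : Oracles n m}
    {s s₁ S U : ℕ} {ch : Prog} {e : ℕ} {E : ℤ → ℤ},
    Ctx c C₀ d₀ f ε B Δ O s s₁ S U ch e r E → ∀ (σ : State) (PS : List (Row n)),
    Inv f B S b r E PS σ → StageAt b PS (radius n r E B) k σ →
    Runs O (findDeep n b r k) σ (fun τ => (∀ z, z ≠ b + 3 → z ≠ b + 2 → τ z = σ z) ∧
      IsAnswer (fun a => (∀ j < r, (hrow n E j).1 ⬝ᵥ a = (hrow n E j).2) ∧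
        Deep k (readIntVec n (σ (b + 10)) 0) (fun j => readIntVec n (σ (b + 11 + 2 * j)) 0)
          (fun j => readIntVec n (σ (b + 12 + 2 * j)) 0) a) (τ (b + 2))) (c * U) := by
  obtain ⟨c, hc⟩ := exists_runs_search (n := n) (.get 3 (.const 0))
    (pairE (eqE n b r) ++ deepRows n b k) [(fun _ => .const 0, .const 0)]
  refine ⟨c + (radiusE n b r).weight, fun {m C₀ d₀ f ε B Δ O s s₁ S U ch e E} hctx σ PS hI hS => ?_⟩
  have hpre : LevelPre n r (σ b) B Δ s := by rw [hI.row]; exact hctx.pre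
  have hss := hctx.sizes.s_le
  have hs₁ := hctx.sizes.s₁_le
  have hU := hctx.sizes.S_le
  have hA : ∀ x, b + 10 ≤ x → x ∈ ({b + 3, b + 2}ᶜ : Set ℕ) := by intro x hx; simp; omega
  refine (hc hctx.set.valid (b + 3) (b + 2) σ s₁ {b + 3, b + 2}ᶜ (by simp) (by simp)
    ⟨by simp; omega, by simp only [Expr.val, hI.three]; exact hctx.pre.bits_B.trans hss, trivial⟩
    ?_ ?_).mono ?_ (Nat.mul_le_mul (by omega) (by omega))
  · intro q hq
    rcases List.mem_append.1 hq with hq | hq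
    · exact (ok_pairE (ok_eqE hpre (by simp)) q hq).mono hss le_rfl
    · exact ok_deepRows
        (fun t => (hctx.ok_oE hI hS (hA _ le_rfl) t).mono hss le_rfl)
        (fun j hj t => (hctx.ok_vE hI hS (fun x hx => hA x (by omega)) hj t).mono hss le_rfl)
        (fun j hj t => hctx.ok_lE hI (by omega) hS (fun x hx => hA x (by omega)) hj t) q hq
  · intro q hq
    rw [List.mem_singleton.1 hq]
    exact ⟨fun _ => trivial, trivial⟩
  · rintro τ ⟨hfr, hans⟩
    refine ⟨hfr, hans.congr fun a => ?_⟩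
    rw [List.forall_mem_append, forall_mem_pairE, forall_mem_eqE, forall_mem_deepRows, hI.row,
      mem_affineSpace_eqs]
    constructor
    · exact fun h => h.2.1
    · intro h
      refine ⟨?_, h, _, List.mem_singleton_self _, ?_⟩
      · simp only [Expr.val, hI.three]
        exact hI.abs_le (hS.mem_of_deep hk hctx.pre.indep (fun x hx => hI.dot_eq hx) h.1 h.2)
      · simp [RowE.val, Expr.val, dotProduct]

/-! ## The flat case -/

/-- A bound for the direction found in the flat case. -/
def flatRadiusE (n b r k M : ℕ) : Expr :=
  .add (.mul (.const (M * 2 ^ k * n)) (radiusE n b r)) (.mul (.const r) (heightE n b r))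

/-- Searches for a direction in which the simplex of the level is flat, and sweeps the hyperplanes
orthogonal to it. -/
def flat (n b e r k : ℕ) (ch : Prog) (M : ℕ) : Prog :=
  .seq (search (b + 3) (b + 2) (flatRadiusE n b r k M)
      ((List.range k).flatMap fun j =>
        [(subE (vE n b j) (oE n b), .const M), (negE (subE (vE n b j) (oE n b)), .const M)])
      ((List.range k).map fun j => (negE (subE (vE n b j) (oE n b)), .const (-1))))
    (sweep b e r ch (2 ^ k * M) (cells n (b + 2) 1))

/-- Without deep points, flatness guarantees that the search succeeds. Any vector it returns will
do: the bounds on the edges give |g ⬝ᵥ (z - o)| ≤ 2^k M for all relevant z, and a positive value on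
some edge makes the hyperplanes proper in the space. -/
lemma exists_runs_flat (n b e r k : ℕ) (ch : Prog) (he : 4 ≤ e) (heb : e < b) (hk : r + k = n)
    (hmods : ∀ y, ch.Mods y → y = 0 ∨ 4 ≤ y ∧ y < b) (hs2 : 2 ≤ scale k) : ∃ M c : ℕ,
    ∀ {m C₀ d₀ : ℕ} {f : Fin (m + 1) → (Fin n → ℝ) → ℝ} {ε : ℝ} {B Δ : ℕ} {O : Oracles n m}
    {s s₁ S U : ℕ} {E : ℤ → ℤ},
    Ctx c C₀ d₀ f ε B Δ O s s₁ S U ch e r E → ∀ (σ : State) (PS : List (Row n)),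
    Inv f B S b r E PS σ → StageAt b PS (radius n r E B) k σ →
    (∀ a, (∀ j < r, (hrow n E j).1 ⬝ᵥ a = (hrow n E j).2) →
      ¬ Deep k (readIntVec n (σ (b + 10)) 0) (fun j => readIntVec n (σ (b + 11 + 2 * j)) 0)
          (fun j => readIntVec n (σ (b + 12 + 2 * j)) 0) a) →
    Runs O (flat n b e r k ch M) σ (fun τ => τ (b + 9) 0 = 0 ∧ Post f ε (eqs n E r) τ)
      (c * U) := by
  obtain ⟨M, hM⟩ := exists_flatness_bound k (scale k) hs2
  set rows : List (RowE n) := (List.range k).flatMap fun j =>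
    [(subE (vE n b j) (oE n b), .const M), (negE (subE (vE n b j) (oE n b)), .const M)] with hrows
  set cands : List (RowE n) :=
    (List.range k).map fun j => (negE (subE (vE n b j) (oE n b)), .const (-1)) with hcands
  obtain ⟨c₁, h₁⟩ := exists_runs_search (flatRadiusE n b r k M) rows cands
  obtain ⟨c₂, h₂⟩ := exists_runs_sweep b e r ch (2 ^ k * M) (cells n (b + 2) 1) heb he hmods
  refine ⟨M, 1 + c₁ + c₂ + (flatRadiusE n b r k M).weight,
    fun {m C₀ d₀ f ε B Δ O s s₁ S U E} hctx σ PS hI hS hno => ?_⟩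
  have hpre : LevelPre n r (σ b) B Δ s := by rw [hI.row]; exact hctx.pre
  have hss := hctx.sizes.s_le
  have hs₁ := hctx.sizes.s₁_le
  have hU := hctx.sizes.S_le
  have hA : ∀ x, b + 10 ≤ x → x ∈ ({b + 3, b + 2}ᶜ : Set ℕ) := by intro x hx; simp; omega
  have F := hS.frame hk hctx.pre.indep (fun x hx => hI.dot_eq hx)
  set o := readIntVec n (σ (b + 10)) 0 with ho
  set v : ℕ → Fin n → ℤ := fun j => readIntVec n (σ (b + 11 + 2 * j)) 0 with hv
  set ℓ : ℕ → Fin n → ℤ := fun j => readIntVec n (σ (b + 12 + 2 * j)) 0 with hℓ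
  have hokw : ∀ j < k, ∀ t, (subE (vE n b j) (oE n b) t).Ok σ s {b + 3, b + 2}ᶜ := fun j hj =>
    ok_subE (fun t => hctx.ok_vE hI hS (fun x hx => hA x (by omega)) hj t)
      (fun t => hctx.ok_oE hI hS (hA _ le_rfl) t)
  have hokR : (flatRadiusE n b r k M).Ok σ s {b + 3, b + 2}ᶜ :=
    ⟨⟨trivial, ok_radiusE hpre hI.three (by simp) (by simp; omega)⟩, trivial,
      ok_heightE hpre hI.three (by simp) (by simp; omega)⟩
  have hvalR : (flatRadiusE n b r k M).val σ =
      M * 2 ^ k * (n * radius n r E B) + r * height n r E B := by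
    simp only [flatRadiusE, Expr.val, val_radiusE hI.three, val_heightE hI.three, hI.row]
    ring
  refine Runs.seq (h₁ hctx.set.valid (b + 3) (b + 2) σ s {b + 3, b + 2}ᶜ (by simp) (by simp) hokR
    ?_ ?_) (c := c₂ * U) ?_ (by nlinarith)
  · intro q hq
    simp only [hrows, List.mem_flatMap, List.mem_range, List.mem_cons, List.not_mem_nil,
      or_false] at hq
    obtain ⟨j, hj, rfl | rfl⟩ := hq
    · exact ⟨hokw j hj, trivial⟩
    · exact ⟨ok_negE (hokw j hj), trivial⟩
  · intro q hq
    obtain ⟨j, hj, rfl⟩ := List.mem_map.1 hq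
    exact ⟨ok_negE (hokw j (List.mem_range.1 hj)), trivial⟩
  rintro τ ⟨hfr, hans⟩
  have keyr : ∀ g : Fin n → ℤ, (∀ q ∈ rows, (q.val σ).1 ⬝ᵥ g ≤ (q.val σ).2) ↔
      ∀ j < k, |g ⬝ᵥ (v j - o)| ≤ M := by
    intro g
    simp only [hrows, List.mem_flatMap, List.mem_range, List.mem_cons, List.not_mem_nil, or_false]
    constructor
    · intro h j hj
      have h1 := h _ ⟨j, hj, Or.inl rfl⟩
      have h2 := h _ ⟨j, hj, Or.inr rfl⟩
      simp only [RowE.val, val_negE, val_subE, val_cells_fun, Expr.val, Nat.cast_zero,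
        neg_dotProduct] at h1 h2
      rw [dotProduct_comm, abs_le]
      constructor <;> linarith
    · rintro h q ⟨j, hj, hq⟩
      have h1 := abs_le.1 (h j hj)
      rw [dotProduct_comm] at h1
      rcases hq with rfl | rfl <;>
      · simp only [RowE.val, val_negE, val_subE, val_cells_fun, Expr.val, Nat.cast_zero,
          neg_dotProduct]
        linarith
  have keyc : ∀ g : Fin n → ℤ, (∃ q ∈ cands, (q.val σ).1 ⬝ᵥ g ≤ (q.val σ).2) ↔
      ∃ j < k, 1 ≤ g ⬝ᵥ (v j - o) := by
    intro g
    simp only [hcands, List.mem_map, List.mem_range, exists_exists_and_eq_and]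
    refine exists_congr fun j => and_congr_right fun hj => ?_
    simp only [RowE.val, val_negE, val_subE, val_cells_fun, Expr.val, Nat.cast_zero,
        neg_dotProduct]
    rw [dotProduct_comm g]
    constructor <;> intro h <;> linarith
  have hans' : (∀ t, |readIntVec n (τ (b + 2)) 1 t| ≤ (flatRadiusE n b r k M).val σ) ∧
      (∀ j < k, |readIntVec n (τ (b + 2)) 1 ⬝ᵥ (v j - o)| ≤ M) ∧
      ∃ j < k, 1 ≤ readIntVec n (τ (b + 2)) 1 ⬝ᵥ (v j - o) := by
    rcases hans with ⟨_, h1, h2, h3⟩ | ⟨_, hnone⟩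
    · exact ⟨h1, (keyr _).1 h2, (keyc _).1 h3⟩
    -- The flatness theorem concerns lattice vectors z; the corresponding points of the affine space
    -- are z + o.
    · exfalso
      obtain ⟨g, hg1, ⟨j, hj⟩, hg3⟩ := hM F (fun z hz hd => hno (z + o) (fun j hj => by
          rw [dotProduct_add, hz ⟨j, hj⟩, hI.dot_eq hS.base j hj, zero_add]) (fun i hi => by
          rw [add_sub_cancel_right]; exact hd ⟨i, hi⟩)) (radius n r E B) (height n r E B)
        (fun j t => hS.size j j.2 t) (fun l t => abs_le_height l.2 t)
      exact hnone g ⟨fun t => by rw [hvalR]; exact hg3 t, (keyr g).2 fun j hj => hg1 ⟨j, hj⟩,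
        (keyc g).2 ⟨j, j.2, hj⟩⟩
  set g := readIntVec n (τ (b + 2)) 1 with hg
  obtain ⟨hgR, hgM, j₀, hj₀, hgj⟩ := hans'
  have hgb : ∀ t, bits (g t) ≤ s₁ := fun t => by
    refine (bits_le_of_abs_le (hgR t)).trans (hokR.bits_val_le.trans (le_trans ?_ hctx.sizes.le₁))
    exact Nat.mul_le_mul_right _ (by omega)
  have hτb : τ b = E := by rw [hfr _ (by omega) (by omega), hI.row]
  have hτo : readIntVec n (τ (b + 10)) 0 = o := by rw [hfr _ (by omega) (by omega)]
  have hgv : (fun t => (cells n (b + 2) 1 t).val τ) = g := by rw [val_cells_fun, Nat.cast_one]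
  refine (h₂ (hctx.sizes.mono (by omega)) hctx.child τ (by rw [hτb]; exact hctx.pre)
    (by rw [hfr 3 (by omega) (by omega)]; exact hI.three) o
    (ok_cells (by simp) (by rw [Nat.cast_one]; exact hgb)) hτo
    (fun t => by rw [val_cells, Nat.cast_one]; exact hgb t)
    (fun t => (hctx.bits_le hI hS.base t).trans hss) ⟨v j₀ - o, fun j hj => ?_, ?_⟩ ?_).mono ?_ le_rfl
  · rw [hτb]
    exact hI.dot_sub (hS.mem j₀ hj₀) hS.base j hj
  · rw [hgv]; omega
  · intro z hzA hzK
    rw [hgv]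
    rw [hτb] at hzA
    have hzX := hI.all z hzA hzK
    have := F.abs_dotProduct_le (z := z - o) (g := g)
      (fun l => hI.dot_sub hzX hS.base l l.2) (fun i => hS.le i i.2 z hzX) (M := M)
      (fun j => hgM j j.2)
    push_cast; exact this
  · rw [hτb]; exact fun _ h => h


/-! ## The cut through a central lattice point -/

/-- The result of one round of the main loop of a level: either the problem is solved, or a row has
been added to the polytope and the number of its integer points has decreased by a constant
factor. -/
def Round {n m : ℕ} (f : Fin (m + 1) → (Fin n → ℝ) → ℝ) (ε : ℝ) (B S b r k : ℕ) (E : ℤ → ℤ)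
    (PS : List (Row n)) (τ : State) : Prop :=
  (τ (b + 9) 0 = 0 ∧ Post f ε (eqs n E r) τ) ∨
  (τ (b + 9) 0 = 1 ∧ (intPoints PS).Nonempty ∧ ∃ q, Inv f B S b r E (PS ++ [q]) τ ∧
    2 * (2 * scale k + 1) ^ k * (intPoints (PS ++ [q])).ncard + (intPoints PS).ncard ≤
      2 * (2 * scale k + 1) ^ k * (intPoints PS).ncard)

/-- Stops the main loop with a negative answer. -/
def stopNone (b : ℕ) : Prog :=
  .seq (.assign (b + 9) (.const 0) (.const 0)) (.assign 0 (.const 0) (.const 0))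

lemma runs_stopNone {n m : ℕ} (O : Oracles n m) (b : ℕ) (σ : State) :
    Runs O (stopNone b) σ (fun τ => τ (b + 9) 0 = 0 ∧ τ 0 0 = 0) 7 := by
  refine Runs.seq (Runs.assign (s := 0) (A := Set.univ) (b := 3) (Q := fun τ => τ (b + 9) 0 = 0)
    trivial trivial ?_ (by simp [Expr.weight])) (c := 3) (fun τ hτ => ?_) le_rfl
  · simp [Expr.val]
  · refine Runs.assign (s := 0) (A := Set.univ) trivial trivial ⟨?_, ?_⟩ (by simp [Expr.weight])
    · rw [Function.update_of_ne (by omega), hτ]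
    · simp [Expr.val]

/-- Stops the main loop with a positive answer. -/
def stopSome {n : ℕ} (b : ℕ) (z : Fin n → Expr) : Prog :=
  .seq (.assign (b + 9) (.const 0) (.const 0))
    (fill 0 (.const 0) 0 (.const 1 :: List.ofFn z))

lemma exists_runs_stopSome {n : ℕ} (b : ℕ) (z : Fin n → Expr) : ∃ c : ℕ, ∀ {m : ℕ}
    (O : Oracles n m) (σ : State) (s : ℕ), (∀ t, (z t).Ok σ s {0, b + 9}ᶜ) →
    Runs O (stopSome b z) σ (fun τ => τ (b + 9) 0 = 0 ∧ τ 0 0 = 1 ∧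
      readIntVec n (τ 0) 1 = fun t => (z t).val σ) (c * (s + 1)) := by
  obtain ⟨c, hc⟩ := exists_runs_fill (.const 0) (.const 1 :: List.ofFn z) 0
  refine ⟨4 + c, fun O σ s hz => ?_⟩
  refine Runs.seq (Runs.assign (s := 0) (A := Set.univ) (b := 3) (Q := fun τ => τ = _)
    trivial trivial rfl (by simp [Expr.weight])) (c := c * (s + 1)) ?_ (by nlinarith)
  rintro τ rfl
  set ρ : State := Function.update σ (b + 9) (Function.update (σ (b + 9)) ((Expr.const 0).val σ)
    ((Expr.const 0).val σ)) with hρ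
  have hA : ∀ x ∈ ({0, b + 9}ᶜ : Set ℕ), ρ x = σ x := by
    intro x hx
    simp only [Set.mem_compl_iff, Set.mem_insert_iff, Set.mem_singleton_iff, not_or] at hx
    exact Function.update_of_ne hx.2 _ _
  refine (hc O 0 ρ s {0, b + 9}ᶜ (by simp) trivial fun e he => ?_).mono ?_ le_rfl
  · rcases List.mem_cons.1 he with rfl | he
    · trivial
    · obtain ⟨j, rfl⟩ := (List.mem_ofFn' _ _).1 he
      exact (hz j).transfer hA
  · rintro τ rfl
    have h := holds_writeAt (ρ 0) 0 ((Expr.const 1 :: List.ofFn z).map (Expr.val ρ))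
    rw [List.map_cons, holds_cons, List.map_ofFn, holds_ofFn] at h
    refine ⟨?_, ?_, ?_⟩
    · rw [Function.update_of_ne (by omega), hρ, Function.update_self]
      simp [Expr.val]
    · rw [Function.update_self]
      have h1 := h.1
      simp only [Expr.val, Nat.cast_zero, add_zero, List.map_cons, List.map_ofFn] at h1 ⊢
      exact h1
    · rw [Function.update_self]
      have h2 := h.2
      simp only [Expr.val, Nat.cast_zero, add_zero, zero_add, List.map_cons, List.map_ofFn] at h2 ⊢
      rw [h2]
      funext t
      exact (hz t).val_eq hA

/-- The query for separating the point `a` from the set within the affine space of the level. -/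
def sepQuery (n b r : ℕ) (a : Fin n → Expr) : Prog :=
  .seq (fill (b + 3) (.const 0) 0
    (.const r :: ((List.ofFn a).flatMap (fun q => [q, .const 1]) ++ flatRows (eqE n b r))))
    (.call .sep (b + 3) (b + 5))

lemma eq_or_eq_of_mods_sepQuery {n b r y : ℕ} {a : Fin n → Expr} (h : (sepQuery n b r a).Mods y) :
    y = b + 3 ∨ y = b + 5 := by
  rcases h with h | h
  · exact Or.inl (eq_of_mods_fill h)
  · exact Or.inr h

/-- The integer point is entered as fractions with denominator 1. The digits of the answer are
bounded by the assumption `Oracles.SepPolySize`, through the field `sep` of `Sizes`. -/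
lemma exists_runs_sepQuery (n b r : ℕ) (a : Fin n → Expr) : ∃ c : ℕ,
    ∀ {m C₀ d₀ : ℕ} {f : Fin (m + 1) → (Fin n → ℝ) → ℝ} {ε : ℝ} {B Δ : ℕ} {O : Oracles n m}
    {s s₁ S U : ℕ}, Setting C₀ d₀ f ε B Δ O → Sizes c C₀ d₀ s s₁ S U →
    ∀ (σ : State), LevelPre n r (σ b) B Δ s → (∀ t, (a t).Ok σ s {b + 3, b + 5}ᶜ) →
    ∀ z : Fin n → ℤ, (fun t => (a t).val σ) = z → intPoint z ∈ affineSpace (eqs n (σ b) r) →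
    Runs O (sepQuery n b r a) σ (fun τ => (∀ y, y ≠ b + 3 → y ≠ b + 5 → τ y = σ y) ∧
      ((τ (b + 5) 0 = 0 ∧ intPoint z ∈ levelSet f ε) ∨
      (τ (b + 5) 0 = 1 ∧ ∃ w : Fin n → ℚ,
        O.sep (eqs n (σ b) r) (fun j => (z j : ℚ)) = some w ∧
        ∀ j : Fin n, τ (b + 5) (1 + 2 * (j : ℕ)) = (w j).num ∧
          τ (b + 5) (1 + 2 * (j : ℕ) + 1) = (w j).den ∧
          bits (w j).num ≤ s₁ ∧ bits (w j).den ≤ s₁))) (c * U) := by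
  set L : List Expr := .const r :: ((List.ofFn a).flatMap (fun q => [q, .const 1]) ++
    flatRows (eqE n b r)) with hL
  obtain ⟨c, hc⟩ := exists_runs_fill (.const 0) L 0
  set W := (L.map fun e => 1 + e.weight).sum with hW
  refine ⟨6 + c + W, fun {m C₀ d₀ f ε B Δ O s s₁ S U} hset hs σ hpre ha z hz hzA => ?_⟩
  have hss := hs.s_le
  have hs₁ := hs.s₁_le
  have hU := hs.S_le
  have hok : ∀ e ∈ L, e.Ok σ s {b + 3, b + 5}ᶜ := by
    intro e he
    rcases List.mem_cons.1 he with rfl | he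
    · trivial
    rcases List.mem_append.1 he with he | he
    · obtain ⟨q, hq, he⟩ := List.mem_flatMap.1 he
      obtain ⟨j, rfl⟩ := (List.mem_ofFn' _ _).1 hq
      simp only [List.mem_cons, List.not_mem_nil, or_false] at he
      rcases he with rfl | rfl
      · exact ha j
      · trivial
    · exact ok_flatRows (ok_eqE hpre (by simp)) e he
  refine (Runs.seq (hc O (b + 3) σ s {b + 3, b + 5}ᶜ (by simp) trivial hok) (c := (5 + W) * U) ?_
    (by nlinarith)).frame.mono
    (fun τ h => ⟨fun y h1 h2 => h.2 y (fun h3 => ?_), h.1⟩) le_rfl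
  swap
  · rcases eq_or_eq_of_mods_sepQuery h3 with h3 | h3
    · exact h1 h3
    · exact h2 h3
  rintro τ rfl
  set A := eqs n (σ b) r with hA
  set zq : Fin n → ℚ := fun j => (z j : ℚ) with hzq
  have hLval : L.map (Expr.val σ) = (r : ℤ) :: (encodeRat zq ++ flatRows A) := by
    rw [hL, List.map_cons, List.map_append, map_flatRows, map_val_eqE, List.map_flatMap, hzq,
      encodeRat_intCast, ← hz, ← hA]
    congr 2
    rw [show (List.ofFn fun t => (a t).val σ) = (List.ofFn a).map (Expr.val σ) by
      rw [List.map_ofFn]; rfl, List.flatMap_map]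
    rfl
  rw [hLval]
  set ρ : State := Function.update σ (b + 3) (writeAt (σ (b + 3))
    ((Expr.const 0).val σ + ((0 : ℕ) : ℤ)) ((r : ℤ) :: (encodeRat zq ++ flatRows A))) with hρ
  have hholds : Holds (ρ (b + 3)) 0 ((r : ℤ) :: (encodeRat zq ++ flatRows A)) := by
    simp only [hρ, Function.update_self, Expr.val, Nat.cast_zero, add_zero]
    exact holds_writeAt _ _ _
  have hh := hholds
  rw [holds_cons, holds_append, length_encodeRat, zero_add] at hh
  obtain ⟨h0, h1, h2⟩ := hh
  have hlist : listSize ((r : ℤ) :: (encodeRat zq ++ flatRows A)) ≤ W * (s + 1) := by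
    rw [← hLval]; exact listSize_map_val_le hok
  have hqs : querySize n (ρ (b + 3)) .sep ≤ W * (s + 1) := by
    rw [querySize_of_holds hholds]
    · exact hlist
    · rw [queryLength, h0, Int.toNat_natCast]
      simp [length_encodeRat, length_flatRows, hA]; ring
  have hreply : O.reply (ρ (b + 3)) .sep = encodeOption encodeRat (O.sep A zq) := by
    simp only [Oracles.reply, h0, Int.toNat_natCast]
    rw [h1.readRatVec]
    have : readSystem n (ρ (b + 3)) (1 + 2 * (n : ℤ)) r = A := by
      have h3 := holds_flatRows.1 h2
      rw [hA, length_eqs] at h3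
      rw [← hA] at h3
      rw [← h3]; push_cast; rfl
    rw [this]
  have hzA' : ratPoint zq ∈ affineSpace A := by rw [hzq, ratPoint_intCast]; exact hzA
  have hsize : ∀ w, O.sep A zq = some w → listSize (encodeRat w) ≤ s₁ := by
    intro w hw
    refine (hset.size A zq w hzA' hw).trans (le_trans ?_ hs.sep)
    have h3 : systemSize A + listSize (encodeRat zq) ≤ W * (s + 1) := by
      rw [systemSize_eq]
      refine le_trans ?_ hlist
      rw [← List.singleton_append, listSize_append, listSize_append]
      omega
    have h4 := (log_le_bits B).trans hpre.bits_B
    have h5 := hpre.log_Δ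
    gcongr
    nlinarith
  have hrs : listSize (O.reply (ρ (b + 3)) .sep) ≤ 2 + s₁ := by
    rw [hreply]
    cases hw : O.sep A zq with
    | none => simp [encodeOption, listSize]; omega
    | some w =>
      have := hsize w hw
      simp only [encodeOption, listSize, List.map_cons, List.sum_cons, bits_one] at *
      omega
  refine (runs_call O .sep (b + 3) (b + 5) ρ hqs hrs).mono ?_ (by nlinarith)
  rintro τ rfl
  rw [Function.update_self, hreply]
  have hw := holds_writeList (ρ (b + 5)) (encodeOption encodeRat (O.sep A zq))
  cases hsep : O.sep A zq with
  | none =>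
    rw [hsep] at hw
    simp only [encodeOption, holds_singleton] at hw
    refine Or.inl ⟨hw, ?_⟩
    have := hset.valid.sep_none A zq hzA' hsep
    rwa [hzq, ratPoint_intCast] at this
  | some w =>
    rw [hsep] at hw
    simp only [encodeOption, holds_cons, zero_add] at hw
    refine Or.inr ⟨hw.1, w, rfl, fun j => ⟨(hw.2.encodeRat j).1, (hw.2.encodeRat j).2, ?_, ?_⟩⟩
    · exact (bits_le_listSize (mem_encodeRat w j).1).trans (hsize w hsep)
    · exact (bits_le_listSize (mem_encodeRat w j).2).trans (hsize w hsep)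


/-- The product of the denominators of the vector stored in array `b + 5`. -/
def denE (n b : ℕ) : Expr := prodE (List.ofFn fun j : Fin n => .get (b + 5) (.const (2 + 2 * (j : ℕ))))

/-- The integral multiple of the vector stored in array `b + 5`. -/
def normalE (n b : ℕ) : Fin n → Expr := fun j =>
  .div (.mul (.get (b + 5) (.const (1 + 2 * (j : ℕ)))) (denE n b))
    (.get (b + 5) (.const (2 + 2 * (j : ℕ))))

/-- Rows must be integral, so the separating vector is multiplied by the product D of its
denominators. As D is positive, the direction of the inequality is preserved. -/
lemma exists_val_normalE {n b : ℕ} {σ : State} {w : Fin n → ℚ}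
    (h : ∀ j : Fin n, σ (b + 5) (1 + 2 * (j : ℕ)) = (w j).num ∧
      σ (b + 5) (1 + 2 * (j : ℕ) + 1) = (w j).den) :
    ∃ D : ℝ, 0 < D ∧ ∀ x : Fin n → ℝ,
      intPoint (fun j => (normalE n b j).val σ) ⬝ᵥ x = D * ∑ j, (w j : ℝ) * x j := by
  have h2 : ∀ j : Fin n, σ (b + 5) (2 + 2 * (j : ℕ)) = (w j).den := fun j => by
    rw [← (h j).2]; congr 1; ring
  refine ⟨∏ j, ((w j).den : ℝ), Finset.prod_pos fun j _ => by exact_mod_cast (w j).den_pos,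
    fun x => ?_⟩
  rw [dotProduct, Finset.mul_sum]
  refine Finset.sum_congr rfl fun j _ => ?_
  rw [← mul_assoc]
  congr 1
  have hD : (denE n b).val σ = ∏ j, ((w j).den : ℤ) := by
    rw [denE, val_prodE, List.map_ofFn, List.prod_ofFn]
    exact Finset.prod_congr rfl fun j _ => h2 j
  have hdvd : ((w j).den : ℤ) ∣ ∏ j, ((w j).den : ℤ) := Finset.dvd_prod_of_mem _ (Finset.mem_univ j)
  have hden : ((w j).den : ℝ) ≠ 0 := by exact_mod_cast (w j).den_nz
  simp only [intPoint, normalE, Expr.val, hD, h2, (h j).1]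
  rw [Int.cast_div (hdvd.mul_left _) (by exact_mod_cast hden)]
  push_cast
  rw [Rat.cast_def]
  field_simp

lemma ok_normalE {n b s : ℕ} {σ : State} {A : Set ℕ} (hA : b + 5 ∈ A)
    (h : ∀ j : Fin n, bits (σ (b + 5) (1 + 2 * (j : ℕ))) ≤ s ∧
      bits (σ (b + 5) (1 + 2 * (j : ℕ) + 1)) ≤ s) (j : Fin n) : (normalE n b j).Ok σ s A := by
  have h2 : ∀ j : Fin n, bits (σ (b + 5) (2 + 2 * (j : ℕ))) ≤ s := fun j => by
    have := (h j).2
    rwa [show (1 : ℤ) + 2 * (j : ℕ) + 1 = 2 + 2 * (j : ℕ) by ring] at this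
  refine ⟨⟨⟨hA, (h j).1, trivial⟩, ok_prodE fun e he => ?_⟩, hA, h2 j, trivial⟩
  obtain ⟨i, rfl⟩ := (List.mem_ofFn' _ _).1 he
  exact ⟨hA, h2 i, trivial⟩

/-- The sum of the squares of the inner products of a vector with the edges of the simplex of the
level. -/
def edgeTest (n b k : ℕ) : Expr :=
  sumE (List.ofFn fun i : Fin k => .mul (dotE (normalE n b) (subE (vE n b i) (oE n b)))
    (dotE (normalE n b) (subE (vE n b i) (oE n b))))

/-- Separates the central lattice point stored in array `b + 2`, solves the problem on the
separating hyperplane, and cuts off the part of the polytope beyond it. -/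
def cut (n b e r k : ℕ) (ch : Prog) : Prog :=
  .seq (sepQuery n b r (cells n (b + 2) 1))
    (.cond (.get (b + 5) (.const 0))
      (.cond (edgeTest n b k)
        (.seq (callChild b e r ch (normalE n b) (dotE (normalE n b) (cells n (b + 2) 1)))
          (.cond (.get 0 (.const 0)) (.assign (b + 9) (.const 0) (.const 0))
            (appendRow b (normalE n b)
              (.sub (dotE (normalE n b) (cells n (b + 2) 1)) (.const 1)))))
        (stopNone b))
      (stopSome b (cells n (b + 2) 1)))

/-- If the normal h vanishes on all edges, it is constant on the space, and the oracle's guarantee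
of a proper hyperplane leaves only the possibility that K_{ε/2} misses the space. Otherwise the
hyperplane through a is settled by the child. If the child reports no point of K_0 on it,
integrality turns h ⬝ᵥ z < h ⬝ᵥ a into the cut h ⬝ᵥ z ≤ h ⬝ᵥ a - 1, which also removes a. -/
lemma exists_runs_cut (n b e r k : ℕ) (ch : Prog) (he : 4 ≤ e) (heb : e < b) (hk : r + k = n)
    (hk1 : 1 ≤ k) (hmods : ∀ y, ch.Mods y → y = 0 ∨ 4 ≤ y ∧ y < b) : ∃ c : ℕ,
    ∀ {m C₀ d₀ : ℕ} {f : Fin (m + 1) → (Fin n → ℝ) → ℝ} {ε : ℝ} {B Δ : ℕ} {O : Oracles n m}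
    {s s₁ S U : ℕ} {E : ℤ → ℤ},
    Ctx c C₀ d₀ f ε B Δ O s s₁ S U ch e r E → ∀ (σ : State) (PS : List (Row n)),
    Inv f B S b r E PS σ → PS.length ≤ S → σ (b + 9) 0 = 1 →
    StageAt b PS (radius n r E B) k σ →
    (∀ j < r, (hrow n E j).1 ⬝ᵥ readIntVec n (σ (b + 2)) 1 = (hrow n E j).2) →
    Deep k (readIntVec n (σ (b + 10)) 0) (fun j => readIntVec n (σ (b + 11 + 2 * j)) 0)
      (fun j => readIntVec n (σ (b + 12 + 2 * j)) 0) (readIntVec n (σ (b + 2)) 1) →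
    Runs O (cut n b e r k ch) σ (Round f ε B S b r k E PS) (c * U) := by
  set aE : Fin n → Expr := cells n (b + 2) 1 with haE
  set hv : Fin n → Expr := normalE n b with hhv
  obtain ⟨c₁, h₁⟩ := exists_runs_sepQuery n b r aE
  obtain ⟨c₂, h₂⟩ := exists_runs_callChild b e r ch hv (dotE hv aE) heb he hmods
  obtain ⟨c₃, h₃⟩ := exists_runs_appendRow b hv (.sub (dotE hv aE) (.const 1))
  obtain ⟨c₄, h₄⟩ := exists_runs_stopSome b aE
  refine ⟨50 + c₁ + c₂ + c₃ + c₄ + (edgeTest n b k).weight,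
    fun {m C₀ d₀ f ε B Δ O s s₁ S U E} hctx σ PS hI hlen hloc hS ha hdeep => ?_⟩
  have hpre : LevelPre n r (σ b) B Δ s := by rw [hI.row]; exact hctx.pre
  have hss := hctx.sizes.s_le
  have hs₁ := hctx.sizes.s₁_le
  have hU := hctx.sizes.S_le
  have F := hS.frame hk hctx.pre.indep (fun x hx => hI.dot_eq hx)
  have haX := hS.mem_of_deep hk hctx.pre.indep (fun x hx => hI.dot_eq hx) ha hdeep
  set a := readIntVec n (σ (b + 2)) 1 with haa
  set o := readIntVec n (σ (b + 10)) 0 with ho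
  set v : ℕ → Fin n → ℤ := fun j => readIntVec n (σ (b + 11 + 2 * j)) 0 with hv'
  have haA : intPoint a ∈ affineSpace (eqs n E r) := hI.sub a haX
  have hab := hctx.bits_le hI haX
  refine Runs.seq (h₁ hctx.set (hctx.sizes.mono (by omega)) σ hpre
    (ok_cells (by simp) (by rw [Nat.cast_one]; exact hab)) a
    (by rw [haE, val_cells_fun, Nat.cast_one]) (by rw [hI.row]; exact haA))
    (c := (40 + c₂ + c₃ + c₄ + (edgeTest n b k).weight) * U) ?_ (by nlinarith)
  rintro τ ⟨hfr, hans⟩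
  have hIτ : Inv f B S b r E PS τ := hI.frame (hfr _ (by omega) (by omega))
    (hfr _ (by omega) (by omega)) (by rw [hfr _ (by omega) (by omega)]; exact hI.poly)
  have hpreτ : LevelPre n r (τ b) B Δ s := by rw [hIτ.row]; exact hctx.pre
  have ha2 : τ (b + 2) = σ (b + 2) := hfr _ (by omega) (by omega)
  have hloc' : τ (b + 9) = σ (b + 9) := hfr _ (by omega) (by omega)
  have oka : ∀ {A : Set ℕ}, b + 2 ∈ A → ∀ t, (aE t).Ok τ s A := fun hA =>
    ok_cells hA (by rw [Nat.cast_one, ha2]; exact hab)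
  have hav : (fun t => (aE t).val τ) = a := by rw [haE, val_cells_fun, Nat.cast_one, ha2]
  have hget : (Expr.get (b + 5) (.const 0)).Ok τ s₁ Set.univ := by
    refine ⟨trivial, ?_, trivial⟩
    have := hctx.sizes.le₁
    rcases hans with ⟨h, _⟩ | ⟨h, _⟩ <;> simp [Expr.val, h]
    nlinarith
  refine Runs.cond hget (c := (30 + c₂ + c₃ + c₄ + (edgeTest n b k).weight) * U) (fun hpos => ?_)
    (fun hneg => ?_) (by simp [Expr.weight]; nlinarith)
  swap
  · have haK : intPoint a ∈ levelSet f ε := by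
      rcases hans with ⟨_, h⟩ | ⟨h, _⟩
      · exact h
      · simp [Expr.val, h] at hneg
    refine (h₄ O τ s (oka (by simp))).mono ?_ (Nat.mul_le_mul (by omega) (by omega))
    rintro υ ⟨h1, h2, h3⟩
    exact Or.inl ⟨h1, Or.inl ⟨h2, by rw [h3, hav]; exact haK⟩⟩
  obtain ⟨w, hw, hwτ⟩ := (hans.resolve_left fun h => by simp [Expr.val, h.1] at hpos).2
  rw [hI.row] at hw
  obtain ⟨D, hD, hDx⟩ := exists_val_normalE (fun j => ⟨(hwτ j).1, (hwτ j).2.1⟩)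
  have okh : ∀ {A : Set ℕ}, b + 5 ∈ A → ∀ t, (hv t).Ok τ s₁ A := fun hA => ok_normalE hA fun j => by
    rw [(hwτ j).1, (hwτ j).2.1]; exact (hwτ j).2.2
  set h := fun t => (hv t).val τ with hh
  have hA10 : ∀ x, b + 10 ≤ x → τ x = σ x := fun x hx => hfr x (by omega) (by omega)
  have hSτ : StageAt b PS (radius n r E B) k τ := by
    have h0 : readIntVec n (τ (b + 10)) 0 = o := by rw [hA10 _ le_rfl]
    rw [StageAt, h0]
    exact hS.congr (fun j _ => by rw [hA10 _ (by omega)]) (fun j _ => by rw [hA10 _ (by omega)])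
  have hokw : ∀ i < k, ∀ t, (subE (vE n b i) (oE n b) t).Ok τ s₁ Set.univ := fun i hi t =>
    (ok_subE (fun t => hctx.ok_vE hIτ hSτ (fun x _ => Set.mem_univ x) hi t)
      (fun t => hctx.ok_oE hIτ hSτ (Set.mem_univ _) t) t).mono hss le_rfl
  -- A sum of squares tests all edges at once.
  have htest : (edgeTest n b k).val τ = ∑ i : Fin k, (h ⬝ᵥ (v i - o)) ^ 2 := by
    rw [edgeTest, val_sumE, List.map_ofFn, List.sum_ofFn]
    refine Finset.sum_congr rfl fun i _ => ?_
    simp only [Function.comp, Expr.val, val_dotE, val_subE, val_cells_fun, Nat.cast_zero]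
    rw [hA10 _ le_rfl, hA10 _ (by omega), sq]
  have oktest : (edgeTest n b k).Ok τ s₁ Set.univ := ok_sumE fun e he => by
    obtain ⟨i, rfl⟩ := (List.mem_ofFn' _ _).1 he
    have := ok_dotE (okh (Set.mem_univ (b + 5))) (hokw i i.2)
    exact ⟨this, this⟩
  have haA' : ratPoint (fun j => (a j : ℚ)) ∈ affineSpace (eqs n E r) := by
    rw [ratPoint_intCast]; exact haA
  refine Runs.cond oktest (c := (20 + c₂ + c₃ + c₄) * U) (fun hpos => ?_)
    (fun hneg => ?_) (by nlinarith)
  swap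
  · have hzero : ∀ i : Fin k, h ⬝ᵥ (v i - o) = 0 := by
      rw [htest, not_lt] at hneg
      have h1 := (Finset.sum_eq_zero_iff_of_nonneg fun i _ => sq_nonneg _).1
        (le_antisymm hneg (Finset.sum_nonneg fun i _ => sq_nonneg _))
      exact fun i => pow_eq_zero_iff two_ne_zero |>.1 (h1 i (Finset.mem_univ i))
    have hempty : ¬ (levelSet f (ε / 2) ∩ affineSpace (eqs n E r)).Nonempty := by
      intro hne
      -- As k ≥ 1, translating a by the first edge gives a second point of the space.
      have hw0 : affineSpace (eqs n E r) ≠ {ratPoint fun j => (a j : ℚ)} := by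
        intro heq
        have h1 : intPoint (a + (v 0 - o)) ∈ affineSpace (eqs n E r) := by
          rw [mem_affineSpace_eqs]
          intro j hj
          rw [dotProduct_add, ha j hj, hI.dot_sub (hS.mem 0 hk1) hS.base j hj, add_zero]
        rw [heq, ratPoint_intCast, Set.mem_singleton_iff] at h1
        have h2 := intPoint_injective h1
        have h3 : 0 < readIntVec n (σ (b + 12 + 2 * 0)) 0 ⬝ᵥ (v 0 - o) := hS.pos 0 hk1
        rw [add_eq_left] at h2
        rw [h2, dotProduct_zero] at h3
        exact lt_irrefl _ h3
      obtain ⟨x, hxA, hx⟩ := hctx.set.valid.sep_proper _ _ w haA' hw hw0 hne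
      refine hx ?_
      rw [ratPoint_intCast]
      have hxa : ∀ l : Fin r, intPoint (hrow n E l).1 ⬝ᵥ (x - intPoint a) = 0 := by
        intro l
        rw [dotProduct_sub, intPoint_dotProduct, ha l l.2, sub_eq_zero]
        exact hxA _ (List.mem_map_of_mem (List.mem_range.2 l.2))
      -- The edges span the direction space, so a functional vanishing on them is constant on the
      -- affine space.
      obtain ⟨μ, hμ⟩ := F.exists_real_coordinates hxa
      have h1 : intPoint h ⬝ᵥ (x - intPoint a) = 0 := by
        rw [hμ, dotProduct_sum]
        refine Finset.sum_eq_zero fun i _ => ?_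
        rw [dotProduct_smul, intPoint_dotProduct]
        rw [show h ⬝ᵥ (readIntVec n (σ (b + 11 + 2 * (i : ℕ))) 0 - readIntVec n (σ (b + 10)) 0) = 0
          from hzero i]
        simp
      rw [dotProduct_sub, hDx, hDx, ← mul_sub, mul_eq_zero, or_iff_right hD.ne', sub_eq_zero] at h1
      exact h1
    refine (runs_stopNone O b τ).mono ?_ (by nlinarith)
    rintro υ ⟨h1, h2⟩
    refine Or.inl ⟨h1, Or.inr ⟨h2, fun z hzA hzK => hempty ⟨intPoint z, fun i => ?_, hzA⟩⟩⟩
    have := hzK i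
    have := hctx.set.pos
    linarith
  have hne : ∃ i : Fin k, h ⬝ᵥ (v i - o) ≠ 0 := by
    by_contra! hall
    rw [htest, Finset.sum_eq_zero fun i _ => by rw [hall i]; norm_num] at hpos
    exact lt_irrefl _ hpos
  obtain ⟨i₀, hi₀⟩ := hne
  have hval : (dotE hv aE).val τ = h ⬝ᵥ a := by rw [val_dotE, hav]
  refine Runs.seq (h₂ (hctx.sizes.mono (by omega)) hctx.child τ hpreτ hIτ.three
    (okh (by simp; omega))
    (ok_dotE (okh (by simp; omega)) fun t => (oka (by simp; omega) t).mono hss le_rfl)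
    ⟨v i₀ - o, fun j hj => ?_, hi₀⟩) (c := (15 + c₃) * U) ?_ (by nlinarith)
  · rw [hIτ.row]; exact hI.dot_sub (hS.mem i₀ i₀.2) hS.base j hj
  rintro υ ⟨hfr', hpost⟩
  rw [hval, hIτ.row] at hpost
  have hIυ : Inv f B S b r E PS υ := hIτ.frame (hfr' _ (Or.inl le_rfl)) (hfr' _ (Or.inr rfl))
    (by rw [hfr' _ (Or.inl (by omega))]; exact hIτ.poly)
  refine Runs.cond hpost.ok_get (c := (5 + c₃) * U) (fun hpos => ?_) (fun hneg => ?_)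
    (by simp [Expr.weight]; nlinarith)
  · refine Runs.assign (s := 0) (A := Set.univ) trivial trivial (Or.inl ⟨?_, Or.inl ?_⟩)
      (by simp [Expr.weight]; nlinarith)
    · simp [Expr.val]
    · rw [Function.update_of_ne (by omega)]
      rcases hpost with h1 | ⟨h1, _⟩
      · exact h1
      · simp [Expr.val, h1] at hpos
  · have hnone := (hpost.resolve_left fun h1 => by simp [Expr.val, h1.1] at hneg).2
    have hsame : ∀ x ∈ {x | b ≤ x}, υ x = τ x := fun x hx => hfr' x (Or.inl hx)
    have okhυ : ∀ t, (hv t).Ok υ s₁ {b + 1, b + 9}ᶜ := fun t =>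
      ((okh (A := {x | b ≤ x} ∩ {b + 1, b + 9}ᶜ) (by simp) t).transfer
        fun x hx => hsame x hx.1).mono le_rfl Set.inter_subset_right
    have okaυ : ∀ t, (aE t).Ok υ s₁ {b + 1, b + 9}ᶜ := fun t =>
      ((oka (A := {x | b ≤ x} ∩ {b + 1, b + 9}ᶜ) (by simp) t).transfer
        fun x hx => hsame x hx.1).mono hss Set.inter_subset_right
    have hhυ : (fun t => (hv t).val υ) = h := funext fun t =>
      (okh (A := {x | b ≤ x}) (by simp) t).val_eq hsame
    have haυ : (fun t => (aE t).val υ) = a := by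
      rw [← hav]
      exact funext fun t => (oka (A := {x | b ≤ x}) (by simp) t).val_eq hsame
    refine (h₃ (O := O) (hctx.sizes.mono (by omega)) υ PS hIυ.poly hlen okhυ
      ⟨ok_dotE okhυ okaυ, trivial⟩).mono ?_ (by nlinarith)
    rintro ω ⟨hfr'', hω9, hPω⟩
    have hβ : (Expr.sub (dotE hv aE) (.const 1)).val υ = h ⬝ᵥ a - 1 := by
      simp only [Expr.val, val_dotE, hhυ, haυ]
    rw [hhυ, hβ] at hPω
    refine Or.inr ⟨?_, ⟨a, haX⟩, (h, h ⬝ᵥ a - 1), ⟨?_, ?_, hPω, ?_, ?_, ?_⟩, ?_⟩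
    · rw [hω9, hfr' _ (Or.inl (by omega)), hloc', hloc]
    · rw [hfr'' _ (by omega) (by omega), hIυ.row]
    · rw [hfr'' _ (by omega) (by omega), hIυ.three]
    · exact fun q hq => List.mem_append_left _ (hI.box hq)
    · exact fun z hz => hI.sub z (mem_intPoints_append.1 hz).1
    · intro z hzA hzK
      refine mem_intPoints_append.2 ⟨hI.all z hzA hzK, ?_⟩
      have hle : h ⬝ᵥ z ≤ h ⬝ᵥ a := by
        have h1 := hctx.set.valid.sep_le _ _ w haA' hw (intPoint z) ⟨fun i => by
          have := hzK i
          have := hctx.set.pos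
          linarith, hzA⟩
        rw [ratPoint_intCast] at h1
        have h2 := mul_le_mul_of_nonneg_left h1 hD.le
        rw [← hDx, ← hDx, intPoint_dotProduct, intPoint_dotProduct] at h2
        exact_mod_cast h2
      have hne : h ⬝ᵥ z ≠ h ⬝ᵥ a := fun heq =>
        hnone z (intPoint_mem_affineSpace_append.2 ⟨hzA, heq⟩) hzK
      simp only
      omega
    · exact hS.ncard_le hI.box hk hctx.pre.indep (fun x hx => hI.dot_eq hx) ha hdeep h (by omega)


/-! ## One round of the main loop -/

/-- Chooses the last `d` of `k` pairs of a stage, and concludes the round. -/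
def steps (n b e r k : ℕ) (ch : Prog) (M : ℕ) : ℕ → Prog
  | 0 => .seq (findDeep n b r k) (.cond (.get (b + 2) (.const 0)) (cut n b e r k ch)
      (flat n b e r k ch M))
  | d + 1 => .seq (choosePair n b r (k - (d + 1)))
      (.cond (dotE (lE n b (k - (d + 1))) (subE (vE n b (k - (d + 1))) (oE n b)))
        (steps n b e r k ch M d) (sweep b e r ch 0 (lE n b (k - (d + 1)))))

/-- Induction on the number d of pairs still to be chosen. The flatness constant M is fixed before
d, as it is a parameter of the whole program. -/
lemma exists_runs_steps (n b e r k : ℕ) (ch : Prog) (he : 4 ≤ e) (heb : e < b) (hk : r + k = n)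
    (hk1 : 1 ≤ k) (hmods : ∀ y, ch.Mods y → y = 0 ∨ 4 ≤ y ∧ y < b) : ∃ M : ℕ, ∀ d ≤ k, ∃ c : ℕ,
    ∀ {m C₀ d₀ : ℕ} {f : Fin (m + 1) → (Fin n → ℝ) → ℝ} {ε : ℝ} {B Δ : ℕ} {O : Oracles n m}
    {s s₁ S U : ℕ} {E : ℤ → ℤ},
    Ctx c C₀ d₀ f ε B Δ O s s₁ S U ch e r E → ∀ (σ : State) (PS : List (Row n)),
    Inv f B S b r E PS σ → PS.length ≤ S → σ (b + 9) 0 = 1 →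
    StageAt b PS (radius n r E B) (k - d) σ →
    Runs O (steps n b e r k ch M d) σ (Round f ε B S b r k E PS) (c * U) := by
  have hs2 : 2 ≤ scale k := by
    have : 1 ≤ (k + 1) * 2 ^ k := Nat.mul_pos (by omega) (by positivity)
    rw [scale, mul_assoc]; omega
  obtain ⟨M, c₁, h₁⟩ := exists_runs_flat n b e r k ch he heb hk hmods hs2
  obtain ⟨c₂, h₂⟩ := exists_runs_cut n b e r k ch he heb hk hk1 hmods
  obtain ⟨c₃, h₃⟩ := exists_runs_findDeep n b r k (by omega) hk
  refine ⟨M, fun d => ?_⟩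
  induction d with
  | zero =>
    refine fun _ => ⟨10 + c₁ + c₂ + c₃,
      fun {m C₀ d₀ f ε B Δ O s s₁ S U E} hctx σ PS hI hlen hloc hS => ?_⟩
    have hU := hctx.sizes.S_le
    rw [Nat.sub_zero] at hS
    refine Runs.seq (h₃ (hctx.mono (by omega)) σ PS hI hS) (c := (9 + c₁ + c₂) * U) ?_
      (by nlinarith)
    rintro τ ⟨hfr, hans⟩
    have hIτ : Inv f B S b r E PS τ := hI.frame (hfr _ (by omega) (by omega))
      (hfr _ (by omega) (by omega)) (by rw [hfr _ (by omega) (by omega)]; exact hI.poly)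
    have h10 : τ (b + 10) = σ (b + 10) := hfr _ (by omega) (by omega)
    have hv : ∀ j, τ (b + 11 + 2 * j) = σ (b + 11 + 2 * j) := fun j => hfr _ (by omega) (by omega)
    have hl : ∀ j, τ (b + 12 + 2 * j) = σ (b + 12 + 2 * j) := fun j => hfr _ (by omega) (by omega)
    have hSτ : StageAt b PS (radius n r E B) k τ := by
      rw [StageAt, h10]
      exact hS.congr (fun j _ => by rw [hv]) (fun j _ => by rw [hl])
    have hget : (Expr.get (b + 2) (.const 0)).Ok τ S Set.univ := by
      refine ⟨trivial, ?_, trivial⟩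
      have := hctx.sizes.le₂
      rcases hans with ⟨h, _⟩ | ⟨h, _⟩ <;> simp [Expr.val, h]
      nlinarith
    refine Runs.cond hget (c := (c₁ + c₂) * U) (fun hpos => ?_) (fun hneg => ?_)
      (by simp [Expr.weight]; nlinarith)
    · rcases hans with ⟨_, h⟩ | ⟨h, _⟩
      · refine (h₂ (hctx.mono (by omega)) τ PS hIτ hlen
          (by rw [hfr _ (by omega) (by omega)]; exact hloc) hSτ h.1 ?_).mono (fun _ h => h)
          (by nlinarith)
        simp only [h10, hv, hl]
        exact h.2
      · simp [Expr.val, h] at hpos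
    · rcases hans with ⟨h, _⟩ | ⟨_, h⟩
      · simp [Expr.val, h] at hneg
      · refine (h₁ (hctx.mono (by omega)) τ PS hIτ hSτ fun a ha hd => h a ⟨ha, ?_⟩).mono
          (fun _ h => Or.inl h) (by nlinarith)
        simp only [h10, hv, hl] at hd
        exact hd
  | succ d ih =>
    intro hd
    obtain ⟨c₄, h₄⟩ := ih (by omega)
    set i := k - (d + 1) with hi
    obtain ⟨c₅, h₅⟩ := exists_runs_choosePair n b r i (by omega) (by omega)
    obtain ⟨c₆, h₆⟩ := exists_runs_sweep b e r ch 0 (lE n b i) heb he hmods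
    set test := dotE (lE n b i) (subE (vE n b i) (oE n b)) with htest
    refine ⟨2 + test.weight + c₄ + c₅ + c₆ + (radiusE n b r).weight,
      fun {m C₀ d₀ f ε B Δ O s s₁ S U E} hctx σ PS hI hlen hloc hS => ?_⟩
    have hss := hctx.sizes.s_le
    have hs₁ := hctx.sizes.s₁_le
    have hU := hctx.sizes.S_le
    refine Runs.seq (h₅ (hctx.mono (by omega)) σ PS hI hlen hS)
      (c := (1 + test.weight + c₄ + c₆) * U) ?_ (by nlinarith)
    rintro τ ⟨hIτ, h9, hSτ, hnext, hℓR, hvX, hle, hℓh, hℓ0⟩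
    have oko : ∀ t, (oE n b t).Ok τ s₁ Set.univ := fun t =>
      (hctx.ok_oE hIτ hSτ (Set.mem_univ _) t).mono hss le_rfl
    have okv : ∀ t, (vE n b i t).Ok τ s₁ Set.univ := fun t =>
      ok_cells (Set.mem_univ _) (fun t => (hctx.bits_le hIτ hvX t).trans hss) t
    have hℓb : ∀ t, bits (readIntVec n (τ (b + 12 + 2 * i)) 0 t) ≤ s₁ := fun t =>
      hctx.bits_radius_le (b := b) (by omega) hIτ.row hIτ.three (hℓR t)
    have okl : ∀ {A : Set ℕ}, b + 12 + 2 * i ∈ A → ∀ t, (lE n b i t).Ok τ s₁ A := fun hA =>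
      ok_cells hA hℓb
    have hval : test.val τ = readIntVec n (τ (b + 12 + 2 * i)) 0 ⬝ᵥ
        (readIntVec n (τ (b + 11 + 2 * i)) 0 - readIntVec n (τ (b + 10)) 0) := by
      simp only [htest, val_dotE, val_subE, val_cells_fun, Nat.cast_zero]
    refine Runs.cond (ok_dotE (okl (Set.mem_univ _)) (ok_subE okv oko)) (c := (c₄ + c₆) * U)
      (fun hpos => ?_) (fun hneg => ?_) (by nlinarith)
    · refine (h₄ (hctx.mono (by omega)) τ PS hIτ hlen (by rw [h9]; exact hloc) ?_).mono
        (fun _ h => h) (by nlinarith)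
      rw [show k - d = i + 1 by omega]
      exact hnext (by rwa [← hval])
    -- The maximum of |ℓ ⬝ᵥ (x - o)| is zero, so the single hyperplane through o suffices (W = 0).
    -- It is proper because ℓ is nonzero and orthogonal to the equations, so that ℓ itself serves as
    -- the certificate of independence.
    · have hzero : ∀ x ∈ intPoints PS, readIntVec n (τ (b + 12 + 2 * i)) 0 ⬝ᵥ
          (x - readIntVec n (τ (b + 10)) 0) = 0 := fun x hx => by
        rw [← htest, hval, not_lt] at hneg
        exact abs_nonpos_iff.1 ((hle x hx).trans hneg)
      refine (h₆ (hctx.sizes.mono (by omega)) hctx.child τ (by rw [hIτ.row]; exact hctx.pre)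
        hIτ.three (readIntVec n (τ (b + 10)) 0) (okl (by simp; omega)) rfl hℓb
        (fun t => (hctx.bits_le hIτ hSτ.base t).trans hss)
        ⟨readIntVec n (τ (b + 12 + 2 * i)) 0, fun j hj => ?_, ?_⟩ fun z hzA hzK => ?_).mono ?_
        (by nlinarith)
      · rw [hIτ.row]; exact hℓh j hj
      · rw [val_cells_fun, Nat.cast_zero]
        exact fun h => hℓ0 (dotProduct_self_eq_zero.1 h)
      · rw [hIτ.row] at hzA
        rw [val_cells_fun, Nat.cast_zero, hzero z (hIτ.all z hzA hzK)]; simp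
      · rw [hIτ.row]; exact fun _ h => Or.inl h

/-- One round of the main loop of a level. -/
def body (n b e r k : ℕ) (ch : Prog) (M : ℕ) : Prog :=
  .seq (pQuery b (b + 2) (fun _ : Fin n => .const 0)) (.cond (.get (b + 2) (.const 0))
    (.seq (fill (b + 10) (.const 0) 0 (List.ofFn (cells n (b + 2) 1))) (steps n b e r k ch M k))
    (stopNone b))

lemma exists_runs_body (n b e r k : ℕ) (ch : Prog) (he : 4 ≤ e) (heb : e < b) (hk : r + k = n)
    (hk1 : 1 ≤ k) (hmods : ∀ y, ch.Mods y → y = 0 ∨ 4 ≤ y ∧ y < b) : ∃ M c : ℕ,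
    ∀ {m C₀ d₀ : ℕ} {f : Fin (m + 1) → (Fin n → ℝ) → ℝ} {ε : ℝ} {B Δ : ℕ} {O : Oracles n m}
    {s s₁ S U : ℕ} {E : ℤ → ℤ},
    Ctx c C₀ d₀ f ε B Δ O s s₁ S U ch e r E → ∀ (σ : State) (PS : List (Row n)),
    Inv f B S b r E PS σ → PS.length ≤ S → σ (b + 9) 0 = 1 →
    Runs O (body n b e r k ch M) σ (Round f ε B S b r k E PS) (c * U) := by
  obtain ⟨M, hM⟩ := exists_runs_steps n b e r k ch he heb hk hk1 hmods
  obtain ⟨c₁, h₁⟩ := hM k le_rfl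
  obtain ⟨c₂, h₂⟩ := exists_runs_pQuery b (b + 2) (fun _ : Fin n => .const 0) (by omega)
  obtain ⟨c₃, h₃⟩ := exists_runs_fillVec (cells n (b + 2) 1)
  refine ⟨M, 20 + c₁ + c₂ + c₃,
    fun {m C₀ d₀ f ε B Δ O s s₁ S U E} hctx σ PS hI hlen hloc => ?_⟩
  have hss := hctx.sizes.s_le
  have hs₁ := hctx.sizes.s₁_le
  have hU := hctx.sizes.S_le
  refine Runs.seq (h₂ hctx.set (hctx.sizes.mono (by omega)) σ PS hI.poly hlen hI.box
    hctx.pre.bits_B (fun _ => trivial)) (c := (19 + c₁ + c₃) * U) ?_ (by nlinarith)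
  rintro τ ⟨hfr, hP, hans, -⟩
  have hIτ : Inv f B S b r E PS τ := hI.frame (hfr _ (by omega) (by omega))
    (hfr _ (by omega) (by omega)) hP
  have hget : (Expr.get (b + 2) (.const 0)).Ok τ S Set.univ := by
    refine ⟨trivial, ?_, trivial⟩
    have := hctx.sizes.le₂
    rcases hans with ⟨h, _⟩ | ⟨h, _⟩ <;> simp [Expr.val, h]
    nlinarith
  refine Runs.cond hget (c := (10 + c₁ + c₃) * U) (fun hpos => ?_) (fun hneg => ?_)
    (by simp [Expr.weight]; nlinarith)
  · have hoX : readIntVec n (τ (b + 2)) 1 ∈ intPoints PS := by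
      rcases hans with ⟨_, h⟩ | ⟨h, _⟩
      · exact h
      · simp [Expr.val, h] at hpos
    refine Runs.seq (h₃ O (b + 10) τ s {b + 10}ᶜ (by simp) (ok_cells (by simp)
      (by rw [Nat.cast_one]; exact hctx.bits_le hIτ hoX))) (c := c₁ * U) ?_ ?_
    · rintro υ ⟨hfr', hυ⟩
      rw [val_cells_fun, Nat.cast_one] at hυ
      refine h₁ (hctx.mono (by omega)) υ PS (hIτ.frame (hfr' _ (by omega)) (hfr' _ (by omega))
        (by rw [hfr' _ (by omega)]; exact hP)) hlen
        (by rw [hfr' _ (by omega), hfr _ (by omega) (by omega)]; exact hloc) ?_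
      rw [Nat.sub_self]
      refine ⟨by rw [hυ]; exact hoX, ?_, ?_, ?_, ?_, ?_⟩ <;> exact fun j hj => by omega
    · nlinarith [Nat.mul_le_mul_left c₃ (show s + 1 ≤ U by omega)]
  · have hnone : ∀ z, z ∉ intPoints PS := by
      rcases hans with ⟨h, _⟩ | ⟨_, h⟩
      · simp [Expr.val, h] at hneg
      · exact h
    refine (runs_stopNone O b τ).mono ?_ (by nlinarith)
    rintro υ ⟨h1, h2⟩
    exact Or.inl ⟨h1, Or.inr ⟨h2, fun z hzA hzK => hnone z (hI.all z hzA hzK)⟩⟩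

/-! ## The main loop -/

/-- Bernoulli's inequality (1 + 1/L)^(L+1) ≥ 2, with denominators cleared. The auxiliary induction
is used for exponent L + 1. -/
lemma two_mul_pow_le (L : ℕ) : 2 * L ^ (L + 1) ≤ (L + 1) ^ (L + 1) := by
  rcases Nat.eq_zero_or_pos L with rfl | hL
  · simp
  have h : ∀ m : ℕ, (L + m) * L ^ m ≤ L * (L + 1) ^ m := by
    intro m
    induction m with
    | zero => simp
    | succ m ih =>
      calc (L + (m + 1)) * L ^ (m + 1) ≤ (L + m) * L ^ m * (L + 1) := by
            rw [pow_succ]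
            nlinarith [Nat.zero_le (m * L ^ m)]
        _ ≤ L * (L + 1) ^ m * (L + 1) := Nat.mul_le_mul_right _ ih
        _ = _ := by ring
  have h1 := h (L + 1)
  refine Nat.le_of_mul_le_mul_left (le_trans ?_ h1) hL
  nlinarith [Nat.zero_le (L ^ (L + 1))]

/-- A bound for the number of rounds. -/
def rounds (n k s : ℕ) : ℕ := 2 * (2 * scale k + 1) ^ k * (n * (s + 1) + 1)

/-- Let K = 2 (2 `scale` k + 1)^k. A round leaves at most a fraction (K - 1) / K of the points, so K
rounds at least halve their number. Since there are at most 2^(n(s+1)) points initially, K (n (s +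
1) + 1) rounds bring the bound below 1. -/
lemma ncard_mul_pow_lt {n k s B : ℕ} {PS : List (Row n)} (h : boxRows n B ⊆ PS)
    (hB : bits B ≤ s) :
    (intPoints PS).ncard * (2 * (2 * scale k + 1) ^ k - 1) ^ rounds n k s <
      (2 * (2 * scale k + 1) ^ k) ^ rounds n k s := by
  have h1 : (intPoints PS).ncard ≤ (2 * B + 1) ^ n := by
    have hsub : intPoints PS ⊆
        (Finset.Icc (fun _ => -(B : ℤ)) (fun _ => (B : ℤ)) : Finset (Fin n → ℤ)) := by
      intro z hz
      have := subset_box_of_boxRows h hz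
      rw [Finset.mem_coe, Finset.mem_Icc]
      exact ⟨fun j => (abs_le.1 (this j)).1, fun j => (abs_le.1 (this j)).2⟩
    refine (Set.ncard_le_ncard hsub (Finset.finite_toSet _)).trans (le_of_eq ?_)
    rw [Set.ncard_coe_finset, Pi.card_Icc]
    simp only [Int.card_Icc, Finset.prod_const, Finset.card_univ, Fintype.card_fin]
    congr 1; omega
  have h2 : (2 * B + 1) ^ n ≤ 2 ^ (n * (s + 1)) := by
    rw [mul_comm n, pow_mul]
    refine Nat.pow_le_pow_left ?_ n
    have := bits_le_iff.1 hB
    rw [Int.natAbs_natCast] at this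
    rw [pow_succ]; omega
  obtain ⟨L, hL⟩ : ∃ L, 2 * (2 * scale k + 1) ^ k = L + 1 :=
    ⟨2 * (2 * scale k + 1) ^ k - 1, by
      have : 0 < (2 * scale k + 1) ^ k := by positivity
      omega⟩
  rw [rounds, hL, Nat.add_sub_cancel]
  set q := n * (s + 1) with hq
  have hL1 : 1 ≤ L := by
    have : 0 < (2 * scale k + 1) ^ k := by positivity
    omega
  calc (intPoints PS).ncard * L ^ ((L + 1) * (q + 1)) ≤ 2 ^ q * L ^ ((L + 1) * (q + 1)) :=
        Nat.mul_le_mul_right _ (h1.trans h2)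
    _ < 2 ^ (q + 1) * L ^ ((L + 1) * (q + 1)) := by
        refine Nat.mul_lt_mul_of_pos_right ?_ (by positivity)
        rw [pow_succ]
        have : 0 < 2 ^ q := by positivity
        omega
    _ = (2 * L ^ (L + 1)) ^ (q + 1) := by rw [mul_pow, pow_mul]
    _ ≤ ((L + 1) ^ (L + 1)) ^ (q + 1) := Nat.pow_le_pow_left (two_mul_pow_le L) _
    _ = _ := by rw [pow_mul]

/-- The inequality for the cardinality is a potential: after T further shrinking rounds fewer than
one point would be left. At T = 0 the polytope has no integer point, and the round must stop,
because a continuing round exhibits one. The bound N on the number of rows includes the cuts still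
to come. -/
lemma runs_loop {n m : ℕ} {f : Fin (m + 1) → (Fin n → ℝ) → ℝ} {ε : ℝ} {B S b r k V : ℕ}
    {E : ℤ → ℤ} {O : Oracles n m} {p : Prog} {N : ℕ}
    (hp : ∀ (σ : State) (PS : List (Row n)), Inv f B S b r E PS σ → PS.length ≤ N →
      σ (b + 9) 0 = 1 → Runs O p σ (Round f ε B S b r k E PS) V) (T : ℕ) :
    ∀ (σ : State) (PS : List (Row n)), Inv f B S b r E PS σ → PS.length + T ≤ N →
      σ (b + 9) 0 = 1 → (intPoints PS).ncard * (2 * (2 * scale k + 1) ^ k - 1) ^ T <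
        (2 * (2 * scale k + 1) ^ k) ^ T →
      Runs O (.loop (.get (b + 9) (.const 0)) p) σ (Post f ε (eqs n E r)) ((T + 2) * (V + 5)) := by
  have hdone : ∀ τ : State, τ (b + 9) 0 = 0 → Post f ε (eqs n E r) τ →
      Runs O (.loop (.get (b + 9) (.const 0)) p) τ (Post f ε (eqs n E r)) 3 := by
    intro τ h0 hpost
    refine ⟨τ, _, .loop_neg (by simp [Expr.val, h0]), ?_, hpost⟩
    simp [Expr.cost, Expr.val, h0]
  have hgo : ∀ {σ τ : State} {t W : ℕ}, σ (b + 9) 0 = 1 → Exec O p σ τ t → t ≤ V →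
      Runs O (.loop (.get (b + 9) (.const 0)) p) τ (Post f ε (eqs n E r)) W →
      Runs O (.loop (.get (b + 9) (.const 0)) p) σ (Post f ε (eqs n E r)) (V + 5 + W) := by
    rintro σ τ t W h1 hex ht ⟨υ, t', h2, h3, h4⟩
    refine ⟨υ, _, .loop_pos (by simp [Expr.val, h1]) hex h2, ?_, h4⟩
    have : (Expr.get (b + 9) (.const 0)).cost σ = 3 := by simp [Expr.cost, Expr.val, h1]
    omega
  induction T with
  | zero =>
    intro σ PS hI hlen hloc hcard
    obtain ⟨τ, t, hex, ht, hround⟩ := hp σ PS hI hlen hloc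
    rcases hround with ⟨h0, hpost⟩ | ⟨_, hne, _⟩
    · exact (hgo hloc hex ht (hdone τ h0 hpost)).mono (fun _ h => h) (by nlinarith)
    · have := (Set.ncard_pos (finite_intPoints hI.box)).2 hne
      rw [pow_zero, pow_zero] at hcard
      omega
  | succ T ih =>
    intro σ PS hI hlen hloc hcard
    obtain ⟨τ, t, hex, ht, hround⟩ := hp σ PS hI (by omega) hloc
    rcases hround with ⟨h0, hpost⟩ | ⟨h1, _, q, hI', hq⟩
    · exact (hgo hloc hex ht (hdone τ h0 hpost)).mono (fun _ h => h) (by nlinarith)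
    · refine (hgo hloc hex ht (ih τ (PS ++ [q]) hI' (by simp; omega) h1 ?_)).mono (fun _ h => h)
        (by nlinarith)
      set K := 2 * (2 * scale k + 1) ^ k with hK
      have hK1 : 1 ≤ K := by
        have : 0 < (2 * scale k + 1) ^ k := by positivity
        omega
      obtain ⟨L, hL⟩ : ∃ L, K = L + 1 := ⟨K - 1, by omega⟩
      rw [hL, Nat.add_sub_cancel] at hcard ⊢
      rw [hL] at hq
      have h2 : (L + 1) * (intPoints (PS ++ [q])).ncard ≤ L * (intPoints PS).ncard := by
        have : (L + 1) * (intPoints PS).ncard = L * (intPoints PS).ncard + (intPoints PS).ncard := by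
          ring
        omega
      refine Nat.lt_of_mul_lt_mul_left (a := L + 1) ?_
      calc (L + 1) * ((intPoints (PS ++ [q])).ncard * L ^ T)
          = ((L + 1) * (intPoints (PS ++ [q])).ncard) * L ^ T := by ring
        _ ≤ (L * (intPoints PS).ncard) * L ^ T := Nat.mul_le_mul_right _ h2
        _ = (intPoints PS).ncard * L ^ (T + 1) := by ring
        _ < (L + 1) ^ (T + 1) := hcard
        _ = _ := by ring


/-! ## Written arrays -/

lemma mods_sweep {n b e r W : ℕ} {ch : Prog} {v : Fin n → Expr} (heb : e < b) (he : 4 ≤ e)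
    (hmods : ∀ y, ch.Mods y → y = 0 ∨ 4 ≤ y ∧ y < b) {y : ℕ} (h : (sweep b e r ch W v).Mods y) :
    y = 0 ∨ 4 ≤ y ∧ y < b + 12 + 2 * n := by
  rcases h with h | h | h
  · have : y = b + 9 := h
    omega
  · have := eq_of_mods_fill h; omega
  · have := mods_sweepLoop heb he hmods h; omega

lemma mods_stopNone {b y : ℕ} (h : (stopNone b).Mods y) : y = 0 ∨ y = b + 9 := by
  rcases h with h | h
  · exact Or.inr h
  · exact Or.inl h

lemma mods_stopSome {n b y : ℕ} {z : Fin n → Expr} (h : (stopSome b z).Mods y) :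
    y = 0 ∨ y = b + 9 := by
  rcases h with h | h
  · exact Or.inr h
  · exact Or.inl (eq_of_mods_fill h)

lemma mods_setPair {n b i y : ℕ} {u g : Fin n → Expr} (h : (setPair b i u g).Mods y) :
    y = b + 11 + 2 * i ∨ y = b + 12 + 2 * i := by
  rcases h with h | h
  · exact Or.inl (eq_of_mods_fill h)
  · exact Or.inr (eq_of_mods_fill h)

lemma mods_cut {n b e r k : ℕ} {ch : Prog} (heb : e < b) (he : 4 ≤ e)
    (hmods : ∀ y, ch.Mods y → y = 0 ∨ 4 ≤ y ∧ y < b) {y : ℕ} (h : (cut n b e r k ch).Mods y) :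
    y = 0 ∨ 4 ≤ y ∧ y < b + 12 + 2 * n := by
  rcases h with h | (((h | h) | h | h) | h) | h
  · have := eq_or_eq_of_mods_sepQuery h; omega
  · have := eq_of_mods_fill h; omega
  · have := hmods y h; omega
  · have : y = b + 9 := h
    omega
  · have := eq_or_eq_of_mods_appendRow h; omega
  · have := mods_stopNone h; omega
  · have := mods_stopSome h; omega

lemma mods_steps {n b e r k M d : ℕ} {ch : Prog} (heb : e < b) (he : 4 ≤ e) (hk : k ≤ n)
    (hmods : ∀ y, ch.Mods y → y = 0 ∨ 4 ≤ y ∧ y < b) (hd : d ≤ k) {y : ℕ}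
    (h : (steps n b e r k ch M d).Mods y) : y = 0 ∨ 4 ≤ y ∧ y < b + 12 + 2 * n := by
  induction d with
  | zero =>
    rcases h with h | h | h | h
    · have := eq_or_eq_of_mods_search h; omega
    · exact mods_cut heb he hmods h
    · have := eq_or_eq_of_mods_search h; omega
    · exact mods_sweep heb he hmods h
  | succ d ih =>
    rcases h with (h | h | h | h | h) | h | h
    · have := eq_or_eq_of_mods_search h; omega
    · have := eq_or_eq_of_mods_pQuery h; omega
    · have := eq_or_eq_of_mods_pQuery h; omega
    · have := mods_setPair h; omega
    · have := mods_setPair h; omega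
    · exact ih (by omega) h
    · exact mods_sweep heb he hmods h

lemma mods_body {n b e r k M : ℕ} {ch : Prog} (heb : e < b) (he : 4 ≤ e) (hk : k ≤ n)
    (hmods : ∀ y, ch.Mods y → y = 0 ∨ 4 ≤ y ∧ y < b) {y : ℕ}
    (h : (body n b e r k ch M).Mods y) : y = 0 ∨ 4 ≤ y ∧ y < b + 12 + 2 * n := by
  rcases h with h | (h | h) | h
  · have := eq_or_eq_of_mods_pQuery h; omega
  · have := eq_of_mods_fill h; omega
  · exact mods_steps heb he hk hmods le_rfl h
  · have := mods_stopNone h; omega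

/-! ### Recursion on the dimension and the final bound. -/

/-! ## The levels -/

/-- The first array of the level of dimension `k`. -/
def levelBase (n k : ℕ) : ℕ := 4 + k * (2 * n + 12)

/-- The program solves the problem in affine spaces of dimension `k` in polynomial time. -/
def Solves (n k : ℕ) (p : Prog) : Prop :=
  (∀ y, p.Mods y → y = 0 ∨ 4 ≤ y ∧ y < levelBase n (k + 1)) ∧
  ∀ C₀ d₀ : ℕ, ∃ g : ℕ → ℕ, PolyBdd g ∧ ∀ {m : ℕ} {f : Fin (m + 1) → (Fin n → ℝ) → ℝ} {ε : ℝ}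
    {B Δ : ℕ} {O : Oracles n m}, Setting C₀ d₀ f ε B Δ O → ∀ r s : ℕ, r + k = n →
      ChildOk f ε B Δ O p (levelBase n k) r s (g s)

/-- In each round, boundedly many child calls get inputs of S(s) digits, and there are T(s) + 1
rounds at most. The cost is a composition of polynomially bounded functions; the polynomials depend
on C₀ and d₀, the program does not. -/
lemma exists_solves_succ {n k : ℕ} (hk : k + 1 ≤ n) {ch : Prog} (hch : Solves n k ch) :
    ∃ p, Solves n (k + 1) p := by
  set e := levelBase n k with he
  set b := levelBase n (k + 1) with hb
  obtain ⟨r, hr⟩ : ∃ r, r + (k + 1) = n := ⟨n - (k + 1), by omega⟩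
  -- Arrays of a level: b holds the equations, b + 1 the polytope, b + 9 the loop flag, b + 10 the
  -- point o, then the pairs (v i, ℓ i); the remaining ones up to b + 9 are for queries, answers and
  -- the sweep direction. As there are at most n pairs, 12 + 2n arrays suffice.
  have hbe : b = e + 12 + 2 * n := by rw [hb, he, levelBase, levelBase]; ring
  have he4 : 4 ≤ e := by rw [he, levelBase]; omega
  have heb : e < b := by omega
  have hb' : levelBase n (k + 1 + 1) = b + 12 + 2 * n := by rw [hb, levelBase, levelBase]; ring
  obtain ⟨hmods, hrun⟩ := hch
  obtain ⟨M, c₁, h₁⟩ := exists_runs_body n b e r (k + 1) ch he4 heb hr (by omega) hmods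
  obtain ⟨c₂, h₂⟩ := exists_runs_initPolytope n b r (by omega)
  set p := body n b e r (k + 1) ch M with hp
  refine ⟨.seq (initPolytope n b r) (.seq (.assign (b + 9) (.const 0) (.const 1))
    (.loop (.get (b + 9) (.const 0)) p)), ?_, fun C₀ d₀ => ?_⟩
  · rintro y (h | h | h)
    · have := eq_of_mods_fill h; omega
    · have : y = b + 9 := h
      omega
    · rw [hb']; exact mods_body heb he4 hk hmods h
  obtain ⟨g, hg, hgrun⟩ := hrun C₀ d₀
  set c := c₁ + c₂ with hc
  let s₁ : ℕ → ℕ := fun s => (c + 1) * (s + 1) + C₀ * (c * (s + 1)) ^ d₀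
  let T : ℕ → ℕ := fun s => rounds n (k + 1) s
  -- Besides the digits of derived rows, S bounds the number of rows the polytope ever has: 2n + 2r
  -- at the start and one more per round.
  let S : ℕ → ℕ := fun s => (c + 1) * (s₁ s + 1) + (2 * n + 2 * r) + T s
  let U : ℕ → ℕ := fun s => (S s + 1) ^ 2 + g (S s)
  have ps₁ : PolyBdd s₁ :=
    ((PolyBdd.const _).mul (PolyBdd.id.add (.const 1))).add
      ((PolyBdd.const _).mul (((PolyBdd.const _).mul (PolyBdd.id.add (.const 1))).pow _))
  have pT : PolyBdd T :=
    (PolyBdd.const (2 * (2 * scale (k + 1) + 1) ^ (k + 1))).mul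
      (((PolyBdd.const n).mul (PolyBdd.id.add (.const 1))).add (.const 1))
  have pS : PolyBdd S := (((PolyBdd.const _).mul (ps₁.add (.const 1))).add (.const _)).add pT
  have pU : PolyBdd U := ((pS.add (.const 1)).pow 2).add (hg.comp pS)
  refine ⟨fun s => (T s + 2) * (c₁ * U s + 5) + (c₂ * U s + 10),
    ((pT.add (.const 2)).mul (((PolyBdd.const _).mul pU).add (.const 5))).add
      (((PolyBdd.const _).mul pU).add (.const 10)),
    fun {m f ε B Δ O} hset r' s hr' => ?_⟩
  obtain rfl : r' = r := by omega
  intro E σ hpre hσ h3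
  have hsizes : Sizes c C₀ d₀ s (s₁ s) (S s) (U s) :=
    ⟨Nat.le_add_right _ _, Nat.le_add_left _ _, by simp only [S]; omega, Nat.le_add_right _ _⟩
  have hchild : ChildOk f ε B Δ O ch e (r' + 1) (S s) (U s) := fun E' τ h1 h2 h3 =>
    (hgrun hset (r' + 1) (S s) (by omega) E' τ h1 h2 h3).mono (fun _ h => h) (Nat.le_add_left _ _)
  have hctx : Ctx c C₀ d₀ f ε B Δ O s (s₁ s) (S s) (U s) ch e r' E := ⟨hset, hsizes, hchild, hpre⟩
  refine Runs.seq (h₂ (hsizes.mono (by omega)) σ (by rw [hσ]; exact hpre) h3)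
    (c := (T s + 2) * (c₁ * U s + 5) + 5) ?_ (by simp only; omega)
  rintro τ ⟨hfr, PS, hP, hPlen, hPbox, hPX⟩
  rw [hσ] at hPX
  refine Runs.seq (Runs.assign (s := 0) (A := Set.univ) (b := 4) (Q := fun τ => τ = _) trivial
    trivial rfl (by simp [Expr.weight])) (c := (T s + 2) * (c₁ * U s + 5)) ?_ (by omega)
  rintro υ rfl
  refine runs_loop (N := S s) (V := c₁ * U s) (fun ω PS' hI hl hloc =>
    h₁ (hctx.mono (by omega)) ω PS' hI hl hloc) (T s) _ PS ⟨?_, ?_, ?_, hPbox, ?_, ?_⟩ ?_ ?_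
    (ncard_mul_pow_lt hPbox hpre.bits_B)
  · rw [Function.update_of_ne (by omega), hfr _ (by omega), hσ]
  · rw [Function.update_of_ne (by omega), hfr _ (by omega), h3]
  · rw [Function.update_of_ne (by omega)]; exact hP
  · exact fun z hz => ((hPX z).1 hz).2
  · refine fun z hzA hzK => (hPX z).2 ⟨fun j => ?_, hzA⟩
    have := hset.subset_box hzK j
    simp only [intPoint] at this
    rw [abs_le]
    exact_mod_cast this
  · rw [hPlen]; simp only [S]; omega
  · simp [Expr.val]

/-- Solves the problem for an affine space that consists of a single point. -/
def leaf (n b : ℕ) : Prog :=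
  .seq (search (b + 3) (b + 2) (.get 3 (.const 0)) (pairE (eqE n b n))
      [(fun _ : Fin n => .const 0, .const 0)])
    (.cond (.get (b + 2) (.const 0))
      (.seq (fill (b + 4) (.const 0) 0 (.const n :: flatRows (eqE n b n)))
        (.seq (.call .feas (b + 4) (b + 5))
          (.cond (.get (b + 5) (.const 0)) (stopSome b (cells n (b + 2) 1)) (stopNone b))))
      (stopNone b))

/-- With n independent equations the space is one point. The optimization oracle tells whether it is
integral and in the box. If so, it has precision 1 ≤ Δ, so a negative answer of the feasibility
oracle excludes it from K_0, and a positive answer can only return this point, then in K_{ε/2} and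
hence in K_ε. -/
lemma exists_solves_zero (n : ℕ) : ∃ p, Solves n 0 p := by
  set b := levelBase n 0 with hb
  have hb4 : b = 4 := by rw [hb, levelBase]; omega
  have hb' : levelBase n (0 + 1) = b + 12 + 2 * n := by rw [hb, levelBase, levelBase]; ring
  obtain ⟨c₁, h₁⟩ := exists_runs_search (.get 3 (.const 0)) (pairE (eqE n b n))
    [(fun _ : Fin n => .const 0, .const 0)]
  set L : List Expr := .const n :: flatRows (eqE n b n) with hL
  obtain ⟨c₂, h₂⟩ := exists_runs_fill (.const 0) L 0
  obtain ⟨c₃, h₃⟩ := exists_runs_stopSome b (cells n (b + 2) 1)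
  set W := (L.map fun e => 1 + e.weight).sum with hW
  refine ⟨leaf n b, ?_, fun C₀ d₀ => ⟨fun s => (c₁ + c₂ + W + c₃ + 40 + 4 * n) * (s + 1),
    (PolyBdd.const _).mul (PolyBdd.id.add (.const 1)), ?_⟩⟩
  · rintro y (h | (h | h | h | h) | h)
    · have := eq_or_eq_of_mods_search h; omega
    · have := eq_of_mods_fill h; omega
    · have : y = b + 5 := h
      omega
    · have := mods_stopSome h; omega
    · have := mods_stopNone h; omega
    · have := mods_stopNone h; omega
  intro m f ε B Δ O hset r s hr E σ hpre hσ h3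
  have hrn : r = n := by omega
  rw [hrn] at hpre ⊢
  have hpreσ : LevelPre n n (σ b) B Δ s := by rw [hσ]; exact hpre
  refine Runs.seq (h₁ hset.valid (b + 3) (b + 2) σ s {b + 3, b + 2}ᶜ (by simp) (by simp)
    ⟨by simp; omega, by simp only [Expr.val, h3]; exact hpre.bits_B, trivial⟩
    (ok_pairE (ok_eqE hpreσ (by simp))) (fun q hq => by
      rw [List.mem_singleton.1 hq]; exact ⟨fun _ => trivial, trivial⟩))
    (c := (c₂ + W + c₃ + 36 + 4 * n) * (s + 1)) ?_ (by simp only; nlinarith)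
  rintro τ ⟨hfr, hans⟩
  have hiff : ∀ z : Fin n → ℤ, ((∀ j, |z j| ≤ (Expr.get 3 (.const 0)).val σ) ∧
      (∀ q ∈ pairE (eqE n b n), (q.val σ).1 ⬝ᵥ z ≤ (q.val σ).2) ∧
      ∃ q ∈ [((fun _ : Fin n => Expr.const 0, Expr.const 0) : RowE n)],
        (RowE.val σ q).1 ⬝ᵥ z ≤ (RowE.val σ q).2) ↔
      (∀ j, |z j| ≤ B) ∧ intPoint z ∈ affineSpace (eqs n E n) := by
    intro z
    rw [forall_mem_pairE, forall_mem_eqE, hσ]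
    simp only [Expr.val, h3]
    refine and_congr_right fun _ => and_iff_left ⟨_, List.mem_singleton_self _, ?_⟩
    simp [RowE.val, Expr.val, dotProduct]
  replace hans := hans.congr hiff
  have hget : (Expr.get (b + 2) (.const 0)).Ok τ (s + 1) Set.univ := by
    refine ⟨trivial, ?_, trivial⟩
    rcases hans with ⟨h, _⟩ | ⟨h, _⟩ <;> simp [Expr.val, h]
  refine Runs.cond hget (c := (c₂ + W + c₃ + 24 + 4 * n) * (s + 1)) (fun hpos => ?_)
    (fun hneg => ?_) (by simp [Expr.weight]; nlinarith)
  swap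
  · have hnone : ∀ z : Fin n → ℤ, ¬ ((∀ j, |z j| ≤ B) ∧ intPoint z ∈ affineSpace (eqs n E n)) := by
      rcases hans with ⟨h, _⟩ | ⟨_, h⟩
      · simp [Expr.val, h] at hneg
      · exact h
    refine (runs_stopNone O b τ).mono ?_ (by nlinarith)
    rintro υ ⟨_, h0⟩
    refine Or.inr ⟨h0, fun z hzA hzK => hnone z ⟨fun j => ?_, hzA⟩⟩
    have := hset.subset_box hzK j
    simp only [intPoint] at this
    rw [abs_le]
    exact_mod_cast this
  obtain ⟨hzB, hzA⟩ : (∀ j, |readIntVec n (τ (b + 2)) 1 j| ≤ B) ∧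
      intPoint (readIntVec n (τ (b + 2)) 1) ∈ affineSpace (eqs n E n) := by
    rcases hans with ⟨_, h⟩ | ⟨h, _⟩
    · exact h
    · simp [Expr.val, h] at hpos
  set z := readIntVec n (τ (b + 2)) 1 with hz
  have hzb : ∀ j, bits (z j) ≤ s := fun j => (bits_le_of_abs_le (hzB j)).trans hpre.bits_B
  have hτb : τ b = E := by rw [hfr _ (by omega) (by omega), hσ]
  have hpreτ : LevelPre n n (τ b) B Δ s := by rw [hτb]; exact hpre
  have hok : ∀ q ∈ L, q.Ok τ s {b + 4}ᶜ := by
    intro q hq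
    rcases List.mem_cons.1 hq with rfl | hq
    · trivial
    · exact ok_flatRows (ok_eqE hpreτ (by simp)) q hq
  refine Runs.seq (h₂ O (b + 4) τ s {b + 4}ᶜ (by simp) trivial hok)
    (c := (W + c₃ + 22 + 4 * n) * (s + 1)) ?_ (by nlinarith)
  rintro τ' rfl
  set A := eqs n E n with hA
  have hLval : L.map (Expr.val τ) = (n : ℤ) :: flatRows A := by
    rw [hL, List.map_cons, map_flatRows, map_val_eqE, hτb]; rfl
  rw [hLval]
  set ρ : State := Function.update τ (b + 4) (writeAt (τ (b + 4))
    ((Expr.const 0).val τ + ((0 : ℕ) : ℤ)) ((n : ℤ) :: flatRows A)) with hρ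
  have hholds : Holds (ρ (b + 4)) 0 ((n : ℤ) :: flatRows A) := by
    simp only [hρ, Function.update_self, Expr.val, Nat.cast_zero, add_zero]
    exact holds_writeAt _ _ _
  have hh := hholds
  rw [holds_cons, zero_add] at hh
  obtain ⟨h0, h1⟩ := hh
  have hqs : querySize n (ρ (b + 4)) .feas ≤ W * (s + 1) := by
    rw [querySize_of_holds hholds]
    · rw [← hLval]; exact listSize_map_val_le hok
    · rw [queryLength, h0, Int.toNat_natCast]
      simp [length_flatRows, hA]; ring
  have hreply : O.reply (ρ (b + 4)) .feas = encodeOption encodeRat (O.feas A) := by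
    simp only [Oracles.reply, h0, Int.toNat_natCast]
    have h4 := holds_flatRows.1 h1
    rw [hA, length_eqs] at h4
    rw [h4]
  have hunique : ∀ x ∈ affineSpace A, x = intPoint z := by
    intro x hx
    -- A frame without edges: vectors orthogonal to n independent rows are zero.
    have F : Frame (fun j : Fin n => (hrow n E j).1) (fun j : Fin 0 => (0 : Fin n → ℤ))
        (fun j : Fin 0 => (0 : Fin n → ℤ)) :=
      ⟨rfl, hpre.indep, fun _ j => j.elim0, fun i => i.elim0, fun i => i.elim0, fun i => i.elim0⟩
    obtain ⟨μ, hμ⟩ := F.exists_real_coordinates (x := x - intPoint z) fun l => by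
      rw [dotProduct_sub, intPoint_dotProduct, mem_affineSpace_eqs.1 hzA l l.2, sub_eq_zero]
      exact hx _ (List.mem_map_of_mem (List.mem_range.2 l.2))
    rw [Finset.univ_eq_empty, Finset.sum_empty, sub_eq_zero] at hμ
    exact hμ
  have hsome : ∀ x, O.feas A = some x → x = fun j => (z j : ℚ) := by
    intro x hx
    have h4 := hunique _ (hset.valid.feas_some A x hx).2.1
    rw [← ratPoint_intCast] at h4
    funext j
    have := congrFun h4 j
    simp only [ratPoint] at this
    exact_mod_cast this
  have hrs : listSize (O.reply (ρ (b + 4)) .feas) ≤ (3 + 4 * n) * (s + 1) := by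
    rw [hreply]
    cases hx : O.feas A with
    | none => simp [encodeOption, listSize]; nlinarith
    | some x =>
      rw [hsome x hx]
      have h4 : listSize (encodeRat fun j => (z j : ℚ)) ≤ 2 * n * (s + 1 + 1) := by
        rw [← length_encodeRat fun j => (z j : ℚ)]
        refine listSize_le fun y hy => ?_
        rw [encodeRat_intCast] at hy
        obtain ⟨y', hy', hy⟩ := List.mem_flatMap.1 hy
        obtain ⟨j, rfl⟩ := (List.mem_ofFn' _ _).1 hy'
        simp only [List.mem_cons, List.not_mem_nil, or_false] at hy
        rcases hy with rfl | rfl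
        · exact (hzb j).trans (Nat.le_succ s)
        · simp
      simp only [encodeOption, listSize, List.map_cons, List.sum_cons, bits_one] at h4 ⊢
      nlinarith
  refine Runs.seq (runs_call O .feas (b + 4) (b + 5) ρ hqs hrs)
    (c := (c₃ + 15) * (s + 1)) ?_ (by nlinarith)
  rintro υ rfl
  rw [hreply]
  set ω : State := Function.update ρ (b + 5)
    (writeList (ρ (b + 5)) (encodeOption encodeRat (O.feas A))) with hω
  have hω5 : Holds (ω (b + 5)) 0 (encodeOption encodeRat (O.feas A)) := by
    rw [hω, Function.update_self]; exact holds_writeList _ _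
  have hω2 : readIntVec n (ω (b + 2)) 1 = z := by
    rw [hω, Function.update_of_ne (by omega), hρ, Function.update_of_ne (by omega)]
  have hω50 : ω (b + 5) 0 = 0 ∨ ω (b + 5) 0 = 1 := by
    cases hx : O.feas A with
    | none =>
      rw [hx] at hω5
      exact Or.inl (holds_singleton.1 hω5)
    | some x =>
      rw [hx] at hω5
      exact Or.inr (holds_cons.1 hω5).1
  have hget' : (Expr.get (b + 5) (.const 0)).Ok ω (s + 1) Set.univ := by
    refine ⟨trivial, ?_, trivial⟩
    rcases hω50 with h | h <;> simp [Expr.val, h]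
  refine Runs.cond hget' (c := (c₃ + 7) * (s + 1)) (fun hpos => ?_) (fun hneg => ?_)
    (by simp [Expr.weight]; nlinarith)
  · cases hx : O.feas A with
    | none =>
      rw [hx] at hω5
      simp only [Expr.val] at hpos
      rw [holds_singleton.1 hω5] at hpos
      exact absurd hpos (lt_irrefl _)
    | some x =>
      refine (h₃ O ω s (ok_cells (by simp) (by rw [Nat.cast_one, hω2]; exact hzb))).mono ?_
        (by nlinarith)
      rintro τ' ⟨_, h4, h5⟩
      refine Or.inl ⟨h4, ?_⟩
      rw [h5, val_cells_fun, Nat.cast_one, hω2, ← ratPoint_intCast, ← hsome x hx]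
      intro i
      have := (hset.valid.feas_some A x hx).2.2.1 i
      have := hset.pos
      linarith
  · cases hx : O.feas A with
    | some x =>
      rw [hx] at hω5
      simp only [Expr.val] at hneg
      rw [(holds_cons.1 hω5).1] at hneg
      exact absurd zero_lt_one hneg
    | none =>
      refine (runs_stopNone O b ω).mono ?_ (by nlinarith)
      rintro τ' ⟨_, h4⟩
      refine Or.inr ⟨h4, fun y hyA => ?_⟩
      rw [hunique _ hyA, ← ratPoint_intCast]
      refine hset.valid.feas_none A hx _ ⟨1, le_rfl, hset.one_le, fun j => ⟨z j, by simp⟩⟩ ?_ ?_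
      · intro j
        have := abs_le.1 (hzB j)
        simp only [ratPoint, Rat.cast_intCast]
        exact_mod_cast this
      · rw [ratPoint_intCast]; exact hzA

lemma exists_solves (n : ℕ) : ∀ k ≤ n, ∃ p, Solves n k p
  | 0, _ => exists_solves_zero n
  | k + 1, h => by
    obtain ⟨ch, hch⟩ := exists_solves n k (by omega)
    exact exists_solves_succ h hch

lemma bits_le_log (B : ℕ) : bits B ≤ Nat.log 2 B + 1 := by
  rw [bits_le_iff, Int.natAbs_natCast]
  exact Nat.lt_pow_succ_log_self one_lt_two B


/-- The recursion starts with no equations in dimension n. B is copied to array 3 first, since array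
0 receives the output. The program is fixed before C₀ and d₀, which enter only the cost bound. -/
theorem exists_program (n : ℕ) :
    ∃ P : Prog, ∀ C₀ d₀ : ℕ, ∃ C d : ℕ,
      ∀ (m : ℕ) (f : Fin (m + 1) → (Fin n → ℝ) → ℝ) (ε : ℝ) (B Δ : ℕ)
        (O : Oracles n m),
        (∀ i, QuasiconvexOn ℝ Set.univ (f i)) → 0 < ε → 1 ≤ B → 1 ≤ Δ →
        levelSet f 0 ⊆ box n B →
        levelSet f ε ⊆ box n B →
        O.Valid f ε B Δ → O.SepPolySize B Δ C₀ d₀ →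
        ∃ (σ : State) (t : ℕ),
          Exec O P (initState B Δ m) σ t ∧
          t ≤ C * (Nat.log 2 B + Nat.log 2 Δ + 1) ^ d ∧
          CorrectOutput f ε σ := by
  obtain ⟨p, -, hp⟩ := exists_solves n n le_rfl
  refine ⟨.seq (.assign 3 (.const 0) (.get 0 (.const 0))) p, fun C₀ d₀ => ?_⟩
  obtain ⟨g, hg, hrun⟩ := hp C₀ d₀
  -- The input size is L + 1, as B has at most log B + 1 digits. The term 6 (L + 2) pays for copying
  -- B.
  obtain ⟨C, d, hCd⟩ : PolyBdd fun L => 1 + 6 * (L + 1 + 1) + g (L + 1) :=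
    ((PolyBdd.const 1).add ((PolyBdd.const 6).mul ((PolyBdd.id.add (.const 1)).add (.const 1)))).add
      (hg.comp (PolyBdd.id.add (.const 1)))
  refine ⟨C, d, fun m f ε B Δ O _ hε _ hΔ hbox _ hO hsize => ?_⟩
  set L := Nat.log 2 B + Nat.log 2 Δ with hL
  have hset : Setting C₀ d₀ f ε B Δ O := ⟨hO, hε, hΔ, hbox, hsize⟩
  have hB : bits B ≤ L + 1 := (bits_le_log B).trans (by omega)
  have hrun' : Runs O (.seq (.assign 3 (.const 0) (.get 0 (.const 0))) p) (initState B Δ m)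
      (Post f ε (eqs n (initState B Δ m (levelBase n n)) 0))
      (1 + 6 * (L + 1 + 1) + g (L + 1)) := by
    refine Runs.seq (Runs.assign (s := L + 1) (A := Set.univ) (b := 6 * (L + 1 + 1))
      (Q := fun τ => τ = _) trivial ⟨trivial, ?_, trivial⟩ rfl ?_) ?_ le_rfl
    · simpa [Expr.val, initState] using hB
    · simp [Expr.weight]
    · rintro τ rfl
      refine hrun hset 0 (L + 1) (by omega) _ _ ⟨hB, by omega, ?_, ?_, ?_⟩ ?_ ?_
      · exact fun j hj => by omega
      · exact fun j hj => by omega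
      · exact linearIndependent_empty_type
      · rw [Function.update_of_ne]
        rw [levelBase]; omega
      · simp [Expr.val, initState]
  obtain ⟨τ, t, hex, ht, hpost⟩ := hrun'
  refine ⟨τ, t, hex, ht.trans (hCd L), ?_⟩
  rcases hpost with h | ⟨h0, h⟩
  · exact Or.inl h
  · exact Or.inr ⟨h0, fun z => h z (by simp [eqs, affineSpace])⟩

end ConvexIntMin

theorem theorem1 (n : ℕ) (hn : 1 ≤ n) :
    ∃ P : ConvexIntMin.Prog, ∀ C₀ d₀ : ℕ, ∃ C d : ℕ,
      ∀ (m : ℕ) (f : Fin (m + 1) → (Fin n → ℝ) → ℝ) (ε : ℝ) (B Δ : ℕ)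
        (O : ConvexIntMin.Oracles n m),
        (∀ i, QuasiconvexOn ℝ Set.univ (f i)) → 0 < ε → 1 ≤ B → 1 ≤ Δ →
        ConvexIntMin.levelSet f 0 ⊆ ConvexIntMin.box n B →
        ConvexIntMin.levelSet f ε ⊆ ConvexIntMin.box n B →
        O.Valid f ε B Δ → O.SepPolySize B Δ C₀ d₀ →
        ∃ (σ : ConvexIntMin.State) (t : ℕ),
          ConvexIntMin.Exec O P (ConvexIntMin.initState B Δ m) σ t ∧
          t ≤ C * (Nat.log 2 B + Nat.log 2 Δ + 1) ^ d ∧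
          ConvexIntMin.CorrectOutput f ε σ :=
  ConvexIntMin.exists_program n
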